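/- Let $n\ge 2$, $\gamma\in\mathbb R$ with $\gamma\ge-\frac{n-3}{2}$, $2<q\le\infty$ and $R>0$. Sobolev norms on $\mathcal S'(\mathbb R^n)$ are $\|f\|_{\dot H^s}^2=(2\pi)^{-n}\int|\xi|^{2s}|\hat f(\xi)|^2\,d\xi$ and $\|f\|_{H^s}^2=(2\pi)^{-n}\int(1+|\xi|^2)^{s}|\hat f(\xi)|^2\,d\xi$, with value $\infty$ unless $\hat f$ is a (locally integrable) function for which the integral is finite. Let $X$ be a normed (or seminormed) function space on $\mathbb R^n$, given by a norm $\|\cdot\|_X:\mathcal S'(\mathbb R^n)\to[0,\infty]$ (equal to $\infty$ off $X$) that is absolutely homogeneous, subadditive, and determined by its dual norm: $$\|u\|_X=\sup_{v\in\mathcal S,\ \|v\|_{X'}\le1}|\langle u,v\rangle|,\qquad \|v\|_{X'}=\sup_{\|u\|_X\le1}|\langle u,v\rangle|.$$ For $I\subset\mathbb R$ write $\|u\|_{L^q_tX(I\times\mathbb R^n)}$ for the $L^q(I)$ norm of $t\mapsto\|u(t,\cdot)\|_X$, and similarly for $L^2_tH^{\gamma-1}$. Solutions of $(\partial_t^2-\Delta)u=F$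 are $\mathcal S'(\mathbb R^n)$-valued and weak in $x$: for every Schwartz $\varphi$, $t\mapsto\langle u(t),\varphi\rangle$ is differentiable with derivative $\langle\partial_tu(t),\varphi\rangle$, $t\mapsto\langle F(t),\varphi\rangle$ is locally integrable, and $\langle\partial_tu(t),\varphi\rangle=\langle\partial_tu(0),\varphi\rangle+\int_0^t\langle\Delta u(s)+F(s),\varphi\rangle\,ds$. Assume the global free Strichartz estimate: there is a constant $C_0$ such that $$\|v\|_{L^q_tX(\mathbb R\times\mathbb R^n)}\le C_0\bigl(\|v(0,\cdot)\|_{\dot H^\gamma}+\|\partial_tv(0,\cdot)\|_{\dot H^{\gamma-1}}\bigr)$$ for every solution $v$ of $(\partial_t^2-\Delta)v=0$ on $\mathbb R\times\mathbb R^n$ whose data satisfy $v(0,\cdot)\in\dot H^\gamma$ and $\partial_tv(0,\cdot)\in\dot H^{\gamma-1}$. Then there is a constant $C$ (depending on $n,X,\gamma,q,R$ only) such that, whenever $w$ solves $$(\partial_t^2-\Delta)w=F\ \text{ on }\mathbb R_+\times\mathbb R^n,\qquad w|_{t=0}=\partial_tw|_{t=0}=0,$$ with $F\in L^2_tH^{\gamma-1}(\mathbb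 R_+\times\mathbb R^n)$ and $F(t,x)=0$ for $|x|>2R$ (in the sense of distributions in $x$, for a.e. $t>0$), we have $$\|w\|_{L^q_tX(\mathbb R_+\times\mathbb R^n)}\le C\,\|F\|_{L^2_tH^{\gamma-1}(\mathbb R_+\times\mathbb R^n)}.$$ -/

import Mathlib

open MeasureTheory Set
open scoped SchwartzMap ENNReal NNReal FourierTransform Laplacian

noncomputable section

/-- Euclidean space `ℝⁿ`. -/
abbrev Rn (n : ℕ) : Type := EuclideanSpace ℝ (Fin n)

/-- The tempered distribution `u` is the function `g`: every product `φ g` with a Schwartz function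
is integrable (so `g` is locally integrable) and `u φ = ∫ φ g`. -/
def IsRepresentedBy {n : ℕ} (u : 𝓢'(Rn n, ℂ)) (g : Rn n → ℂ) : Prop :=
  ∀ φ : 𝓢(Rn n, ℂ), Integrable (fun x => φ x * g x) ∧ u φ = ∫ x, φ x * g x

/-- The `L²` norm of `m · û` for a real weight `m`. It is `∞` if the Fourier transform of `u` is not
a function, or if it is a function but the weighted function is not in `L²`. (The function
representing `û` is unique up to null sets, so the infimum has at most one distinct value.) -/
def weightedFourierNorm {n : ℕ} (m : Rn n → ℝ) (u : 𝓢'(Rn n, ℂ)) : ℝ≥0∞ :=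
  ⨅ (g : Rn n → ℂ) (_ : IsRepresentedBy (𝓕 u) g), eLpNorm (fun ξ => m ξ • g ξ) 2 volume

/-- The norm of the homogeneous Sobolev space `Ḣˢ(ℝⁿ)`, that is `‖(-Δ)^{s/2} u‖_{L²}`. The factor
`2π` appears because Mathlib's Fourier transform has the kernel `exp(-2πi x·ξ)`. -/
def homSobolevNorm {n : ℕ} (s : ℝ) (u : 𝓢'(Rn n, ℂ)) : ℝ≥0∞ :=
  weightedFourierNorm (fun ξ => (2 * Real.pi * ‖ξ‖) ^ s) u

/-- The norm of the inhomogeneous Sobolev space `Hˢ(ℝⁿ)`, that is `‖(1-Δ)^{s/2} u‖_{L²}`. -/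
def sobolevNorm {n : ℕ} (s : ℝ) (u : 𝓢'(Rn n, ℂ)) : ℝ≥0∞ :=
  weightedFourierNorm (fun ξ => (1 + (2 * Real.pi * ‖ξ‖) ^ 2) ^ (s / 2)) u

/-- A normed space `X` of functions (or distributions) on `ℝⁿ`, given by its norm extended by `∞` to
all tempered distributions. The norm is recovered from the dual norm
`‖v‖_{X'} = sup {|u v| : ‖u‖_X ≤ 1}` by `‖u‖_X = sup {|u v| : ‖v‖_{X'} ≤ 1}`, with `v` ranging over
Schwartz functions. The pairing is bilinear; replacing `v` by its complex conjugate in both formulas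
gives the same condition for the sesquilinear pairing. Neither definiteness of the norm nor
localizability is asked for. -/
structure NormedFunctionSpace (n : ℕ) where
  /-- the norm `‖u‖_X`, equal to `∞` when `u` is not in `X` -/
  nrm : 𝓢'(Rn n, ℂ) → ℝ≥0∞
  nrm_smul : ∀ (c : ℂ) (u : 𝓢'(Rn n, ℂ)), nrm (c • u) = ‖c‖ₑ * nrm u
  nrm_add_le : ∀ u v : 𝓢'(Rn n, ℂ), nrm (u + v) ≤ nrm u + nrm v
  nrm_eq_iSup : ∀ u : 𝓢'(Rn n, ℂ),
    nrm u = ⨆ (v : 𝓢(Rn n, ℂ)) (_ : (⨆ (u' : 𝓢'(Rn n, ℂ)) (_ : nrm u' ≤ 1), ‖u' v‖ₑ) ≤ 1), ‖u v‖ₑ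

/-- The `L^q_t` norm over the time set `I` of `t ↦ N (u t)`. -/
def timeNorm {n : ℕ} (N : 𝓢'(Rn n, ℂ) → ℝ≥0∞) (q : ℝ≥0∞) (I : Set ℝ) (u : ℝ → 𝓢'(Rn n, ℂ)) :
    ℝ≥0∞ :=
  eLpNorm (fun t => N (u t)) q (volume.restrict I)

/-- `u` solves `(∂_t² - Δ) u = F` on `I × ℝⁿ`, where `I ∋ 0` is a time interval, with time
derivative `∂_t u = u'`, in the weak sense in `x`: for every Schwartz function `φ`, the function
`t ↦ ⟨u t, φ⟩` has the derivative `⟨u' t, φ⟩` on `I`, and `⟨u' t, φ⟩` is the primitive of the locally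
integrable function `⟨Δ (u t) + F t, φ⟩`. -/
def IsWaveSolutionOn {n : ℕ} (I : Set ℝ) (u u' F : ℝ → 𝓢'(Rn n, ℂ)) : Prop :=
  ∀ φ : 𝓢(Rn n, ℂ), ∀ t ∈ I,
    HasDerivWithinAt (fun s => u s φ) (u' t φ) I t ∧
    IntervalIntegrable (fun s => F s φ) volume 0 t ∧
    u' t φ = u' 0 φ + ∫ s in (0 : ℝ)..t, ((Δ (u s)) φ + F s φ)

/-- The global abstract Strichartz estimate for the free wave equation on `ℝ × ℝⁿ`:
`‖v‖_{L^q_t X} ≲ ‖v(0)‖_{Ḣ^γ} + ‖∂_t v(0)‖_{Ḣ^{γ-1}}` for all solutions of `(∂_t² - Δ) v = 0` with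
Cauchy data in `Ḣ^γ × Ḣ^{γ-1}`. -/
def FreeStrichartz {n : ℕ} (X : NormedFunctionSpace n) (γ : ℝ) (q : ℝ≥0∞) : Prop :=
  ∃ C : ℝ≥0, ∀ v v' : ℝ → 𝓢'(Rn n, ℂ), IsWaveSolutionOn univ v v' 0 →
    homSobolevNorm γ (v 0) < ∞ → homSobolevNorm (γ - 1) (v' 0) < ∞ →
    timeNorm X.nrm q univ v ≤ C * (homSobolevNorm γ (v 0) + homSobolevNorm (γ - 1) (v' 0))

end

/-! Write |D| for √(-Δ) and f(s, ξ) for the Fourier transform of F(s). For a fixed time set J, the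
wave ∫_J sin((t-s)|D|)/|D| F(s) ds is a free wave in t: the subtraction formulas for sine and cosine
separate t from s, and the data at t = 0 are -∫_J sin(s|D|)/|D| F(s) ds and ∫_J cos(s|D|) F(s) ds.
The free Strichartz estimate therefore applies as soon as these data are bounded in Ḣ^γ × Ḣ^{γ-1} by
the L²(J; H^{γ-1}) norm of F, with a constant independent of J.

That bound is the heart of the matter (`exists_homSobolevNorm_wave_le`). Both weighted data are
|ξ|^{γ-1} times a sine or cosine transform in time of f(·, ξ), taken at the frequency ρ = |ξ|, so a
space-time Fourier transform is restricted to the cone, on which an L² bound alone says nothing.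
Compact support of F in space rescues this: f(s, ·) is reproduced by convolution with a fixed
Schwartz function ψ, so the value on the cone is an average over η with ρ = |ξ| kept fixed.
Cauchy–Schwarz and polar coordinates in ξ leave the sphere estimate ρ^{n-1+2(γ-1)} ∫ |ψ(η-ρω)| dσ(ω)
≲ (1+|η|)^{2(γ-1)} (`exists_toSphere_bound`), and Plancherel in time for each fixed η finishes
(`exists_lintegral_oscInt_le`). The sphere estimate is where n-1+2(γ-1) ≥ 0, that is γ ≥ -(n-3)/2,
is used: it controls small ρ. For large ρ the sphere is thickened to a shell of unit width.

The solution w(t) is the wave generated on J = (0, t] evaluated at the same t, so J varies with t.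
The Christ–Kiselev argument (`ForcedFamily.timeNorm_le`) removes this dependence. At generation i,
(0, T] is cut into 2^i pieces carrying equal shares of the energy ∫ ‖F(s)‖² ds, and (0, t] is, up to
an error tending to 0 weakly, a disjoint union of at most one piece from each generation. The pieces
of generation i cost 2^{i/q} by summation in ℓ^q and gain 2^{-i/2} from their energy; the resulting
geometric series converges because q > 2. The duality formula for the norm of X gives the lower
semicontinuity needed in the limit.

Since w is only a weak solution with distributional values, Duhamel's formula needs a proof
(`IsWaveSolutionOn.fourier_eq`). It rests on a uniqueness theorem for V'' = pV in 𝓢', obtained by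
iterating the integrated equation on compactly supported test functions, and on a jointly measurable
choice of f (`exists_fourier_forcing`). -/

open Filter Topology

/-! ### Absolutely convergent series in the Schwartz space. -/

section SchwartzSeries

variable {E F : Type*} [NormedAddCommGroup E] [NormedSpace ℝ E] [NormedAddCommGroup F]
  [NormedSpace ℝ F]

/-- A series of Schwartz functions converges if it converges absolutely for every seminorm. -/
theorem SchwartzMap.exists_hasSum_of_summable_seminorm [CompleteSpace F] {f : ℕ → 𝓢(E, F)}
    (h : ∀ k n, Summable fun i => SchwartzMap.seminorm ℝ k n (f i)) : ∃ g, HasSum f g := by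
  have hd : ∀ (k n i : ℕ) (x : E), ‖x‖ ^ k * ‖iteratedFDeriv ℝ n (f i) x‖ ≤
      SchwartzMap.seminorm ℝ k n (f i) := fun k n i x => SchwartzMap.le_seminorm ℝ k n (f i) x
  have hd0 : ∀ (n i : ℕ) (x : E), ‖iteratedFDeriv ℝ n (f i) x‖ ≤
      SchwartzMap.seminorm ℝ 0 n (f i) := fun n i x => by simpa using hd 0 n i x
  have hsm : ContDiff ℝ ((⊤ : ℕ∞) : WithTop ℕ∞) fun x => ∑' i, f i x :=
    contDiff_tsum (v := fun n i => SchwartzMap.seminorm ℝ 0 n (f i))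
      (fun i => (f i).smooth _) (fun k _ => h 0 k) (fun k i x _ => hd0 k i x)
  have hder : ∀ (n : ℕ) (x : E), iteratedFDeriv ℝ n (fun y => ∑' i, f i y) x =
      ∑' i, iteratedFDeriv ℝ n (f i) x := fun n x =>
    iteratedFDeriv_tsum_apply (N := ⊤) (v := fun n i => SchwartzMap.seminorm ℝ 0 n (f i))
      (fun i => (f i).smooth _) (fun k _ => h 0 k) (fun k i x _ => hd0 k i x) le_top x
  have hsum : ∀ (n : ℕ) (x : E), Summable fun i => iteratedFDeriv ℝ n (f i) x := fun n x =>
    .of_norm_bounded (h 0 n) fun i => hd0 n i x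
  let g : 𝓢(E, F) :=
    { toFun := fun x => ∑' i, f i x
      smooth' := hsm
      decay' := fun k n => by
        refine ⟨∑' i, SchwartzMap.seminorm ℝ k n (f i), fun x => ?_⟩
        rw [hder]
        have hs : Summable fun i => ‖x‖ ^ k • iteratedFDeriv ℝ n (f i) x :=
          (hsum n x).const_smul _
        calc ‖x‖ ^ k * ‖∑' i, iteratedFDeriv ℝ n (f i) x‖
            = ‖∑' i, ‖x‖ ^ k • iteratedFDeriv ℝ n (f i) x‖ := by
              rw [(hsum n x).tsum_const_smul, norm_smul]; simp
          _ ≤ _ := tsum_of_norm_bounded (h k n).hasSum fun i => by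
              rw [norm_smul]; simpa using hd k n i x }
  refine ⟨g, ?_⟩
  -- For each seminorm, the error of a finite partial sum is at most the sum of the seminorms of the
  -- omitted terms, which tends to 0.
  rw [HasSum, SummationFilter.unconditional_filter, (schwartz_withSeminorms ℝ E F).tendsto_nhds]
  rintro ⟨k, n⟩ ε hε
  have hs := (h k n)
  have ht := hs.tendsto_cofinite_zero
  have hvan : Tendsto (fun s : Finset ℕ => ∑' i : {i // i ∉ s}, SchwartzMap.seminorm ℝ k n (f i))
      atTop (𝓝 0) :=
    tendsto_tsum_compl_atTop_zero fun i => SchwartzMap.seminorm ℝ k n (f i)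
  filter_upwards [hvan.eventually (gt_mem_nhds hε)] with s hlt
  refine lt_of_le_of_lt ?_ hlt
  rw [schwartzSeminormFamily_apply]
  refine SchwartzMap.seminorm_le_bound ℝ k n _ (tsum_nonneg fun i => apply_nonneg _ _) fun x => ?_
  have hfin : iteratedFDeriv ℝ n (∑ i ∈ s, f i - g : 𝓢(E, F)) x =
      - ∑' i : {i // i ∉ s}, iteratedFDeriv ℝ n (f i) x := by
    have h1 : ((∑ i ∈ s, f i - g : 𝓢(E, F)) : E → F) = (∑ i ∈ s, fun y => f i y) - fun y => g y := by
      ext y; simp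
    rw [h1, iteratedFDeriv_sub_apply, iteratedFDeriv_sum_apply]
    · have : iteratedFDeriv ℝ n (fun y => g y) x = _ := hder n x
      rw [this, ← (hsum n x).sum_add_tsum_subtype_compl s]
      simp
    · exact fun i _ => ((f i).smooth n).contDiffAt
    · rw [show (∑ i ∈ s, fun y => f i y) = fun y => ∑ i ∈ s, f i y by ext y; simp]
      exact (ContDiff.sum fun i _ => (f i).smooth n).contDiffAt
    · exact (g.smooth n).contDiffAt
  rw [hfin, norm_neg]
  have hs' : Summable fun i : {i // i ∉ s} => iteratedFDeriv ℝ n (f i) x := (hsum n x).subtype _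
  calc ‖x‖ ^ k * ‖∑' i : {i // i ∉ s}, iteratedFDeriv ℝ n (f i) x‖
      = ‖∑' i : {i // i ∉ s}, ‖x‖ ^ k • iteratedFDeriv ℝ n (f i) x‖ := by
        rw [hs'.tsum_const_smul, norm_smul]; simp
    _ ≤ _ := tsum_of_norm_bounded ((h k n).subtype _).hasSum fun i => by
        rw [norm_smul]; simpa using hd k n i x

end SchwartzSeries

/-! ### Uniform boundedness for families of tempered distributions. -/

section UniformBound

variable {E : Type*} [NormedAddCommGroup E] [NormedSpace ℝ E]

/-- A pointwise bounded family of tempered distributions is bounded uniformly on the terms of a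
series of Schwartz functions which converges absolutely for every seminorm. -/
theorem TemperedDistribution.exists_bound_of_pointwise_bounded {f : ℕ → 𝓢(E, ℂ)}
    (h : ∀ k n, Summable fun i => SchwartzMap.seminorm ℝ k n (f i)) {ι : Type*}
    (u : ι → 𝓢'(E, ℂ)) (hu : ∀ g, ∃ C, ∀ i, ‖u i g‖ ≤ C) : ∃ C, ∀ i k, ‖u i (f k)‖ ≤ C := by
  -- The series provides a map from the Banach space ℓ¹ to Schwartz functions, c ↦ ∑ c_k f_k.
  -- Composing the distributions with it makes Banach–Steinhaus available.
  have hsum : ∀ c : lp (fun _ : ℕ => ℂ) 1, ∃ g, HasSum (fun k => c k • f k) g := fun c => by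
    refine SchwartzMap.exists_hasSum_of_summable_seminorm fun k n => ?_
    have : ∀ i, SchwartzMap.seminorm ℝ k n (c i • f i) ≤ ‖c‖ * SchwartzMap.seminorm ℝ k n (f i) := by
      intro i
      have : SchwartzMap.seminorm ℝ k n (c i • f i) = ‖c i‖ * SchwartzMap.seminorm ℝ k n (f i) :=
        map_smul_eq_mul (SchwartzMap.seminorm ℂ k n) (c i) (f i)
      rw [this]
      gcongr
      exact lp.norm_apply_le_norm one_ne_zero c i
    exact .of_nonneg_of_le (fun i => apply_nonneg _ _) this ((h k n).mul_left _)
  choose G hG using hsum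
  have huG : ∀ i c, HasSum (fun k => c k * u i (f k)) (u i (G c)) := fun i c => by
    have e : (fun k => c k * u i (f k)) = u i ∘ fun k => c k • f k :=
      funext fun k => ((u i).map_smul (c k) (f k)).symm
    exact e ▸ (hG c).map (u i) (u i).continuous
  -- For a single i the values are terms of a convergent series, hence bounded; this gives
  -- continuity of each functional `T i` but no uniformity in i.
  have hbd : ∀ i, ∃ C, ∀ k, ‖u i (f k)‖ ≤ C := fun i => by
    obtain ⟨g, hg⟩ := SchwartzMap.exists_hasSum_of_summable_seminorm h
    have := (hg.map (u i) (u i).continuous).summable.tendsto_atTop_zero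
    obtain ⟨C, hC⟩ := this.norm.bddAbove_range
    exact ⟨C, fun k => hC ⟨k, rfl⟩⟩
  let T : ι → lp (fun _ : ℕ => ℂ) 1 →L[ℂ] ℂ := fun i => LinearMap.mkContinuousOfExistsBound
    { toFun := fun c => ∑' k, c k * u i (f k)
      map_add' := fun c d => by
        rw [← (huG i c).summable.tsum_add (huG i d).summable]; simp [add_mul]
      map_smul' := fun a c => by
        rw [RingHom.id_apply, smul_eq_mul, ← tsum_mul_left]; simp [mul_assoc] } <| by
    obtain ⟨C, hC⟩ := hbd i
    refine ⟨C, fun c => ?_⟩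
    have hc := lp.hasSum_norm (p := 1) (by simp) c
    simp only [ENNReal.toReal_one, Real.rpow_one] at hc
    have := tsum_of_norm_bounded (f := fun k => c k * u i (f k)) (hc.mul_left C) fun k => by
      rw [norm_mul, mul_comm]; gcongr; exact hC k
    exact this
  have hT : ∀ i c, T i c = u i (G c) := fun i c => (huG i c).tsum_eq
  obtain ⟨C, hC⟩ := banach_steinhaus (g := T) fun c => by
    obtain ⟨C, hC⟩ := hu (G c)
    exact ⟨C, fun i => by rw [hT]; exact hC i⟩
  refine ⟨C, fun i k => ?_⟩
  -- Unit vectors of ℓ¹ recover the individual terms of the series.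
  have h1 : T i (lp.single (E := fun _ : ℕ => ℂ) 1 k (1 : ℂ)) = u i (f k) := by
    change ∑' j, (lp.single (E := fun _ : ℕ => ℂ) 1 k (1 : ℂ)) j * u i (f j) = _
    rw [tsum_eq_single k]
    · simp
    · intro j hj; simp [lp.single_apply, hj]
  rw [← h1]
  refine (T i).le_of_opNorm_le (hC i) _ |>.trans ?_
  rw [lp.norm_single (by simp)]; simp

end UniformBound

/-! ### Seminorms of products. -/

section Multiplication

variable {E : Type*} [NormedAddCommGroup E] [NormedSpace ℝ E]

/-- Multiplication by a function whose derivatives are bounded on the support of a Schwartz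
function does not increase the order of the seminorms. -/
theorem SchwartzMap.seminorm_smulLeftCLM_le {g : E → ℂ} (hg : g.HasTemperateGrowth) {B M : ℝ}
    (hM₀ : 0 ≤ M) (k n : ℕ) (f : 𝓢(E, ℂ))
    (hB : ∀ i ≤ n, ∀ x ∈ tsupport f, ‖iteratedFDeriv ℝ i g x‖ ≤ B)
    (hM : ∀ j ≤ n, SchwartzMap.seminorm ℝ k j f ≤ M) :
    SchwartzMap.seminorm ℝ k n (SchwartzMap.smulLeftCLM ℂ g f) ≤ 2 ^ n * (max B 0 * M) := by
  refine SchwartzMap.seminorm_le_bound ℝ k n _ (by positivity) fun x => ?_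
  rw [SchwartzMap.smulLeftCLM_apply hg]
  have h1 := norm_iteratedFDeriv_smul_le (n := n) hg.1 (f.smooth ⊤) x (by exact_mod_cast le_top)
  have h2 : ∀ i ∈ Finset.range (n + 1), ‖x‖ ^ k * ((n.choose i : ℝ) * ‖iteratedFDeriv ℝ i g x‖ *
      ‖iteratedFDeriv ℝ (n - i) f x‖) ≤ (n.choose i : ℝ) * (max B 0 * M) := by
    intro i hi
    by_cases hx : x ∈ tsupport f
    · have hb := (hB i (by grind) x hx).trans (le_max_left B 0)
      have hm := (SchwartzMap.le_seminorm ℝ k (n - i) f x).trans (hM (n - i) (by grind))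
      calc _ = (n.choose i : ℝ) * (‖iteratedFDeriv ℝ i g x‖ *
            (‖x‖ ^ k * ‖iteratedFDeriv ℝ (n - i) f x‖)) := by ring
        _ ≤ _ := by gcongr
    · have : iteratedFDeriv ℝ (n - i) f x = 0 := by
        by_contra h
        exact hx (support_iteratedFDeriv_subset (𝕜 := ℝ) (n - i) h)
      rw [this]
      simp only [norm_zero, mul_zero]
      positivity
  calc _ ≤ ‖x‖ ^ k * ∑ i ∈ Finset.range (n + 1), (n.choose i : ℝ) * ‖iteratedFDeriv ℝ i g x‖ *
        ‖iteratedFDeriv ℝ (n - i) f x‖ := by gcongr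
    _ ≤ ∑ i ∈ Finset.range (n + 1), (n.choose i : ℝ) * (max B 0 * M) := by
        rw [Finset.mul_sum]; exact Finset.sum_le_sum h2
    _ = _ := by
        rw [← Finset.sum_mul]
        congr 1
        exact_mod_cast Nat.sum_range_choose n

end Multiplication

/-! ### Smooth cut-offs and density of compactly supported functions. -/

section Cutoff

variable {E : Type*} [NormedAddCommGroup E] [InnerProductSpace ℝ E]

/-- A smooth cut-off function on `E`, equal to `1` on the unit ball and to `0` outside the ball of
radius `2`. -/
theorem exists_schwartz_cutoff [FiniteDimensional ℝ E] : ∃ χ : 𝓢(E, ℂ), HasCompactSupport χ ∧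
    (∀ x, ‖x‖ ≤ 1 → χ x = 1) := by
  let b : ContDiffBump (0 : E) := ⟨1, 2, one_pos, one_lt_two⟩
  have h1 : HasCompactSupport (Complex.ofRealCLM ∘ b) := b.hasCompactSupport.comp_left rfl
  have h2 : ContDiff ℝ ((⊤ : ℕ∞) : WithTop ℕ∞) (Complex.ofRealCLM ∘ b) :=
    Complex.ofRealCLM.contDiff.comp b.contDiff
  refine ⟨h1.toSchwartzMap h2, h1, fun x hx => ?_⟩
  have : b x = 1 := b.one_of_mem_closedBall (by simpa using hx)
  change Complex.ofRealCLM (b x) = 1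
  simp [this]

/-- The dilate `x ↦ χ (x / r)` of a Schwartz function. -/
noncomputable def SchwartzMap.dilate (χ : 𝓢(E, ℂ)) (r : ℝ) (hr : r ≠ 0) : 𝓢(E, ℂ) :=
  SchwartzMap.compCLMOfContinuousLinearEquiv ℝ
    (ContinuousLinearEquiv.smulLeft (Units.mk0 r⁻¹ (inv_ne_zero hr))) χ

theorem SchwartzMap.dilate_apply (χ : 𝓢(E, ℂ)) (r : ℝ) (hr : r ≠ 0) (x : E) :
    χ.dilate r hr x = χ (r⁻¹ • x) := rfl

theorem SchwartzMap.hasCompactSupport_dilate {χ : 𝓢(E, ℂ)} (hχ : HasCompactSupport χ) (r : ℝ)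
    (hr : r ≠ 0) : HasCompactSupport (χ.dilate r hr) :=
  hχ.comp_homeomorph
    (ContinuousLinearEquiv.smulLeft (R₁ := ℝ) (Units.mk0 r⁻¹ (inv_ne_zero hr)) : E ≃L[ℝ] E).toHomeomorph

/-- Compactly supported functions are dense in the Schwartz space. -/
theorem SchwartzMap.tendsto_cutoff {χ : 𝓢(E, ℂ)} (h1 : ∀ x, ‖x‖ ≤ 1 → χ x = 1) (f : 𝓢(E, ℂ)) :
    Tendsto (fun m : ℕ => SchwartzMap.smulLeftCLM ℂ
      (χ.dilate (m + 1 : ℝ) (by positivity)) f) atTop (𝓝 f) := by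
  rw [(schwartz_withSeminorms ℝ E ℂ).tendsto_nhds]
  rintro ⟨k, n⟩ ε hε
  simp only [schwartzSeminormFamily_apply]
  obtain ⟨B, hB⟩ : ∃ B : ℝ, ∀ i ≤ n, ∀ x, ‖iteratedFDeriv ℝ i (fun y => 1 - χ y) x‖ ≤ B := by
    have : ∀ i, ∃ B : ℝ, ∀ x, ‖iteratedFDeriv ℝ i (fun y => 1 - χ y) x‖ ≤ B := fun i => by
      refine ⟨1 + SchwartzMap.seminorm ℝ 0 i χ, fun x => ?_⟩
      rw [show (fun y => 1 - χ y) = (fun _ => (1 : ℂ)) - (fun y => χ y) from rfl,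
        iteratedFDeriv_sub_apply contDiffAt_const (χ.smooth i).contDiffAt]
      refine (norm_sub_le _ _).trans (add_le_add ?_ (SchwartzMap.norm_iteratedFDeriv_le_seminorm ℝ χ i x))
      rcases i.eq_zero_or_pos with rfl | hi
      · simp
      · rw [iteratedFDeriv_const_of_ne hi.ne']; simp
    choose B hB using this
    exact ⟨∑ j ∈ Finset.range (n + 1), |B j|, fun i hi x => (hB i x).trans <| (le_abs_self _).trans
      (Finset.single_le_sum (f := fun j => |B j|) (fun _ _ => abs_nonneg _) (by grind))⟩
  have hB0 : 0 ≤ B := (norm_nonneg _).trans (hB 0 n.zero_le 0)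
  let M := ∑ j ∈ Finset.range (n + 1), SchwartzMap.seminorm ℝ (k + 1) j f
  have hM0 : 0 ≤ M := Finset.sum_nonneg fun _ _ => apply_nonneg _ _
  have key : ∀ m : ℕ, SchwartzMap.seminorm ℝ k n (SchwartzMap.smulLeftCLM ℂ
      (χ.dilate (m + 1 : ℝ) (by positivity)) f - f) ≤ (2 ^ n * (B * M)) / (m + 1 : ℝ) := by
    intro m
    refine SchwartzMap.seminorm_le_bound ℝ k n _ (by positivity) fun x => ?_
    set r : ℝ := m + 1 with hr
    have hr1 : 1 ≤ r := by simp [hr]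
    have hr0 : r ≠ 0 := by positivity
    let g : E → ℂ := fun y => 1 - χ (r⁻¹ • y)
    have hfun : ((SchwartzMap.smulLeftCLM ℂ (χ.dilate r hr0) f - f : 𝓢(E, ℂ)) : E → ℂ) =
        - fun y => g y • f y := by
      ext y
      simp only [sub_apply, SchwartzMap.smulLeftCLM_apply_apply (χ.dilate r hr0).hasTemperateGrowth,
        SchwartzMap.dilate_apply, Pi.neg_apply, g, smul_eq_mul]
      ring
    have hgs : ContDiff ℝ ((⊤ : ℕ∞) : WithTop ℕ∞) fun y => 1 - χ y :=
      contDiff_const.sub (χ.smooth ⊤)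
    have hgd : ∀ i, iteratedFDeriv ℝ i g x =
        r⁻¹ ^ i • iteratedFDeriv ℝ i (fun y => 1 - χ y) (r⁻¹ • x) := fun i => by
      rw [show g = fun z => (fun y => 1 - χ y) (r⁻¹ • z) from rfl,
        iteratedFDeriv_comp_const_smul r⁻¹ (hgs.of_le (by exact_mod_cast le_top))]
    have hgs' : ContDiff ℝ ((⊤ : ℕ∞) : WithTop ℕ∞) g := hgs.comp (contDiff_const_smul r⁻¹)
    have h1' := norm_iteratedFDeriv_smul_le (n := n) hgs' (f.smooth ⊤) x
      (by exact_mod_cast le_top)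
    -- The factor g vanishes near every point with |x| < r, and |x|/r ≥ 1 elsewhere. The factor
    -- |x|/r is paid for by one more power of the weight on f, which produces the decay 1/r.
    have hgb : ∀ i ≤ n, ‖iteratedFDeriv ℝ i g x‖ ≤ B * (‖x‖ / r) := by
      intro i hi
      rcases lt_or_ge ‖x‖ r with hx | hx
      · have : (fun y => 1 - χ (r⁻¹ • y)) =ᶠ[𝓝 x] fun _ => 0 := by
          filter_upwards [continuous_norm.continuousAt.eventually_lt continuousAt_const hx] with y hy
          rw [h1, sub_self]
          rw [norm_smul, norm_inv, Real.norm_of_nonneg (by positivity), inv_mul_le_one₀ (by positivity)]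
          exact hy.le
        rw [(this.iteratedFDeriv ℝ i).eq_of_nhds]
        simp only [iteratedFDeriv_fun_zero]
        simp; positivity
      · rw [hgd, norm_smul]
        have h3 : ‖r⁻¹ ^ i‖ ≤ 1 := by
          rw [norm_pow, norm_inv, Real.norm_of_nonneg (by positivity)]
          exact pow_le_one₀ (by positivity) (inv_le_one_of_one_le₀ hr1)
        have h4 : 1 ≤ ‖x‖ / r := (one_le_div₀ (by positivity)).2 hx
        calc _ ≤ 1 * B := by gcongr; exact hB i hi _
          _ ≤ _ := by nlinarith
    rw [hfun, iteratedFDeriv_neg_apply, norm_neg]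
    calc _ ≤ ‖x‖ ^ k * ∑ i ∈ Finset.range (n + 1), (n.choose i : ℝ) * ‖iteratedFDeriv ℝ i g x‖ *
          ‖iteratedFDeriv ℝ (n - i) f x‖ := by gcongr
      _ ≤ ∑ i ∈ Finset.range (n + 1), (n.choose i : ℝ) * (B * M / r) := by
          rw [Finset.mul_sum]
          refine Finset.sum_le_sum fun i hi => ?_
          have hm : ‖x‖ ^ (k + 1) * ‖iteratedFDeriv ℝ (n - i) f x‖ ≤ M :=
            (SchwartzMap.le_seminorm ℝ (k + 1) (n - i) f x).trans
              (Finset.single_le_sum (f := fun j => SchwartzMap.seminorm ℝ (k + 1) j f)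
                (fun _ _ => apply_nonneg _ _) (by grind))
          calc _ ≤ ‖x‖ ^ k * ((n.choose i : ℝ) * (B * (‖x‖ / r)) *
                ‖iteratedFDeriv ℝ (n - i) f x‖) := by gcongr; exact hgb i (by grind)
            _ = (n.choose i : ℝ) * (B * (‖x‖ ^ (k + 1) * ‖iteratedFDeriv ℝ (n - i) f x‖) / r) := by
                ring
            _ ≤ _ := by gcongr
      _ = _ := by
          rw [← Finset.sum_mul]
          have : (∑ i ∈ Finset.range (n + 1), (n.choose i : ℝ)) = 2 ^ n := by
            exact_mod_cast Nat.sum_range_choose n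
          rw [this]; ring
  have hlim : Tendsto (fun m : ℕ => (2 ^ n * (B * M)) / (m + 1 : ℝ)) atTop (𝓝 0) :=
    tendsto_const_nhds.div_atTop (tendsto_natCast_atTop_atTop.atTop_add tendsto_const_nhds)
  filter_upwards [hlim.eventually (gt_mem_nhds hε)] with m hm using (key m).trans_lt hm

end Cutoff

/-! ### Uniqueness for V'' = pV with distributional values. -/

section Uniqueness

variable {E : Type*} [NormedAddCommGroup E] [InnerProductSpace ℝ E]

/-- The seminorms of `p ^ j • Φ` grow at most exponentially in `j` when `Φ` has compact support. -/
theorem SchwartzMap.exists_seminorm_iterate_smulLeftCLM_le {p : E → ℂ} (hp : p.HasTemperateGrowth)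
    {Φ : 𝓢(E, ℂ)} (hΦ : HasCompactSupport Φ) (k n : ℕ) : ∃ A D : ℝ, ∀ j : ℕ,
      SchwartzMap.seminorm ℝ k n ((SchwartzMap.smulLeftCLM ℂ p)^[j] Φ) ≤ A ^ j * D := by
  have hsupp : ∀ j : ℕ, tsupport ((SchwartzMap.smulLeftCLM ℂ p)^[j] Φ) ⊆ tsupport Φ := by
    intro j
    induction j with
    | zero => rfl
    | succ j ih =>
      rw [Function.iterate_succ_apply']
      have : tsupport (SchwartzMap.smulLeftCLM ℂ p ((SchwartzMap.smulLeftCLM ℂ p)^[j] Φ)) ⊆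
          tsupport ((SchwartzMap.smulLeftCLM ℂ p)^[j] Φ) := by
        rw [SchwartzMap.smulLeftCLM_apply hp]
        exact tsupport_smul_subset_right p _
      exact this.trans ih
  obtain ⟨B, hB⟩ : ∃ B : ℝ, ∀ i ≤ n, ∀ x ∈ tsupport Φ, ‖iteratedFDeriv ℝ i p x‖ ≤ B := by
    have : ∀ i, ∃ B : ℝ, ∀ x ∈ tsupport Φ, ‖iteratedFDeriv ℝ i p x‖ ≤ B := fun i =>
      hΦ.isCompact.exists_bound_of_continuousOn
        (hp.1.continuous_iteratedFDeriv (by exact_mod_cast le_top)).continuousOn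
    choose B hB using this
    exact ⟨∑ j ∈ Finset.range (n + 1), |B j|, fun i hi x hx => (hB i x hx).trans <|
      (le_abs_self _).trans
      (Finset.single_le_sum (f := fun j => |B j|) (fun _ _ => abs_nonneg _) (by grind))⟩
  let D := ∑ i ∈ Finset.range (n + 1), SchwartzMap.seminorm ℝ k i Φ
  have hD : 0 ≤ D := Finset.sum_nonneg fun _ _ => apply_nonneg _ _
  have key : ∀ j : ℕ, ∀ i ≤ n, SchwartzMap.seminorm ℝ k i ((SchwartzMap.smulLeftCLM ℂ p)^[j] Φ) ≤
      (2 ^ n * max B 0) ^ j * D := by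
    intro j
    induction j with
    | zero =>
      intro i hi
      simpa using Finset.single_le_sum (f := fun i => SchwartzMap.seminorm ℝ k i Φ)
        (s := Finset.range (n + 1)) (fun _ _ => apply_nonneg _ _) (by grind)
    | succ j ih =>
      intro i hi
      rw [Function.iterate_succ_apply']
      have := SchwartzMap.seminorm_smulLeftCLM_le hp (B := B) (M := (2 ^ n * max B 0) ^ j * D)
        (by positivity) k i ((SchwartzMap.smulLeftCLM ℂ p)^[j] Φ)
        (fun i' hi' x hx => hB i' (hi'.trans hi) x (hsupp j hx)) (fun i' hi' => ih i' (hi'.trans hi))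
      refine this.trans ?_
      rw [pow_succ]
      have h2 : (2 : ℝ) ^ i ≤ 2 ^ n := pow_le_pow_right₀ one_le_two hi
      calc _ ≤ (2 : ℝ) ^ n * (max B 0 * ((2 ^ n * max B 0) ^ j * D)) := by gcongr
        _ = _ := by ring
  exact ⟨_, D, fun j => key j n le_rfl⟩

/-- Uniqueness for the Fourier transformed wave equation `∂_t² V = p V` with vanishing Cauchy
data, for functions with values in the tempered distributions. -/
theorem TemperedDistribution.eq_zero_of_hasDerivWithinAt [FiniteDimensional ℝ E] {p : E → ℂ} (hp : p.HasTemperateGrowth)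
    {V V' : ℝ → 𝓢'(E, ℂ)}
    (h1 : ∀ Φ, ∀ t, 0 ≤ t → HasDerivWithinAt (fun s => V s Φ) (V' t Φ) (Ici 0) t)
    (h2 : ∀ Φ, ∀ t, 0 ≤ t → V' t Φ = ∫ s in (0 : ℝ)..t, V s (SchwartzMap.smulLeftCLM ℂ p Φ))
    (h0 : V 0 = 0) {T : ℝ} (hT : 0 ≤ T) : V T = 0 := by
  have hcont : ∀ Φ, ContinuousOn (fun s => V s Φ) (Ici 0) := fun Φ t ht =>
    (h1 Φ t ht).continuousWithinAt
  have hcpt : ∀ Φ : 𝓢(E, ℂ), HasCompactSupport Φ → V T Φ = 0 := by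
    intro Φ hΦ
    let f : ℕ → 𝓢(E, ℂ) := fun j => (SchwartzMap.smulLeftCLM ℂ p)^[j] Φ
    -- The seminorms of p^j Φ grow only geometrically because Φ has compact support, so dividing by
    -- j! gives a summable series. Uniform boundedness then yields |V(r)(p^j Φ)| ≤ C j! on [0, T].
    have hsum : ∀ k n, Summable fun j : ℕ =>
        SchwartzMap.seminorm ℝ k n (((j.factorial : ℝ)⁻¹ : ℝ) • f j) := by
      intro k n
      obtain ⟨A, D, hAD⟩ := SchwartzMap.exists_seminorm_iterate_smulLeftCLM_le hp hΦ k n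
      refine .of_nonneg_of_le (fun j => apply_nonneg _ _) (fun j => ?_)
        ((Real.summable_pow_div_factorial A).mul_right D)
      rw [map_smul_eq_mul, norm_inv, Real.norm_natCast]
      calc _ ≤ (j.factorial : ℝ)⁻¹ * (A ^ j * D) := by gcongr; exact hAD j
        _ = _ := by ring
    obtain ⟨C, hC⟩ := TemperedDistribution.exists_bound_of_pointwise_bounded hsum
      (fun r : Icc 0 T => V r) fun g => by
        obtain ⟨C, hC⟩ := isCompact_Icc.exists_bound_of_continuousOn
          ((hcont g).mono (Icc_subset_Ici_self : Icc 0 T ⊆ Ici 0))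
        exact ⟨C, fun r => hC r r.2⟩
    have hC' : ∀ j : ℕ, ∀ r ∈ Icc 0 T, ‖V r (f j)‖ ≤ C * j.factorial := by
      intro j r hr
      have := hC ⟨r, hr⟩ j
      have e : V r (((j.factorial : ℝ)⁻¹ : ℝ) • f j) = ((j.factorial : ℝ)⁻¹ : ℝ) • V r (f j) :=
        LinearMap.map_smul_of_tower (V r).toLinearMap _ _
      rw [e, norm_smul, norm_inv, Real.norm_natCast, inv_mul_le_iff₀ (by positivity)] at this
      linarith
    have hC0 : 0 ≤ C := by simpa using (norm_nonneg _).trans (hC' 0 0 ⟨le_rfl, hT⟩)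
    -- Each pair of integrations in time replaces p^j by p^(j+1). After l pairs the gain
    -- r^(2l)/(2l)! outweighs the loss from j! to (j+l)!.
    have hstep : ∀ l j : ℕ, ∀ r ∈ Icc 0 T,
        ‖V r (f j)‖ ≤ C * (j + l).factorial * (r ^ (2 * l) / (2 * l).factorial) := by
      intro l
      induction l with
      | zero => intro j r hr; simpa using hC' j r hr
      | succ l ih =>
        intro j r hr
        have hV' : ∀ t ∈ Icc 0 T, ‖V' t (f j)‖ ≤
            C * (j + (l + 1)).factorial * (t ^ (2 * l + 1) / (2 * l + 1).factorial) := by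
          intro t ht
          rw [h2 _ t ht.1]
          have hle : ∀ s ∈ Ioc 0 t, ‖V s (SchwartzMap.smulLeftCLM ℂ p (f j))‖ ≤
              C * (j + (l + 1)).factorial * (s ^ (2 * l) / (2 * l).factorial) := fun s hs => by
            have := ih (j + 1) s ⟨hs.1.le, hs.2.trans ht.2⟩
            simp only [f, Function.iterate_succ_apply'] at this
            rwa [show j + 1 + l = j + (l + 1) by ring] at this
          refine (intervalIntegral.norm_integral_le_of_norm_le ht.1 (ae_of_all _ hle) ?_).trans ?_
          · exact (by fun_prop : Continuous fun s : ℝ => C * (j + (l + 1)).factorial *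
              (s ^ (2 * l) / (2 * l).factorial)).intervalIntegrable _ _
          · rw [intervalIntegral.integral_const_mul, intervalIntegral.integral_div, integral_pow]
            refine le_of_eq ?_
            rw [Nat.factorial_succ (2 * l)]
            push_cast
            rw [zero_pow (by omega), sub_zero, div_div]
        have hB : ∀ x : ℝ, HasDerivAt (fun x : ℝ => C * (j + (l + 1)).factorial *
            (x ^ (2 * (l + 1)) / (2 * (l + 1)).factorial)) (C * (j + (l + 1)).factorial *
            (x ^ (2 * l + 1) / (2 * l + 1).factorial)) x := by
          intro x
          have := (((hasDerivAt_pow (2 * (l + 1)) x).div_const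
            ((2 * (l + 1)).factorial : ℝ)).const_mul (C * (j + (l + 1)).factorial : ℝ))
          refine this.congr_deriv ?_
          rw [show 2 * (l + 1) = (2 * l + 1) + 1 by ring, Nat.factorial_succ (2 * l + 1),
            Nat.add_sub_cancel]
          push_cast
          field_simp
        refine image_norm_le_of_norm_deriv_right_le_deriv_boundary (f' := fun t => V' t (f j))
          ((hcont (f j)).mono Icc_subset_Ici_self)
          (fun x hx => (h1 (f j) x hx.1).mono (Ici_subset_Ici.2 hx.1)) ?_ hB
          (fun x hx => hV' x ⟨hx.1, hx.2.le⟩) hr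
        simp [h0]
    have hlim : Tendsto (fun l : ℕ => C * ((T ^ 2) ^ l / l.factorial)) atTop (𝓝 0) := by
      simpa using (FloorSemiring.tendsto_pow_div_factorial_atTop (T ^ 2)).const_mul C
    -- For j = 0, the inequality (l!)² ≤ (2l)! turns l!/(2l)! into at most 1/l!.
    have hle : ∀ l : ℕ, ‖V T Φ‖ ≤ C * ((T ^ 2) ^ l / l.factorial) := by
      intro l
      have := hstep l 0 T ⟨hT, le_rfl⟩
      refine this.trans ?_
      rw [zero_add, mul_assoc, ← pow_mul, ← mul_div_assoc]
      refine mul_le_mul_of_nonneg_left ?_ hC0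
      rw [div_le_div_iff₀ (by positivity) (by positivity)]
      have hf : (l.factorial : ℝ) * l.factorial ≤ (2 * l).factorial := by
        have := Nat.le_of_dvd (Nat.factorial_pos _) (Nat.factorial_mul_factorial_dvd_factorial_add l l)
        rw [two_mul]; exact_mod_cast this
      calc _ = T ^ (2 * l) * ((l.factorial : ℝ) * l.factorial) := by ring
        _ ≤ _ := by gcongr
    exact norm_le_zero_iff.1 (ge_of_tendsto' hlim hle)
  ext Φ
  obtain ⟨χ, hχ, hχ1⟩ := exists_schwartz_cutoff (E := E)
  have hlim := ((V T).continuous.tendsto Φ).comp (SchwartzMap.tendsto_cutoff hχ1 Φ)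
  refine tendsto_nhds_unique hlim ?_
  refine tendsto_const_nhds.congr fun m => (hcpt _ ?_).symm
  rw [SchwartzMap.smulLeftCLM_apply (SchwartzMap.hasTemperateGrowth _)]
  exact (SchwartzMap.hasCompactSupport_dilate hχ _ _).smul_right

end Uniqueness

/-! ### Functions as tempered distributions. -/

section TemperateL1

variable {n : ℕ}

/-- Functions which are integrable against some negative power of `1 + ‖ξ‖`. -/
def TemperateL1 (a : Rn n → ℂ) : Prop :=
  ∃ N : ℕ, Integrable fun ξ => (((1 + ‖ξ‖) ^ N)⁻¹ : ℝ) • a ξ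

theorem SchwartzMap.exists_one_add_pow_mul_le (N : ℕ) : ∃ (s : Finset (ℕ × ℕ)) (C : ℝ), 0 ≤ C ∧
    ∀ (Φ : 𝓢(Rn n, ℂ)) ξ, (1 + ‖ξ‖) ^ N * ‖Φ ξ‖ ≤ C * s.sup (schwartzSeminormFamily ℂ (Rn n) ℂ) Φ := by
  refine ⟨Finset.Iic (N, 0), 2 ^ N, by positivity, fun Φ ξ => ?_⟩
  have := SchwartzMap.one_add_le_sup_seminorm_apply (𝕜 := ℂ) (m := (N, 0)) (k := N) (n := 0)
    le_rfl le_rfl Φ ξ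
  rw [norm_iteratedFDeriv_zero] at this
  exact this

theorem TemperateL1.aestronglyMeasurable {a : Rn n → ℂ} (ha : TemperateL1 a) :
    AEStronglyMeasurable a := by
  obtain ⟨N, hN⟩ := ha
  have h : AEStronglyMeasurable fun ξ : Rn n => ((1 + ‖ξ‖) ^ N : ℝ) • ((((1 + ‖ξ‖) ^ N)⁻¹ : ℝ) • a ξ) :=
    (by fun_prop : Continuous fun ξ : Rn n => (1 + ‖ξ‖) ^ N).aestronglyMeasurable.smul hN.1
  refine h.congr (ae_of_all _ fun ξ => ?_)
  have : (1 + ‖ξ‖) ^ N ≠ 0 := by positivity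
  simp only [smul_smul, mul_inv_cancel₀ this, one_smul]

/-- A product with a function of rapid decay is integrable. -/
theorem TemperateL1.integrable_mul_of_bound {a : Rn n → ℂ} {N : ℕ}
    (hN : Integrable fun ξ => (((1 + ‖ξ‖) ^ N)⁻¹ : ℝ) • a ξ) (ha : AEStronglyMeasurable a)
    {Φ : Rn n → ℂ} (hΦ : AEStronglyMeasurable Φ)
    {C : ℝ} (hC : ∀ ξ, (1 + ‖ξ‖) ^ N * ‖Φ ξ‖ ≤ C) :
    Integrable (fun ξ => Φ ξ * a ξ) ∧
      ‖∫ ξ, Φ ξ * a ξ‖ ≤ C * ∫ ξ, ‖(((1 + ‖ξ‖) ^ N)⁻¹ : ℝ) • a ξ‖ := by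
  have hle : ∀ ξ, ‖Φ ξ * a ξ‖ ≤ C * ‖(((1 + ‖ξ‖) ^ N)⁻¹ : ℝ) • a ξ‖ := fun ξ => by
    have hp : 0 < (1 + ‖ξ‖) ^ N := by positivity
    rw [norm_mul, norm_smul, norm_inv, Real.norm_of_nonneg hp.le]
    calc ‖Φ ξ‖ * ‖a ξ‖ = ((1 + ‖ξ‖) ^ N * ‖Φ ξ‖) * (((1 + ‖ξ‖) ^ N)⁻¹ * ‖a ξ‖) := by
          field_simp
      _ ≤ _ := by gcongr; exact hC ξ
  refine ⟨(hN.norm.const_mul C).mono' (hΦ.mul ha) (ae_of_all _ hle), ?_⟩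
  rw [← integral_const_mul]
  exact norm_integral_le_of_norm_le (hN.norm.const_mul C) (ae_of_all _ hle)

theorem TemperateL1.integrable_mul {a : Rn n → ℂ} (ha : TemperateL1 a) (Φ : 𝓢(Rn n, ℂ)) :
    Integrable fun ξ => Φ ξ * a ξ := by
  have ham := ha.aestronglyMeasurable
  obtain ⟨N, hN⟩ := ha
  obtain ⟨s, C, -, hC⟩ := SchwartzMap.exists_one_add_pow_mul_le (n := n) N
  exact (integrable_mul_of_bound hN ham Φ.continuous.aestronglyMeasurable (hC Φ)).1

/-- The tempered distribution given by a function. -/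
noncomputable def TemperateL1.toDist {a : Rn n → ℂ} (ha : TemperateL1 a) : 𝓢'(Rn n, ℂ) :=
  ContinuousLinearMap.toPointwiseConvergenceCLM _ _ _ _ <|
    SchwartzMap.mkCLMtoNormedSpace (𝕜 := ℂ) (σ := RingHom.id ℂ) (fun Φ : 𝓢(Rn n, ℂ) => ∫ ξ, Φ ξ * a ξ)
      (fun f g => by
        rw [← integral_add (ha.integrable_mul f) (ha.integrable_mul g)]
        simp [add_mul])
      (fun c f => by
        rw [RingHom.id_apply, smul_eq_mul, ← integral_const_mul]
        simp [mul_assoc]) <| by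
      have ham := ha.aestronglyMeasurable
      obtain ⟨N, hN⟩ := ha
      obtain ⟨s, C, hC0, hC⟩ := SchwartzMap.exists_one_add_pow_mul_le (n := n) N
      refine ⟨s, C * ∫ ξ, ‖(((1 + ‖ξ‖) ^ N)⁻¹ : ℝ) • a ξ‖,
        mul_nonneg hC0 (integral_nonneg fun _ => norm_nonneg _), fun Φ => ?_⟩
      refine (integrable_mul_of_bound hN ham Φ.continuous.aestronglyMeasurable (hC Φ)).2.trans ?_
      rw [mul_right_comm]

theorem TemperateL1.toDist_apply {a : Rn n → ℂ} (ha : TemperateL1 a) (Φ : 𝓢(Rn n, ℂ)) :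
    ha.toDist Φ = ∫ ξ, Φ ξ * a ξ := rfl

theorem TemperateL1.isRepresentedBy_toDist {a : Rn n → ℂ} (ha : TemperateL1 a) :
    IsRepresentedBy ha.toDist a :=
  fun Φ => ⟨ha.integrable_mul Φ, rfl⟩

theorem TemperateL1.mono {a b : Rn n → ℂ} (ha : TemperateL1 a) (hb : AEStronglyMeasurable b)
    {C : ℝ} (h : ∀ᵐ ξ, ‖b ξ‖ ≤ C * ‖a ξ‖) : TemperateL1 b := by
  obtain ⟨N, hN⟩ := ha
  refine ⟨N, (hN.norm.const_mul C).mono' ?_ ?_⟩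
  · exact (by fun_prop (disch := intros; positivity) :
      Continuous fun ξ : Rn n => ((1 + ‖ξ‖) ^ N)⁻¹).aestronglyMeasurable.smul hb
  · filter_upwards [h] with ξ hξ
    rw [norm_smul, norm_smul]
    calc _ ≤ ‖((1 + ‖ξ‖) ^ N)⁻¹‖ * (C * ‖a ξ‖) := by gcongr
      _ = _ := by ring

/-- Testing against a dilated cut-off equal to 1 on a given ball exposes g itself there. -/
theorem IsRepresentedBy.locallyIntegrable {u : 𝓢'(Rn n, ℂ)} {g : Rn n → ℂ}
    (hg : IsRepresentedBy u g) : LocallyIntegrable g := by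
  obtain ⟨χ, -, hχ⟩ := exists_schwartz_cutoff (E := Rn n)
  intro x
  let r : ℝ := ‖x‖ + 1
  have hr : 0 < r := by positivity
  refine ⟨Metric.ball 0 r, Metric.isOpen_ball.mem_nhds (by simp [r]), ?_⟩
  refine ((hg (χ.dilate r hr.ne')).1.integrableOn (s := Metric.ball 0 r)).congr_fun_ae ?_
  rw [EventuallyEq, ae_restrict_iff' measurableSet_ball]
  refine ae_of_all _ fun y hy => ?_
  rw [SchwartzMap.dilate_apply, hχ, one_mul]
  rw [norm_smul, norm_inv, Real.norm_of_nonneg hr.le, inv_mul_le_one₀ hr]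
  exact (mem_ball_zero_iff.1 hy).le

/-- The function representing a tempered distribution is unique up to null sets. -/
theorem ae_eq_of_integral_schwartz_mul_eq {f g : Rn n → ℂ} (hf : LocallyIntegrable f)
    (hg : LocallyIntegrable g) (h : ∀ φ : 𝓢(Rn n, ℂ), ∫ x, φ x * f x = ∫ x, φ x * g x) :
    f =ᵐ[volume] g := by
  refine ae_eq_of_integral_contDiff_smul_eq hf hg fun φ hφ hc => ?_
  have h1 : HasCompactSupport (Complex.ofRealCLM ∘ φ) := hc.comp_left rfl
  have h2 : ContDiff ℝ ((⊤ : ℕ∞) : WithTop ℕ∞) (Complex.ofRealCLM ∘ φ) :=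
    Complex.ofRealCLM.contDiff.comp hφ
  exact h (h1.toSchwartzMap h2)

theorem IsRepresentedBy.ae_eq {u : 𝓢'(Rn n, ℂ)} {f g : Rn n → ℂ}
    (hf : IsRepresentedBy u f) (hg : IsRepresentedBy u g) : f =ᵐ[volume] g :=
  ae_eq_of_integral_schwartz_mul_eq hf.locallyIntegrable hg.locallyIntegrable fun φ => by
    rw [← (hf φ).2, ← (hg φ).2]

theorem IsRepresentedBy.congr {u : 𝓢'(Rn n, ℂ)} {f g : Rn n → ℂ}
    (hf : IsRepresentedBy u f) (h : f =ᵐ[volume] g) : IsRepresentedBy u g := fun φ => by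
  have : (fun x => φ x * f x) =ᵐ[volume] fun x => φ x * g x := by
    filter_upwards [h] with x hx using by rw [hx]
  exact ⟨(hf φ).1.congr this, (hf φ).2.trans (integral_congr_ae this)⟩

/-- Any two representatives agree almost everywhere, so the infimum is attained at each of them. -/
theorem weightedFourierNorm_eq {m : Rn n → ℝ} {u : 𝓢'(Rn n, ℂ)} {g : Rn n → ℂ}
    (hg : IsRepresentedBy (𝓕 u) g) :
    weightedFourierNorm m u = eLpNorm (fun ξ => m ξ • g ξ) 2 volume := by
  refine le_antisymm (iInf₂_le g hg) (le_iInf₂ fun g' hg' => le_of_eq ?_)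
  refine eLpNorm_congr_ae ?_
  filter_upwards [hg.ae_eq hg'] with x hx using by rw [hx]

end TemperateL1

/-! ### Compactly supported distributions have function-valued Fourier transforms. -/

section Weights

variable {n : ℕ}

/-- Each derivative of the transform brings down one power of 2πξ. The factor j+1 counts the moments
of order 0, ..., j in the general estimate, all dominated by the same integral. -/
theorem norm_iteratedFDeriv_fourier_le_integral (Φ : 𝓢(Rn n, ℂ)) (j : ℕ) (x : Rn n) :
    ‖iteratedFDeriv ℝ j (𝓕 Φ : 𝓢(Rn n, ℂ)) x‖ ≤ (2 * Real.pi) ^ j * ((j + 1) * ∫ ξ, (1 + ‖ξ‖) ^ j * ‖Φ ξ‖) := by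
  have h := Real.pow_mul_norm_iteratedFDeriv_fourier_le (K := ⊤) (N := ⊤) (Φ.smooth ⊤)
    (fun k m _ _ => Φ.integrable_pow_mul_iteratedFDeriv volume k m) (k := j) (n := 0) le_top le_top x
  rw [SchwartzMap.fourier_coe]
  simp only [pow_zero, one_mul, mul_one, zero_add, Finset.range_one, Finset.product_singleton,
      Finset.sum_map, Function.Embedding.coeFn_mk, norm_iteratedFDeriv_zero] at h
  refine h.trans ?_
  have hint : Integrable fun ξ => (1 + ‖ξ‖) ^ j * ‖Φ ξ‖ := by
    simp_rw [add_pow, one_pow, one_mul, Finset.sum_mul]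
    refine integrable_finsetSum _ fun i _ => ?_
    have := (Φ.integrable_pow_mul (μ := volume) (j - i)).mul_const (j.choose i : ℝ)
    refine this.congr (ae_of_all _ fun ξ => ?_)
    ring
  gcongr
  calc _ ≤ ∑ i ∈ Finset.range (j + 1), ∫ ξ, (1 + ‖ξ‖) ^ j * ‖Φ ξ‖ := by
        refine Finset.sum_le_sum fun i hi => integral_mono (Φ.integrable_pow_mul volume i) hint
          fun ξ => ?_
        have h1 : ‖ξ‖ ^ i ≤ (1 + ‖ξ‖) ^ j :=
          (pow_le_pow_left₀ (norm_nonneg _) (by linarith) i).trans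
            (pow_le_pow_right₀ (by linarith [norm_nonneg ξ]) (by grind))
        dsimp only
        gcongr
    _ = _ := by simp

theorem memLp_two_one_add_norm_sq_rpow {r : ℝ} (hr : (n : ℝ) < 4 * r) :
    MemLp (fun ξ : Rn n => (1 + ‖ξ‖ ^ 2) ^ (-r)) 2 := by
  have hm : Measurable fun ξ : Rn n => (1 + ‖ξ‖ ^ 2) ^ (-r) := by fun_prop
  rw [memLp_two_iff_integrable_sq hm.aestronglyMeasurable]
  have := integrable_rpow_neg_one_add_norm_sq (E := Rn n) (μ := volume) (r := 4 * r) (by simpa using hr)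
  refine this.congr (ae_of_all _ fun ξ => ?_)
  simp only
  rw [← Real.rpow_natCast ((1 + ‖ξ‖ ^ 2) ^ (-r)), ← Real.rpow_mul (by positivity)]
  congr 1; push_cast; ring

/-- Cauchy–Schwarz: the weight (1+|ξ|²)^{-(n+1)} is square integrable, so n+1 additional powers of
(1+|ξ|)² turn an L² bound into an L¹ bound. -/
theorem temperateL1_of_memLp {g h : Rn n → ℂ} (hg : AEStronglyMeasurable g) (hh : MemLp h 2)
    {C : ℝ} {M : ℕ} (hle : ∀ᵐ ξ, ‖g ξ‖ ≤ C * (1 + ‖ξ‖) ^ M * ‖h ξ‖) : TemperateL1 g := by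
  refine ⟨M + 2 * (n + 1), ?_⟩
  have hw := memLp_two_one_add_norm_sq_rpow (n := n) (r := n + 1) (by linarith)
  have hint : Integrable fun ξ : Rn n => (1 + ‖ξ‖ ^ 2) ^ (-((n : ℝ) + 1)) * ‖h ξ‖ :=
    hw.integrable_mul hh.norm
  refine (hint.const_mul C).mono' ?_ ?_
  · exact (by fun_prop (disch := intros; positivity) :
      Continuous fun ξ : Rn n => ((1 + ‖ξ‖) ^ (M + 2 * (n + 1)))⁻¹).aestronglyMeasurable.smul hg
  · filter_upwards [hle] with ξ hξ
    rw [norm_smul, norm_inv, Real.norm_of_nonneg (by positivity), inv_mul_le_iff₀ (by positivity)]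
    refine hξ.trans ?_
    have hC : 0 ≤ C * ‖h ξ‖ := by
      have h1 : 0 ≤ (C * ‖h ξ‖) * (1 + ‖ξ‖) ^ M := by
        linarith [(norm_nonneg (g ξ)).trans hξ]
      exact nonneg_of_mul_nonneg_left h1 (by positivity)
    have h2 : 1 ≤ (1 + ‖ξ‖) ^ (2 * (n + 1)) * (1 + ‖ξ‖ ^ 2) ^ (-((n : ℝ) + 1)) := by
      rw [Real.rpow_neg (by positivity), show (n : ℝ) + 1 = ((n + 1 : ℕ) : ℝ) by push_cast; ring,
        Real.rpow_natCast, ← div_eq_mul_inv, one_le_div₀ (by positivity), pow_mul]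
      exact pow_le_pow_left₀ (by positivity) (by nlinarith [norm_nonneg ξ]) _
    calc C * (1 + ‖ξ‖) ^ M * ‖h ξ‖ = C * ‖h ξ‖ * (1 + ‖ξ‖) ^ M * 1 := by ring
      _ ≤ C * ‖h ξ‖ * (1 + ‖ξ‖) ^ M *
          ((1 + ‖ξ‖) ^ (2 * (n + 1)) * (1 + ‖ξ‖ ^ 2) ^ (-((n : ℝ) + 1))) := by gcongr
      _ = _ := by ring

/-- The Fourier transform of a tempered distribution with compact support is a function. -/
theorem exists_isRepresentedBy_fourier {u : 𝓢'(Rn n, ℂ)} {χ : 𝓢(Rn n, ℂ)}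
    (hu : ∀ φ, u φ = u (SchwartzMap.smulLeftCLM ℂ χ φ)) :
    ∃ g, IsRepresentedBy (𝓕 u) g ∧ TemperateL1 g := by
  -- a bound by a weighted `L¹` norm
  obtain ⟨N, C, hC0, hC⟩ : ∃ (N : ℕ) (C : ℝ), 0 ≤ C ∧
      ∀ Φ : 𝓢(Rn n, ℂ), ‖u (𝓕 Φ)‖ ≤ C * ∫ ξ, (1 + ‖ξ‖) ^ N * ‖Φ ξ‖ := by
    obtain ⟨s, C, -, hs⟩ := Seminorm.bound_of_continuous (schwartz_withSeminorms ℂ (Rn n) ℂ)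
      ((normSeminorm ℂ ℂ).comp u.toLinearMap) (continuous_norm.comp u.continuous)
    let N := s.sup Prod.snd
    have hint : ∀ (Φ : 𝓢(Rn n, ℂ)) (j : ℕ), Integrable fun ξ => (1 + ‖ξ‖) ^ j * ‖Φ ξ‖ := fun Φ j => by
      simp_rw [add_pow, one_pow, one_mul, Finset.sum_mul]
      refine integrable_finsetSum _ fun i _ => ?_
      have := (Φ.integrable_pow_mul (μ := volume) (j - i)).mul_const (j.choose i : ℝ)
      refine this.congr (ae_of_all _ fun ξ => ?_)
      ring
    let M : ℕ → ℝ := fun k => ∑ j ∈ Finset.range (N + 1), SchwartzMap.seminorm ℝ k j χ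
    have hM0 : ∀ k, 0 ≤ M k := fun k => Finset.sum_nonneg fun _ _ => apply_nonneg _ _
    have hpt : ∀ Φ : 𝓢(Rn n, ℂ), ∀ k j, j ≤ N →
        SchwartzMap.seminorm ℂ k j (SchwartzMap.smulLeftCLM ℂ χ (𝓕 Φ)) ≤
          (2 ^ N * ((2 * Real.pi) ^ N * (N + 1)) * M k) * ∫ ξ, (1 + ‖ξ‖) ^ N * ‖Φ ξ‖ := by
      intro Φ k j hj
      set I := ∫ ξ, (1 + ‖ξ‖) ^ N * ‖Φ ξ‖ with hI
      have hI0 : 0 ≤ I := integral_nonneg fun ξ => by positivity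
      -- The roles of the factors are exchanged: χ absorbs the polynomial weights, and only
      -- derivatives of 𝓕 Φ without weights remain. These are controlled by moments of Φ, with no
      -- derivative of Φ.
      have hcomm : SchwartzMap.smulLeftCLM ℂ χ (𝓕 Φ) = SchwartzMap.smulLeftCLM ℂ (𝓕 Φ : 𝓢(Rn n, ℂ)) χ := by
        ext x
        rw [SchwartzMap.smulLeftCLM_apply_apply χ.hasTemperateGrowth,
          SchwartzMap.smulLeftCLM_apply_apply (𝓕 Φ).hasTemperateGrowth, smul_eq_mul, smul_eq_mul,
          mul_comm]
      rw [hcomm]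
      have hpi : (1 : ℝ) ≤ 2 * Real.pi := by linarith [Real.pi_gt_three]
      have hB : ∀ i ≤ j, ∀ x ∈ tsupport χ, ‖iteratedFDeriv ℝ i (𝓕 Φ : 𝓢(Rn n, ℂ)) x‖ ≤
          (2 * Real.pi) ^ N * ((N + 1) * I) := by
        intro i hi x _
        refine (norm_iteratedFDeriv_fourier_le_integral Φ i x).trans ?_
        have h1 : (2 * Real.pi) ^ i ≤ (2 * Real.pi) ^ N := pow_le_pow_right₀ hpi (hi.trans hj)
        have h2 : (i : ℝ) ≤ N := by exact_mod_cast hi.trans hj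
        have h3 : ∫ ξ, (1 + ‖ξ‖) ^ i * ‖Φ ξ‖ ≤ I := integral_mono (hint Φ i) (hint Φ N) fun ξ => by
          have : (1 + ‖ξ‖) ^ i ≤ (1 + ‖ξ‖) ^ N :=
            pow_le_pow_right₀ (by linarith [norm_nonneg ξ]) (hi.trans hj)
          dsimp only; gcongr
        have h4 : 0 ≤ ∫ ξ, (1 + ‖ξ‖) ^ i * ‖Φ ξ‖ := integral_nonneg fun ξ => by positivity
        gcongr
      have := SchwartzMap.seminorm_smulLeftCLM_le (𝓕 Φ).hasTemperateGrowth (M := M k) (hM0 k) k j χ hB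
        (fun i hi => Finset.single_le_sum (f := fun j => SchwartzMap.seminorm ℝ k j χ)
          (fun _ _ => apply_nonneg _ _) (by grind))
      rw [max_eq_left (by positivity)] at this
      refine this.trans ?_
      have h1 : (2 : ℝ) ^ j ≤ 2 ^ N := pow_le_pow_right₀ one_le_two hj
      calc _ ≤ (2 : ℝ) ^ N * ((2 * Real.pi) ^ N * ((N + 1) * I) * M k) := by
            have := hM0 k
            gcongr
        _ = _ := by ring
    let K := ∑ m ∈ s, (2 ^ N * ((2 * Real.pi) ^ N * (N + 1)) * M m.1)
    have hterm : ∀ m ∈ s, 0 ≤ (2 ^ N * ((2 * Real.pi) ^ N * (N + 1)) * M m.1) := fun m _ => by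
      have := hM0 m.1
      have := Real.pi_pos
      positivity
    refine ⟨N, C * K, mul_nonneg C.2 (Finset.sum_nonneg hterm), fun Φ => ?_⟩
    have hI0 : 0 ≤ ∫ ξ, (1 + ‖ξ‖) ^ N * ‖Φ ξ‖ := integral_nonneg fun ξ => by positivity
    rw [hu]
    have h1 := Seminorm.le_def.1 hs (SchwartzMap.smulLeftCLM ℂ χ (𝓕 Φ))
    refine h1.trans ?_
    rw [smul_apply, NNReal.smul_def, smul_eq_mul, mul_assoc]
    refine mul_le_mul_of_nonneg_left ?_ C.2
    refine Seminorm.finset_sup_apply_le (mul_nonneg (Finset.sum_nonneg hterm) hI0) fun m hm => ?_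
    refine (hpt Φ m.1 m.2 (Finset.le_sup (f := Prod.snd) hm)).trans ?_
    gcongr
    exact Finset.single_le_sum (f := fun m : ℕ × ℕ => (2 ^ N * ((2 * Real.pi) ^ N * (N + 1)) * M m.1))
      hterm hm
  -- the Riesz representation theorem in a weighted `L²` space
  let r : ℝ := N + n + 1
  let ω : ℝ → Rn n → ℂ := fun r ξ => (((1 + ‖ξ‖ ^ 2) ^ r : ℝ) : ℂ)
  have hω : ∀ r, (ω r).HasTemperateGrowth := fun r =>
    Function.HasTemperateGrowth.comp Function.Complex.hasTemperateGrowth_ofReal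
      (Function.hasTemperateGrowth_one_add_norm_sq_rpow (Rn n) r)
  have hω1 : ∀ r, ω (-r) * ω r = 1 := fun r => by
    ext ξ
    simp only [ω, Pi.mul_apply, Pi.one_apply]
    rw [← Complex.ofReal_mul, ← Real.rpow_add (by positivity)]; simp
  have hwm := memLp_two_one_add_norm_sq_rpow (n := n) (r := n + 1) (by linarith)
  -- In the exponent r = N+n+1 the part N absorbs the growth (1+|ξ|)^N and the part n+1 leaves a
  -- square integrable weight. `A` is the constant produced by Cauchy–Schwarz against that weight.
  let A : ℝ := C * 2 ^ N * (∫ ξ : Rn n, ((1 + ‖ξ‖ ^ 2) ^ (-((n : ℝ) + 1))) ^ (2 : ℝ)) ^ (1 / 2 : ℝ)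
  let ℓ : 𝓢(Rn n, ℂ) →ₗ[ℂ] ℂ := (𝓕 u).toLinearMap ∘ₗ (SchwartzMap.smulLeftCLM ℂ (ω (-r))).toLinearMap
  have hℓ : ∀ Ψ, ‖ℓ Ψ‖ ≤ A * ‖(SchwartzMap.toLpCLM ℂ ℂ 2 volume).toLinearMap Ψ‖ := by
    intro Ψ
    have h1 := hC (SchwartzMap.smulLeftCLM ℂ (ω (-r)) Ψ)
    refine h1.trans ?_
    have h2 : ∀ ξ, (1 + ‖ξ‖) ^ N * ‖SchwartzMap.smulLeftCLM ℂ (ω (-r)) Ψ ξ‖ ≤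
        2 ^ N * ((1 + ‖ξ‖ ^ 2) ^ (-((n : ℝ) + 1)) * ‖Ψ ξ‖) := fun ξ => by
      rw [SchwartzMap.smulLeftCLM_apply_apply (hω _), norm_smul]
      have : ‖ω (-r) ξ‖ = (1 + ‖ξ‖ ^ 2) ^ (-((n : ℝ) + 1)) * ((1 + ‖ξ‖ ^ 2) ^ N)⁻¹ := by
        simp only [ω, Complex.norm_real, r]
        rw [Real.norm_of_nonneg (by positivity), ← Real.rpow_natCast (1 + ‖ξ‖ ^ 2) N, ← Real.rpow_neg (by positivity),
          ← Real.rpow_add (by positivity)]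
        congr 1; ring
      rw [this]
      have h3 : (1 + ‖ξ‖) ^ N ≤ 2 ^ N * (1 + ‖ξ‖ ^ 2) ^ N := by
        rw [← mul_pow]
        exact pow_le_pow_left₀ (by positivity) (by nlinarith [sq_nonneg (‖ξ‖ - 1), norm_nonneg ξ]) N
      calc _ ≤ 2 ^ N * (1 + ‖ξ‖ ^ 2) ^ N *
            ((1 + ‖ξ‖ ^ 2) ^ (-((n : ℝ) + 1)) * ((1 + ‖ξ‖ ^ 2) ^ N)⁻¹ * ‖Ψ ξ‖) := by gcongr
        _ = _ := by field_simp
    have hΨm : MemLp (fun ξ => ‖Ψ ξ‖) 2 := (Ψ.memLp 2 volume).norm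
    have hprod : Integrable fun ξ : Rn n => (1 + ‖ξ‖ ^ 2) ^ (-((n : ℝ) + 1)) * ‖Ψ ξ‖ :=
      hwm.integrable_mul hΨm
    have hΨn : ‖(SchwartzMap.toLpCLM ℂ ℂ 2 volume).toLinearMap Ψ‖ =
        (∫ ξ, ‖Ψ ξ‖ ^ (2 : ℝ)) ^ (1 / 2 : ℝ) := by
      have := SchwartzMap.norm_toLp' (f := Ψ) (p := 2) (μ := volume) (by simp) (by simp)
      simpa using this
    calc _ ≤ C * ∫ ξ, 2 ^ N * ((1 + ‖ξ‖ ^ 2) ^ (-((n : ℝ) + 1)) * ‖Ψ ξ‖) := by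
          refine mul_le_mul_of_nonneg_left ?_ hC0
          exact integral_mono_of_nonneg (ae_of_all _ fun ξ => by positivity) (hprod.const_mul _)
            (ae_of_all _ h2)
      _ = C * 2 ^ N * ∫ ξ, (1 + ‖ξ‖ ^ 2) ^ (-((n : ℝ) + 1)) * ‖Ψ ξ‖ := by
          rw [integral_const_mul, mul_assoc]
      _ ≤ C * 2 ^ N * ((∫ ξ : Rn n, ((1 + ‖ξ‖ ^ 2) ^ (-((n : ℝ) + 1))) ^ (2 : ℝ)) ^ (1 / 2 : ℝ) *
          (∫ ξ, ‖Ψ ξ‖ ^ (2 : ℝ)) ^ (1 / 2 : ℝ)) := by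
          refine mul_le_mul_of_nonneg_left ?_ (by positivity)
          refine integral_mul_le_Lp_mul_Lq_of_nonneg ⟨by norm_num, by norm_num, by norm_num⟩
            (ae_of_all _ fun ξ => by positivity) (ae_of_all _ fun ξ => by positivity) ?_ ?_
          · simpa using hwm
          · simpa using hΨm
      _ = _ := by rw [hΨn]; ring
  have hdense : DenseRange (SchwartzMap.toLpCLM ℂ ℂ 2 (volume : Measure (Rn n))).toLinearMap := by
    have := SchwartzMap.denseRange_toLpCLM (F := ℂ) (E := Rn n) (p := 2) (μ := volume) (by simp)
    exact this
  let L : Lp ℂ 2 (volume : Measure (Rn n)) →L[ℂ] ℂ :=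
    ℓ.extendOfNorm (SchwartzMap.toLpCLM ℂ ℂ 2 volume).toLinearMap
  have hL : ∀ Ψ, L (SchwartzMap.toLpCLM ℂ ℂ 2 volume Ψ) = ℓ Ψ :=
    LinearMap.extendOfNorm_eq hdense ⟨A, hℓ⟩
  let h := (InnerProductSpace.toDual ℂ _).symm L
  have hh : ∀ f : Lp ℂ 2 (volume : Measure (Rn n)), L f = inner ℂ h f := fun f =>
    (InnerProductSpace.toDual_symm_apply).symm
  -- The conjugate appears because the inner product is conjugate linear in its first entry, where
  -- the Riesz vector h stands; the factor `ω r` undoes the weight.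
  let g : Rn n → ℂ := fun ξ => ω r ξ * starRingEnd ℂ (h ξ)
  have hgm : TemperateL1 g := by
    have hm : AEStronglyMeasurable h := Lp.aestronglyMeasurable h
    refine temperateL1_of_memLp (h := h) (C := 1) (M := 2 * (N + n + 1)) ?_ (Lp.memLp h)
      (ae_of_all _ fun ξ => ?_)
    · exact (hω r).1.continuous.aestronglyMeasurable.mul hm.star
    · simp only [g, ω, norm_mul, RCLike.norm_conj, Complex.norm_real, one_mul]
      gcongr
      rw [Real.norm_of_nonneg (by positivity), pow_mul,
        show r = ((N + n + 1 : ℕ) : ℝ) by simp [r], Real.rpow_natCast]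
      exact pow_le_pow_left₀ (by positivity) (by nlinarith [norm_nonneg ξ]) _
  refine ⟨g, fun Φ => ⟨hgm.integrable_mul Φ, ?_⟩, hgm⟩
  have hΦ : Φ = SchwartzMap.smulLeftCLM ℂ (ω (-r)) (SchwartzMap.smulLeftCLM ℂ (ω r) Φ) := by
    rw [SchwartzMap.smulLeftCLM_smulLeftCLM_apply (hω _) (hω _), hω1]
    ext; simp [Pi.one_def]
  have h2 : 𝓕 u Φ = ℓ (SchwartzMap.smulLeftCLM ℂ (ω r) Φ) := by
    change _ = 𝓕 u (SchwartzMap.smulLeftCLM ℂ (ω (-r)) (SchwartzMap.smulLeftCLM ℂ (ω r) Φ))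
    rw [← hΦ]
  rw [h2, ← hL, hh, L2.inner_def]
  refine integral_congr_ae ?_
  filter_upwards [SchwartzMap.coeFn_toLp (SchwartzMap.smulLeftCLM ℂ (ω r) Φ) 2 volume] with ξ hξ
  rw [SchwartzMap.toLpCLM_apply, hξ, SchwartzMap.smulLeftCLM_apply_apply (hω _)]
  simp only [g, RCLike.inner_apply, smul_eq_mul]
  ring

end Weights

/-! ### The continuous representative of the Fourier transform of a cut-off distribution. -/

section LocalFourier

variable {n : ℕ}

/-- The value at `ξ` of the convolution of the Fourier transform of `u` with `ψ (- ·)`. -/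
noncomputable def localFourier (ψ : 𝓢(Rn n, ℂ)) (u : 𝓢'(Rn n, ℂ)) (ξ : Rn n) : ℂ :=
  𝓕 u (SchwartzMap.compSubConstCLM ℂ ξ ψ)

theorem localFourier_eq_integral (ψ : 𝓢(Rn n, ℂ)) {u : 𝓢'(Rn n, ℂ)} {g : Rn n → ℂ}
    (hg : IsRepresentedBy (𝓕 u) g) (ξ : Rn n) :
    Integrable (fun η => ψ (η - ξ) * g η) ∧ localFourier ψ u ξ = ∫ η, ψ (η - ξ) * g η :=
  hg (SchwartzMap.compSubConstCLM ℂ ξ ψ)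

/-- From 1+|η| ≤ (1+|ξ|)(1+|η-ξ|). It provides a dominating function in η that is uniform for ξ in
bounded sets. -/
theorem SchwartzMap.exists_norm_sub_le (ψ : 𝓢(Rn n, ℂ)) (N : ℕ) : ∃ C : ℝ, 0 ≤ C ∧ ∀ ξ η,
    ‖ψ (η - ξ)‖ ≤ C * (1 + ‖ξ‖) ^ N * ((1 + ‖η‖) ^ N)⁻¹ := by
  obtain ⟨s, C, hC0, hC⟩ := SchwartzMap.exists_one_add_pow_mul_le (n := n) N
  refine ⟨C * s.sup (schwartzSeminormFamily ℂ (Rn n) ℂ) ψ, mul_nonneg hC0 (apply_nonneg _ _),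
    fun ξ η => ?_⟩
  rw [le_mul_inv_iff₀ (by positivity)]
  have h1 := hC ψ (η - ξ)
  have h2 : (1 + ‖η‖) ^ N ≤ (1 + ‖ξ‖) ^ N * (1 + ‖η - ξ‖) ^ N := by
    rw [← mul_pow]
    refine pow_le_pow_left₀ (by positivity) ?_ N
    have : ‖η‖ ≤ ‖η - ξ‖ + ‖ξ‖ := by simpa using norm_add_le (η - ξ) ξ
    nlinarith [norm_nonneg ξ, norm_nonneg (η - ξ)]
  calc _ ≤ ‖ψ (η - ξ)‖ * ((1 + ‖ξ‖) ^ N * (1 + ‖η - ξ‖) ^ N) := by gcongr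
    _ = ((1 + ‖η - ξ‖) ^ N * ‖ψ (η - ξ)‖) * (1 + ‖ξ‖) ^ N := by ring
    _ ≤ _ := by gcongr

theorem continuous_integral_schwartz_sub_mul (ψ : 𝓢(Rn n, ℂ)) {g : Rn n → ℂ} (hg : TemperateL1 g) :
    Continuous fun ξ => ∫ η, ψ (η - ξ) * g η := by
  have hgm := hg.aestronglyMeasurable
  obtain ⟨N, hN⟩ := hg
  obtain ⟨C, hC0, hC⟩ := ψ.exists_norm_sub_le N
  refine continuous_iff_continuousAt.2 fun ξ₀ => ?_
  refine continuousAt_of_dominated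
    (bound := fun η => C * (2 + ‖ξ₀‖) ^ N * ‖(((1 + ‖η‖) ^ N)⁻¹ : ℝ) • g η‖) ?_ ?_ ?_ ?_
  · exact Eventually.of_forall fun ξ =>
      (ψ.continuous.comp (by fun_prop : Continuous fun η : Rn n => η - ξ)).aestronglyMeasurable.mul hgm
  · filter_upwards [Metric.ball_mem_nhds ξ₀ one_pos] with ξ hξ
    refine ae_of_all _ fun η => ?_
    have : ‖ξ‖ ≤ ‖ξ₀‖ + 1 := by
      have h1 : ‖ξ‖ ≤ ‖ξ₀‖ + ‖ξ - ξ₀‖ := by simpa using norm_add_le ξ₀ (ξ - ξ₀)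
      have h2 : ‖ξ - ξ₀‖ < 1 := by simpa [dist_eq_norm] using hξ
      linarith
    rw [norm_mul, norm_smul, norm_inv, Real.norm_of_nonneg (by positivity : 0 ≤ (1 + ‖η‖) ^ N)]
    calc _ ≤ (C * (1 + ‖ξ‖) ^ N * ((1 + ‖η‖) ^ N)⁻¹) * ‖g η‖ := by gcongr; exact hC ξ η
      _ ≤ (C * (2 + ‖ξ₀‖) ^ N * ((1 + ‖η‖) ^ N)⁻¹) * ‖g η‖ := by
          gcongr ?_ * ?_
          gcongr C * ?_ ^ N * _
          linarith
      _ = _ := by ring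
  · exact hN.norm.const_mul _
  · exact ae_of_all _ fun η => ((ψ.continuous.comp
      (by fun_prop : Continuous fun ξ : Rn n => η - ξ)).mul continuous_const).continuousAt

/-- A cut-off distribution has a Fourier transform which is the continuous function
`localFourier`. -/
theorem localFourier_spec {u : 𝓢'(Rn n, ℂ)} {χ : 𝓢(Rn n, ℂ)}
    (hu : ∀ φ, u φ = u (SchwartzMap.smulLeftCLM ℂ χ φ)) :
    IsRepresentedBy (𝓕 u) (localFourier (𝓕⁻ χ) u) ∧ TemperateL1 (localFourier (𝓕⁻ χ) u) ∧
      Continuous (localFourier (𝓕⁻ χ) u) := by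
  obtain ⟨g, hg, hgt⟩ := exists_isRepresentedBy_fourier hu
  set ψ : 𝓢(Rn n, ℂ) := 𝓕⁻ χ with hψ
  have hfun : localFourier ψ u = fun ξ => ∫ η, ψ (η - ξ) * g η :=
    funext fun ξ => (localFourier_eq_integral ψ hg ξ).2
  have hcont : Continuous (localFourier ψ u) := hfun ▸ continuous_integral_schwartz_sub_mul ψ hgt
  have hae : g =ᵐ[volume] localFourier ψ u := by
    refine ae_eq_of_integral_schwartz_mul_eq hg.locallyIntegrable hcont.locallyIntegrable fun Φ => ?_
    -- Invariance of u under multiplication by χ becomes, on the Fourier side, invariance under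
    -- convolution with ψ; Fubini then moves the convolution from the test function to g.
    have h1 : 𝓕 (SchwartzMap.convolution (ContinuousLinearMap.mul ℂ ℂ) Φ ψ) =
        SchwartzMap.smulLeftCLM ℂ χ (𝓕 Φ) := by
      rw [SchwartzMap.fourier_convolution]
      ext x
      rw [SchwartzMap.smulLeftCLM_apply_apply χ.hasTemperateGrowth]
      simp [hψ, SchwartzMap.pairing_apply_apply, mul_comm]
    have h2 : 𝓕 u Φ = 𝓕 u (SchwartzMap.convolution (ContinuousLinearMap.mul ℂ ℂ) Φ ψ) := by
      rw [TemperedDistribution.fourier_apply, hu, TemperedDistribution.fourier_apply, h1]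
    rw [← (hg Φ).2, h2, (hg _).2]
    have hgm := hgt.aestronglyMeasurable
    obtain ⟨N, hN⟩ := hgt
    obtain ⟨C, hC0, hC⟩ := ψ.exists_norm_sub_le N
    have hint : Integrable (fun p : Rn n × Rn n => ψ (p.2 - p.1) * g p.2 * Φ p.1)
        (volume.prod volume) := by
      have hΦi : Integrable fun ξ => (1 + ‖ξ‖) ^ N * ‖Φ ξ‖ := by
        simp_rw [add_pow, one_pow, one_mul, Finset.sum_mul]
        refine integrable_finsetSum _ fun i _ => ?_
        have := (Φ.integrable_pow_mul (μ := volume) (N - i)).mul_const (N.choose i : ℝ)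
        refine this.congr (ae_of_all _ fun ξ => ?_)
        ring
      refine ((hΦi.mul_prod hN.norm).const_mul C).mono' ?_ (ae_of_all _ fun p => ?_)
      · exact ((ψ.continuous.comp (by fun_prop :
          Continuous fun p : Rn n × Rn n => p.2 - p.1)).aestronglyMeasurable.mul hgm.comp_snd).mul
          (Φ.continuous.comp continuous_fst).aestronglyMeasurable
      · rw [norm_mul, norm_mul, norm_smul, norm_inv,
          Real.norm_of_nonneg (by positivity : 0 ≤ (1 + ‖p.2‖) ^ N)]
        calc _ ≤ (C * (1 + ‖p.1‖) ^ N * ((1 + ‖p.2‖) ^ N)⁻¹) * ‖g p.2‖ * ‖Φ p.1‖ := by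
              gcongr; exact hC _ _
          _ = _ := by ring
    calc _ = ∫ η, ∫ ξ, ψ (η - ξ) * g η * Φ ξ := by
          refine integral_congr_ae (ae_of_all _ fun η => ?_)
          simp only
          rw [SchwartzMap.convolution_apply, convolution_def, ← integral_mul_const]
          refine integral_congr_ae (ae_of_all _ fun ξ => ?_)
          simp only [ContinuousLinearMap.mul_apply']
          ring
      _ = ∫ ξ, ∫ η, ψ (η - ξ) * g η * Φ ξ := (integral_integral_swap hint).symm
      _ = _ := by
          refine integral_congr_ae (ae_of_all _ fun ξ => ?_)
          simp only
          rw [hfun, integral_mul_const, mul_comm]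
  refine ⟨hg.congr hae, hgt.mono hcont.aestronglyMeasurable (C := 1) ?_, hcont⟩
  filter_upwards [hae] with ξ hξ
  rw [hξ, one_mul]

/-- A distribution vanishing outside a ball does not change when it is cut off. -/
theorem Distribution.IsVanishingOn.eq_smulLeftCLM {u : 𝓢'(Rn n, ℂ)} {R : ℝ}
    (hu : Distribution.IsVanishingOn u {x : Rn n | R < ‖x‖}) {χ : 𝓢(Rn n, ℂ)} {R' : ℝ} (hR : R < R')
    (hχ : ∀ x, ‖x‖ ≤ R' → χ x = 1) (φ : 𝓢(Rn n, ℂ)) :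
    u φ = u (SchwartzMap.smulLeftCLM ℂ χ φ) := by
  rw [← sub_eq_zero, ← map_sub]
  refine hu _ fun x hx => ?_
  by_contra hlt
  simp only [mem_ofPred_eq, not_lt] at hlt
  refine (notMem_tsupport_iff_eventuallyEq.2 ?_) hx
  filter_upwards [continuous_norm.continuousAt.eventually_lt continuousAt_const (hlt.trans_lt hR)]
    with y hy
  rw [sub_apply, SchwartzMap.smulLeftCLM_apply_apply χ.hasTemperateGrowth, hχ y hy.le]
  simp

end LocalFourier

/-! ### A jointly measurable Fourier transform of the forcing. -/

section Forcing

variable {n : ℕ}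

theorem measurable_uncurry_of_continuous_right {f : ℝ → Rn n → ℂ} (h1 : ∀ s, Continuous (f s))
    (h2 : ∀ ξ, Measurable fun s => f s ξ) : Measurable (Function.uncurry f) :=
  (measurable_uncurry_of_continuous_of_measurable (u := fun ξ s => f s ξ) h1 h2).comp measurable_swap

/-- A forcing term which is weakly measurable in time and supported in a fixed ball is given on the
Fourier side by a jointly measurable function, which is reproduced by convolution with a fixed
Schwartz function. -/
theorem exists_fourier_forcing (n : ℕ) {R : ℝ} (hR : 0 < R) : ∃ ψ : 𝓢(Rn n, ℂ),
    ∀ F : ℝ → 𝓢'(Rn n, ℂ), (∀ φ t, 0 ≤ t → IntervalIntegrable (fun s => F s φ) volume 0 t) →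
    (∀ᵐ t ∂(volume.restrict (Ioi (0 : ℝ))),
        Distribution.IsVanishingOn (F t) {x : Rn n | 2 * R < ‖x‖}) →
    ∃ f : ℝ → Rn n → ℂ, Measurable (Function.uncurry f) ∧
      ∀ᵐ s ∂(volume.restrict (Ioi (0 : ℝ))), IsRepresentedBy (𝓕 (F s)) (f s) ∧
        ∀ ξ, Integrable (fun η => ψ (η - ξ) * f s η) ∧ f s ξ = ∫ η, ψ (η - ξ) * f s η := by
  obtain ⟨χ, -, hχ⟩ := exists_schwartz_cutoff (E := Rn n)
  -- The cut-off equals 1 up to radius 3R, beyond the support radius 2R, because it has to be 1 on a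
  -- neighbourhood of the support.
  have hr : (0 : ℝ) < 3 * R := by positivity
  let χ' := χ.dilate (3 * R) hr.ne'
  have hχ' : ∀ x, ‖x‖ ≤ 3 * R → χ' x = 1 := fun x hx => by
    rw [SchwartzMap.dilate_apply, hχ]
    rwa [norm_smul, norm_inv, Real.norm_of_nonneg hr.le, inv_mul_le_one₀ hr]
  refine ⟨𝓕⁻ χ', fun F hF hvan => ?_⟩
  set ψ : 𝓢(Rn n, ℂ) := 𝓕⁻ χ' with hψ
  have hmeas : ∀ φ, AEStronglyMeasurable (fun s => F s φ) (volume.restrict (Ioi (0 : ℝ))) := fun φ => by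
    have hU : Ioi (0 : ℝ) = ⋃ m : ℕ, Ioc (0 : ℝ) m := by
      ext x
      simp only [mem_Ioi, mem_iUnion, mem_Ioc]
      exact ⟨fun hx => (exists_nat_ge x).imp fun m hm => ⟨hx, hm⟩, fun ⟨m, hm⟩ => hm.1⟩
    rw [hU, aestronglyMeasurable_iUnion_iff]
    intro m
    have := hF φ m m.cast_nonneg
    rw [intervalIntegrable_iff_integrableOn_Ioc_of_le m.cast_nonneg] at this
    exact this.1
  -- For each ξ measurability in time holds only after modification on a null set depending on ξ. A
  -- countable dense set of frequencies allows a single null set, and continuity in ξ recovers the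
  -- other frequencies.
  obtain ⟨D, hD⟩ := TopologicalSpace.exists_dense_seq (Rn n)
  let ν := volume.restrict (Ioi (0 : ℝ))
  have hmk := fun i : ℕ => hmeas (𝓕 (SchwartzMap.compSubConstCLM ℂ (D i) ψ))
  have hgood : ∀ᵐ s ∂ν, Distribution.IsVanishingOn (F s) {x : Rn n | 2 * R < ‖x‖} ∧
      ∀ i, localFourier ψ (F s) (D i) = (hmk i).mk _ s :=
    hvan.and (ae_all_iff.2 fun i => (hmk i).ae_eq_mk)
  let G := (toMeasurable ν {s | ¬ (Distribution.IsVanishingOn (F s) {x : Rn n | 2 * R < ‖x‖} ∧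
      ∀ i, localFourier ψ (F s) (D i) = (hmk i).mk _ s)})ᶜ
  have hGm : MeasurableSet G := (measurableSet_toMeasurable _ _).compl
  have hGae : ∀ᵐ s ∂ν, s ∈ G := by
    rw [ae_iff]
    simp only [G, notMem_compl_iff, ofPred_mem_eq]
    rw [measure_toMeasurable]
    exact ae_iff.1 hgood
  have hGs : ∀ s ∈ G, Distribution.IsVanishingOn (F s) {x : Rn n | 2 * R < ‖x‖} ∧
      ∀ i, localFourier ψ (F s) (D i) = (hmk i).mk _ s := fun s hs => by
    by_contra hcon
    exact hs (subset_toMeasurable ν _ hcon)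
  have hspec : ∀ s ∈ G, IsRepresentedBy (𝓕 (F s)) (localFourier ψ (F s)) ∧
      TemperateL1 (localFourier ψ (F s)) ∧ Continuous (localFourier ψ (F s)) := fun s hs =>
    localFourier_spec fun φ => (hGs s hs).1.eq_smulLeftCLM (by linarith) hχ' φ
  let f : ℝ → Rn n → ℂ := fun s ξ => G.indicator (fun s => localFourier ψ (F s) ξ) s
  have hfG : ∀ s ∈ G, f s = localFourier ψ (F s) := fun s hs => by
    ext ξ; simp [f, hs]
  have hfG' : ∀ s ∉ G, f s = 0 := fun s hs => by
    ext ξ; simp [f, hs]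
  have hcont : ∀ s, Continuous fun ξ => f s ξ := fun s => by
    by_cases hs : s ∈ G
    · have : (fun ξ => f s ξ) = localFourier ψ (F s) := hfG s hs
      rw [this]; exact (hspec s hs).2.2
    · have : (fun ξ => f s ξ) = 0 := hfG' s hs
      rw [this]; exact continuous_zero
  have hmD : ∀ i, Measurable fun s => f s (D i) := fun i => by
    have : (fun s => f s (D i)) = G.indicator ((hmk i).mk _) := by
      ext s
      by_cases hs : s ∈ G
      · simp only [f, hs, indicator_of_mem, (hGs s hs).2 i]
      · simp [f, hs]
    rw [this]
    exact (hmk i).stronglyMeasurable_mk.measurable.indicator hGm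
  have hmξ : ∀ ξ, Measurable fun s => f s ξ := fun ξ => by
    obtain ⟨x, hx, hlim⟩ := mem_closure_iff_seq_limit.1 (hD ξ)
    choose i hi using hx
    refine measurable_of_tendsto_metrizable (f := fun k s => f s (x k)) (fun k => ?_) ?_
    · rw [← hi k]; exact hmD (i k)
    · exact tendsto_pi_nhds.2 fun s => ((hcont s).tendsto ξ).comp hlim
  refine ⟨f, ?_, ?_⟩
  · exact measurable_uncurry_of_continuous_right hcont hmξ
  · filter_upwards [hGae] with s hs
    rw [hfG s hs]
    exact ⟨(hspec s hs).1, fun ξ => localFourier_eq_integral ψ (hspec s hs).1 ξ⟩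

end Forcing

/-! ### The wave multipliers and their trigonometric identities. -/

section WaveMultipliers

variable {n : ℕ}

/-- The multiplier `cos (t √(-Δ))`. -/
noncomputable def waveCos (t : ℝ) (ξ : Rn n) : ℝ := Real.cos (2 * Real.pi * ‖ξ‖ * t)

/-- The multiplier `sin (t √(-Δ)) / √(-Δ)`. -/
noncomputable def waveSin (t : ℝ) (ξ : Rn n) : ℝ := t * Real.sinc (2 * Real.pi * ‖ξ‖ * t)

/-- The multiplier `Δ`. -/
noncomputable def laplaceSymbol (ξ : Rn n) : ℝ := -(2 * Real.pi * ‖ξ‖) ^ 2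

theorem mul_waveSin (t : ℝ) (ξ : Rn n) :
    2 * Real.pi * ‖ξ‖ * waveSin t ξ = Real.sin (2 * Real.pi * ‖ξ‖ * t) := by
  rw [waveSin, ← mul_assoc]
  rcases eq_or_ne (2 * Real.pi * ‖ξ‖ * t) 0 with h | h
  · rw [h]; simp
  · rw [Real.sinc_of_ne_zero h, mul_div_cancel₀ _ h]

theorem waveSin_of_ne_zero (t : ℝ) {ξ : Rn n} (hξ : ξ ≠ 0) :
    waveSin t ξ = Real.sin (2 * Real.pi * ‖ξ‖ * t) / (2 * Real.pi * ‖ξ‖) := by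
  have : 2 * Real.pi * ‖ξ‖ ≠ 0 := by have := Real.pi_pos; positivity
  rw [eq_div_iff this, mul_comm, mul_waveSin]

theorem abs_waveCos_le (t : ℝ) (ξ : Rn n) : |waveCos t ξ| ≤ 1 := Real.abs_cos_le_one _

theorem abs_waveSin_le (t : ℝ) (ξ : Rn n) : |waveSin t ξ| ≤ |t| := by
  rw [waveSin, abs_mul]
  exact mul_le_of_le_one_right (abs_nonneg _) (Real.abs_sinc_le_one _)

/-- One of the two factors 2π|ξ| cancels the denominator of the sine multiplier, so the growth is of
first order, uniformly in t. -/
theorem abs_laplaceSymbol_mul_waveSin_le (t : ℝ) (ξ : Rn n) :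
    |laplaceSymbol ξ * waveSin t ξ| ≤ 2 * Real.pi * ‖ξ‖ := by
  have h : laplaceSymbol ξ * waveSin t ξ =
      -(2 * Real.pi * ‖ξ‖ * Real.sin (2 * Real.pi * ‖ξ‖ * t)) := by
    rw [← mul_waveSin, laplaceSymbol]; ring
  have h0 : 0 ≤ 2 * Real.pi * ‖ξ‖ := by have := Real.pi_pos; positivity
  rw [h, abs_neg, abs_mul, abs_of_nonneg h0]
  exact mul_le_of_le_one_right h0 (Real.abs_sin_le_one _)

theorem continuous_waveCos : Continuous fun p : ℝ × Rn n => waveCos p.1 p.2 := by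
  unfold waveCos; fun_prop

theorem continuous_waveSin : Continuous fun p : ℝ × Rn n => waveSin p.1 p.2 :=
  continuous_fst.mul (Real.continuous_sinc.comp (by fun_prop))

theorem continuous_waveCos_right (t : ℝ) : Continuous (waveCos t : Rn n → ℝ) := by
  unfold waveCos; fun_prop

theorem continuous_waveSin_right (t : ℝ) : Continuous (waveSin t : Rn n → ℝ) := by
  have h : Continuous fun ξ : Rn n => 2 * Real.pi * ‖ξ‖ * t := by fun_prop
  exact continuous_const.mul (Real.continuous_sinc.comp h)

theorem continuous_laplaceSymbol : Continuous (laplaceSymbol (n := n)) := by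
  unfold laplaceSymbol; fun_prop

theorem hasDerivAt_waveSin (t : ℝ) (ξ : Rn n) :
    HasDerivAt (fun t => waveSin t ξ) (waveCos t ξ) t := by
  rcases eq_or_ne ξ 0 with rfl | hξ
  · simpa [waveSin, waveCos] using hasDerivAt_id' t
  · have h0 : 2 * Real.pi * ‖ξ‖ ≠ 0 := by have := Real.pi_pos; positivity
    have h1 := ((((hasDerivAt_id t).const_mul (2 * Real.pi * ‖ξ‖)).sin).div_const (2 * Real.pi * ‖ξ‖))
    have h2 : (fun t => waveSin t ξ) =
        fun t => Real.sin (2 * Real.pi * ‖ξ‖ * id t) / (2 * Real.pi * ‖ξ‖) :=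
      funext fun t => waveSin_of_ne_zero t hξ
    rw [h2]
    refine h1.congr_deriv ?_
    simp only [waveCos, id]
    field_simp

theorem hasDerivAt_waveCos (t : ℝ) (ξ : Rn n) :
    HasDerivAt (fun t => waveCos t ξ) (laplaceSymbol ξ * waveSin t ξ) t := by
  have h1 := ((hasDerivAt_id t).const_mul (2 * Real.pi * ‖ξ‖)).cos
  refine h1.congr_deriv ?_
  have := mul_waveSin t ξ
  simp only [laplaceSymbol, id]
  rw [← this]; ring

theorem waveSin_sub (t s : ℝ) (ξ : Rn n) :
    waveSin (t - s) ξ = waveSin t ξ * waveCos s ξ - waveCos t ξ * waveSin s ξ := by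
  rcases eq_or_ne ξ 0 with rfl | hξ
  · simp [waveSin, waveCos]
  · rw [waveSin_of_ne_zero _ hξ, waveSin_of_ne_zero _ hξ, waveSin_of_ne_zero _ hξ, mul_sub,
      Real.sin_sub, waveCos, waveCos]
    ring

theorem waveCos_sub (t s : ℝ) (ξ : Rn n) : waveCos (t - s) ξ =
    waveCos t ξ * waveCos s ξ - laplaceSymbol ξ * waveSin t ξ * waveSin s ξ := by
  have h1 := mul_waveSin t ξ
  have h2 := mul_waveSin s ξ
  have : laplaceSymbol ξ * waveSin t ξ * waveSin s ξ =
      -((2 * Real.pi * ‖ξ‖ * waveSin t ξ) * (2 * Real.pi * ‖ξ‖ * waveSin s ξ)) := by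
    rw [laplaceSymbol]; ring
  rw [this, h1, h2]
  simp only [waveCos]
  rw [mul_sub, Real.cos_sub]; ring

theorem waveSin_zero (ξ : Rn n) : waveSin 0 ξ = 0 := by simp [waveSin]

theorem waveCos_zero (ξ : Rn n) : waveCos 0 ξ = 1 := by simp [waveCos]

theorem hasTemperateGrowth_laplaceSymbol :
    Function.HasTemperateGrowth fun ξ : Rn n => (laplaceSymbol ξ : ℂ) := by
  have h : (laplaceSymbol : Rn n → ℝ) = fun ξ => -(2 * Real.pi) ^ 2 * ‖ξ‖ ^ 2 := by
    ext ξ; rw [laplaceSymbol]; ring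
  refine Function.HasTemperateGrowth.comp Function.Complex.hasTemperateGrowth_ofReal ?_
  rw [h]
  exact (Function.HasTemperateGrowth.const _).mul (Function.hasTemperateGrowth_norm_sq (Rn n))

/-- The inverse Fourier transform of the Laplacian of a Schwartz function. -/
theorem fourierInv_laplacian (φ : 𝓢(Rn n, ℂ)) :
    𝓕⁻ (Δ φ) = SchwartzMap.smulLeftCLM ℂ (fun ξ : Rn n => (laplaceSymbol ξ : ℂ)) (𝓕⁻ φ) := by
  have h2 : (fun x : Rn n => ‖x‖ ^ 2).HasTemperateGrowth := Function.hasTemperateGrowth_norm_sq (Rn n)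
  have h : ∀ ξ, 𝓕 (Δ φ) ξ = (laplaceSymbol ξ : ℂ) * 𝓕 φ ξ := fun ξ => by
    rw [SchwartzMap.laplacian_eq_fourierMultiplierCLM, SchwartzMap.fourierMultiplierCLM_apply,
      FourierTransform.fourier_smul, FourierTransform.fourier_fourierInv_eq, smul_apply,
      SchwartzMap.smulLeftCLM_apply_apply h2]
    simp only [laplaceSymbol, Complex.real_smul]
    push_cast; ring
  ext ξ
  rw [SchwartzMap.smulLeftCLM_apply_apply hasTemperateGrowth_laplaceSymbol, smul_eq_mul]
  have h3 : ∀ g : 𝓢(Rn n, ℂ), (𝓕⁻ g) ξ = (𝓕 g) (-ξ) := fun g => by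
    rw [SchwartzMap.fourierInv_coe, SchwartzMap.fourier_coe, Real.fourierInv_eq_fourier_neg]
  rw [h3, h3, h]
  simp [laplaceSymbol]

end WaveMultipliers

/-! ### Differentiation of multiplier integrals in time. -/

section Integrals

variable {n : ℕ}

theorem hasDerivAt_integral_waveSin {g : Rn n → ℂ} (hg : Integrable g) (t : ℝ) :
    HasDerivAt (fun t => ∫ ξ, (waveSin t ξ : ℂ) * g ξ) (∫ ξ, (waveCos t ξ : ℂ) * g ξ) t := by
  have hcs : ∀ t : ℝ, Continuous fun ξ : Rn n => (waveSin t ξ : ℂ) := fun t =>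
    Complex.continuous_ofReal.comp (continuous_waveSin_right t)
  have hcc : ∀ t : ℝ, Continuous fun ξ : Rn n => (waveCos t ξ : ℂ) := fun t =>
    Complex.continuous_ofReal.comp (continuous_waveCos_right t)
  refine (hasDerivAt_integral_of_dominated_loc_of_deriv_le (bound := fun ξ => ‖g ξ‖)
    (F := fun t ξ => (waveSin t ξ : ℂ) * g ξ) (F' := fun t ξ => (waveCos t ξ : ℂ) * g ξ)
    (s := univ) Filter.univ_mem ?_ ?_ ?_ ?_ hg.norm ?_).2
  · exact Eventually.of_forall fun t => (hcs t).aestronglyMeasurable.mul hg.1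
  · refine (hg.norm.const_mul |t|).mono' ((hcs t).aestronglyMeasurable.mul hg.1)
      (ae_of_all _ fun ξ => ?_)
    rw [norm_mul, Complex.norm_real]
    gcongr; exact abs_waveSin_le t ξ
  · exact (hcc t).aestronglyMeasurable.mul hg.1
  · refine ae_of_all _ fun ξ t _ => ?_
    rw [norm_mul, Complex.norm_real]
    exact mul_le_of_le_one_left (norm_nonneg _) (abs_waveCos_le t ξ)
  · exact ae_of_all _ fun ξ t _ => (hasDerivAt_waveSin t ξ).ofReal_comp.mul_const _

theorem hasDerivAt_integral_waveCos {g : Rn n → ℂ} (hg : Integrable g)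
    (hg' : Integrable fun ξ => ‖ξ‖ * ‖g ξ‖) (t : ℝ) :
    HasDerivAt (fun t => ∫ ξ, (waveCos t ξ : ℂ) * g ξ)
      (∫ ξ, ((laplaceSymbol ξ * waveSin t ξ : ℝ) : ℂ) * g ξ) t := by
  have hcs : ∀ t : ℝ, Continuous fun ξ : Rn n => ((laplaceSymbol ξ * waveSin t ξ : ℝ) : ℂ) := fun t =>
    Complex.continuous_ofReal.comp (continuous_laplaceSymbol.mul (continuous_waveSin_right t))
  have hcc : ∀ t : ℝ, Continuous fun ξ : Rn n => (waveCos t ξ : ℂ) := fun t =>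
    Complex.continuous_ofReal.comp (continuous_waveCos_right t)
  refine (hasDerivAt_integral_of_dominated_loc_of_deriv_le
    (bound := fun ξ => 2 * Real.pi * (‖ξ‖ * ‖g ξ‖))
    (F := fun t ξ => (waveCos t ξ : ℂ) * g ξ)
    (F' := fun t ξ => ((laplaceSymbol ξ * waveSin t ξ : ℝ) : ℂ) * g ξ)
    (s := univ) Filter.univ_mem ?_ ?_ ?_ ?_ (hg'.const_mul _) ?_).2
  · exact Eventually.of_forall fun t => (hcc t).aestronglyMeasurable.mul hg.1
  · refine hg.norm.mono' ((hcc t).aestronglyMeasurable.mul hg.1)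
      (ae_of_all _ fun ξ => ?_)
    rw [norm_mul, Complex.norm_real]
    exact mul_le_of_le_one_left (norm_nonneg _) (abs_waveCos_le t ξ)
  · exact (hcs t).aestronglyMeasurable.mul hg.1
  · refine ae_of_all _ fun ξ t _ => ?_
    rw [norm_mul, Complex.norm_real, ← mul_assoc]
    gcongr
    exact abs_laplaceSymbol_mul_waveSin_le t ξ
  · exact ae_of_all _ fun ξ t _ => (hasDerivAt_waveCos t ξ).ofReal_comp.mul_const _

end Integrals

/-! ### Free waves with function-valued Fourier data. -/

section FreeSolutions

variable {n : ℕ}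

theorem TemperateL1.mul_bound {a b : Rn n → ℂ} (ha : TemperateL1 a) (hb : AEStronglyMeasurable b)
    {C : ℝ} (M : ℕ) (h : ∀ ξ, ‖b ξ‖ ≤ C * (1 + ‖ξ‖) ^ M) : TemperateL1 fun ξ => b ξ * a ξ := by
  have ham := ha.aestronglyMeasurable
  obtain ⟨N, hN⟩ := ha
  refine ⟨N + M, (hN.norm.const_mul C).mono' ?_ (ae_of_all _ fun ξ => ?_)⟩
  · exact (by fun_prop (disch := intros; positivity) :
      Continuous fun ξ : Rn n => ((1 + ‖ξ‖) ^ (N + M))⁻¹).aestronglyMeasurable.smul (hb.mul ham)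
  · rw [norm_smul, norm_smul, norm_inv, norm_inv, norm_mul,
      Real.norm_of_nonneg (by positivity : 0 ≤ (1 + ‖ξ‖) ^ (N + M)),
      Real.norm_of_nonneg (by positivity : 0 ≤ (1 + ‖ξ‖) ^ N), inv_mul_le_iff₀ (by positivity)]
    calc _ ≤ C * (1 + ‖ξ‖) ^ M * ‖a ξ‖ := by gcongr; exact h ξ
      _ = _ := by rw [pow_add]; field_simp

theorem TemperateL1.add {a b : Rn n → ℂ} (ha : TemperateL1 a) (hb : TemperateL1 b) :
    TemperateL1 fun ξ => a ξ + b ξ := by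
  have key : ∀ {a : Rn n → ℂ} {N : ℕ}, Integrable (fun ξ => (((1 + ‖ξ‖) ^ N)⁻¹ : ℝ) • a ξ) →
      ∀ M, Integrable fun ξ => (((1 + ‖ξ‖) ^ (N + M))⁻¹ : ℝ) • a ξ := fun {a N} h M => by
    have hm := TemperateL1.aestronglyMeasurable ⟨N, h⟩
    refine h.norm.mono' ?_ (ae_of_all _ fun ξ => ?_)
    · exact (by fun_prop (disch := intros; positivity) :
        Continuous fun ξ : Rn n => ((1 + ‖ξ‖) ^ (N + M))⁻¹).aestronglyMeasurable.smul hm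
    · rw [norm_smul, norm_smul, norm_inv, norm_inv,
        Real.norm_of_nonneg (by positivity : 0 ≤ (1 + ‖ξ‖) ^ (N + M)),
        Real.norm_of_nonneg (by positivity : 0 ≤ (1 + ‖ξ‖) ^ N)]
      gcongr
      · linarith [norm_nonneg ξ]
      · omega
  obtain ⟨N, hN⟩ := ha
  obtain ⟨M, hM⟩ := hb
  refine ⟨N + M, ?_⟩
  simp_rw [smul_add]
  exact (key hN M).add (by rw [add_comm N M]; exact key hM N)

/-- The Fourier transform at time `t` of the free wave with the Fourier transformed data `a`, `b`. -/
noncomputable def freeHat (a b : Rn n → ℂ) (t : ℝ) (ξ : Rn n) : ℂ :=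
  (waveCos t ξ : ℂ) * a ξ + (waveSin t ξ : ℂ) * b ξ

/-- The time derivative of `freeHat`. -/
noncomputable def freeHat' (a b : Rn n → ℂ) (t : ℝ) (ξ : Rn n) : ℂ :=
  ((laplaceSymbol ξ * waveSin t ξ : ℝ) : ℂ) * a ξ + (waveCos t ξ : ℂ) * b ξ

theorem temperateL1_waveCos_mul {a : Rn n → ℂ} (ha : TemperateL1 a) (t : ℝ) :
    TemperateL1 fun ξ => (waveCos t ξ : ℂ) * a ξ :=
  ha.mul_bound (Complex.continuous_ofReal.comp (continuous_waveCos_right t)).aestronglyMeasurable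
    (C := 1) 0 fun ξ => by
      simpa only [Complex.norm_real, pow_zero, mul_one, Function.comp, Real.norm_eq_abs] using abs_waveCos_le t ξ

theorem temperateL1_waveSin_mul {a : Rn n → ℂ} (ha : TemperateL1 a) (t : ℝ) :
    TemperateL1 fun ξ => (waveSin t ξ : ℂ) * a ξ :=
  ha.mul_bound (Complex.continuous_ofReal.comp (continuous_waveSin_right t)).aestronglyMeasurable
    (C := |t|) 0 fun ξ => by
      simpa only [Complex.norm_real, pow_zero, mul_one, Function.comp, Real.norm_eq_abs] using abs_waveSin_le t ξ

theorem temperateL1_laplace_waveSin_mul {a : Rn n → ℂ} (ha : TemperateL1 a) (t : ℝ) :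
    TemperateL1 fun ξ => ((laplaceSymbol ξ * waveSin t ξ : ℝ) : ℂ) * a ξ :=
  ha.mul_bound (Complex.continuous_ofReal.comp
    (continuous_laplaceSymbol.mul (continuous_waveSin_right t))).aestronglyMeasurable
    (C := 2 * Real.pi) 1 fun ξ => by
      simp only [Complex.norm_real, pow_one]
      refine (abs_laplaceSymbol_mul_waveSin_le t ξ).trans ?_
      have := Real.pi_pos
      gcongr
      linarith

theorem temperateL1_freeHat {a b : Rn n → ℂ} (ha : TemperateL1 a) (hb : TemperateL1 b) (t : ℝ) :
    TemperateL1 (freeHat a b t) :=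
  (temperateL1_waveCos_mul ha t).add (temperateL1_waveSin_mul hb t)

theorem temperateL1_freeHat' {a b : Rn n → ℂ} (ha : TemperateL1 a) (hb : TemperateL1 b) (t : ℝ) :
    TemperateL1 (freeHat' a b t) :=
  (temperateL1_laplace_waveSin_mul ha t).add (temperateL1_waveCos_mul hb t)

/-- Since |ξ| ≤ 1 + (2π|ξ|)² and the Laplace symbol maps Schwartz functions to Schwartz functions,
the first moment costs nothing. -/
theorem TemperateL1.integrable_norm_mul {a : Rn n → ℂ} (ha : TemperateL1 a) (Φ : 𝓢(Rn n, ℂ)) :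
    Integrable fun ξ => ‖ξ‖ * ‖Φ ξ * a ξ‖ := by
  have h1 := (ha.integrable_mul Φ).norm
  have h2 := (ha.integrable_mul
    (SchwartzMap.smulLeftCLM ℂ (fun ξ : Rn n => (laplaceSymbol ξ : ℂ)) Φ)).norm
  refine (h1.add h2).mono' (continuous_norm.aestronglyMeasurable.mul h1.1) (ae_of_all _ fun ξ => ?_)
  rw [Pi.add_apply, SchwartzMap.smulLeftCLM_apply_apply hasTemperateGrowth_laplaceSymbol, smul_eq_mul,
    mul_assoc, norm_mul (laplaceSymbol ξ : ℂ), Complex.norm_real, norm_mul ‖ξ‖, norm_norm, norm_norm,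
    laplaceSymbol, norm_neg, norm_pow, Real.norm_of_nonneg (by positivity : 0 ≤ 2 * Real.pi * ‖ξ‖)]
  have h3 : ‖ξ‖ ≤ 1 + (2 * Real.pi * ‖ξ‖) ^ 2 := by
    have : 1 ≤ (2 * Real.pi) ^ 2 := by nlinarith [Real.pi_gt_three]
    rw [mul_pow]
    nlinarith [sq_nonneg (‖ξ‖ - 1), sq_nonneg ‖ξ‖]
  nlinarith [norm_nonneg (Φ ξ * a ξ)]

theorem hasDerivAt_toDist_freeHat {a b : Rn n → ℂ} (ha : TemperateL1 a) (hb : TemperateL1 b)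
    (Φ : 𝓢(Rn n, ℂ)) (t : ℝ) :
    HasDerivAt (fun t => (temperateL1_freeHat ha hb t).toDist Φ)
      ((temperateL1_freeHat' ha hb t).toDist Φ) t := by
  have e1 : (fun t => (temperateL1_freeHat ha hb t).toDist Φ) = fun t =>
      (∫ ξ, (waveCos t ξ : ℂ) * (Φ ξ * a ξ)) + ∫ ξ, (waveSin t ξ : ℂ) * (Φ ξ * b ξ) := by
    ext t
    rw [TemperateL1.toDist_apply, ← integral_add]
    · congr 1; ext ξ; rw [freeHat]; ring
    · exact ((temperateL1_waveCos_mul ha t).integrable_mul Φ).congr (ae_of_all _ fun ξ => by ring)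
    · exact ((temperateL1_waveSin_mul hb t).integrable_mul Φ).congr (ae_of_all _ fun ξ => by ring)
  rw [e1]
  refine ((hasDerivAt_integral_waveCos (ha.integrable_mul Φ) (ha.integrable_norm_mul Φ) t).add
    (hasDerivAt_integral_waveSin (hb.integrable_mul Φ) t)).congr_deriv ?_
  rw [TemperateL1.toDist_apply, ← integral_add]
  · congr 1; ext ξ; rw [freeHat']; ring
  · exact ((temperateL1_laplace_waveSin_mul ha t).integrable_mul Φ).congr
      (ae_of_all _ fun ξ => by ring)
  · exact ((temperateL1_waveCos_mul hb t).integrable_mul Φ).congr (ae_of_all _ fun ξ => by ring)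

theorem hasDerivAt_toDist_freeHat' {a b : Rn n → ℂ} (ha : TemperateL1 a) (hb : TemperateL1 b)
    (Φ : 𝓢(Rn n, ℂ)) (t : ℝ) :
    HasDerivAt (fun t => (temperateL1_freeHat' ha hb t).toDist Φ)
      ((temperateL1_freeHat ha hb t).toDist
        (SchwartzMap.smulLeftCLM ℂ (fun ξ : Rn n => (laplaceSymbol ξ : ℂ)) Φ)) t := by
  set Ψ := SchwartzMap.smulLeftCLM ℂ (fun ξ : Rn n => (laplaceSymbol ξ : ℂ)) Φ with hΨ
  have hΨa : ∀ ξ, Ψ ξ = (laplaceSymbol ξ : ℂ) * Φ ξ := fun ξ => by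
    rw [hΨ, SchwartzMap.smulLeftCLM_apply_apply hasTemperateGrowth_laplaceSymbol, smul_eq_mul]
  have e1 : (fun t => (temperateL1_freeHat' ha hb t).toDist Φ) = fun t =>
      (∫ ξ, (waveSin t ξ : ℂ) * (Ψ ξ * a ξ)) + ∫ ξ, (waveCos t ξ : ℂ) * (Φ ξ * b ξ) := by
    ext t
    rw [TemperateL1.toDist_apply, ← integral_add]
    · congr 1; ext ξ; rw [freeHat', hΨa]; push_cast; ring
    · exact ((temperateL1_waveSin_mul ha t).integrable_mul Ψ).congr (ae_of_all _ fun ξ => by ring)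
    · exact ((temperateL1_waveCos_mul hb t).integrable_mul Φ).congr (ae_of_all _ fun ξ => by ring)
  rw [e1]
  refine ((hasDerivAt_integral_waveSin (ha.integrable_mul Ψ) t).add
    (hasDerivAt_integral_waveCos (hb.integrable_mul Φ) (hb.integrable_norm_mul Φ) t)).congr_deriv ?_
  rw [TemperateL1.toDist_apply, ← integral_add]
  · congr 1; ext ξ; rw [freeHat, hΨa]; push_cast; ring
  · exact ((temperateL1_waveCos_mul ha t).integrable_mul Ψ).congr (ae_of_all _ fun ξ => by ring)
  · exact ((temperateL1_laplace_waveSin_mul hb t).integrable_mul Φ).congr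
      (ae_of_all _ fun ξ => by ring)

/-- The functions `𝓕⁻ (freeHat a b t)` are solutions of the free wave equation. -/
theorem isWaveSolutionOn_free {a b : Rn n → ℂ} (ha : TemperateL1 a) (hb : TemperateL1 b) :
    IsWaveSolutionOn univ (fun t => 𝓕⁻ (temperateL1_freeHat ha hb t).toDist)
      (fun t => 𝓕⁻ (temperateL1_freeHat' ha hb t).toDist) 0 := by
  intro φ t _
  refine ⟨(hasDerivAt_toDist_freeHat ha hb (𝓕⁻ φ) t).hasDerivWithinAt, ?_, ?_⟩
  · have : (fun s : ℝ => (0 : ℝ → 𝓢'(Rn n, ℂ)) s φ) = fun _ => 0 := by ext; simp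
    rw [this]; exact intervalIntegrable_const
  · have e : ∀ s : ℝ, (Δ (𝓕⁻ (temperateL1_freeHat ha hb s).toDist)) φ +
        (0 : ℝ → 𝓢'(Rn n, ℂ)) s φ = (temperateL1_freeHat ha hb s).toDist
        (SchwartzMap.smulLeftCLM ℂ (fun ξ : Rn n => (laplaceSymbol ξ : ℂ)) (𝓕⁻ φ)) := fun s => by
      rw [TemperedDistribution.laplacian_apply_apply, TemperedDistribution.fourierInv_apply,
        fourierInv_laplacian]
      simp
    simp_rw [e]
    rw [intervalIntegral.integral_eq_sub_of_hasDerivAt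
      (fun s _ => hasDerivAt_toDist_freeHat' ha hb (𝓕⁻ φ) s)]
    · simp only [TemperedDistribution.fourierInv_apply]; ring
    · exact (continuous_iff_continuousAt.2 fun s =>
        (hasDerivAt_toDist_freeHat ha hb _ s).continuousAt).intervalIntegrable _ _

end FreeSolutions

/-! ### Differentiation of Volterra integrals. -/

section Volterra

variable {n : ℕ}

/-- The fundamental theorem of calculus for Volterra integrals with a smooth kernel. -/
theorem integral_volterra_eq {K K' : ℝ → Rn n → ℝ} (hK : ∀ ξ t, HasDerivAt (fun t => K t ξ) (K' t ξ) t)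
    (hKc' : Continuous fun p : ℝ × Rn n => K' p.1 p.2) {B T : ℝ}
    (hB : ∀ t ξ, |K' t ξ| ≤ B * (1 + ‖ξ‖)) {g : ℝ × Rn n → ℂ}
    (hg : Integrable (fun p => ((1 + ‖p.2‖ : ℝ) : ℂ) * g p) ((volume.restrict (Ioc 0 T)).prod volume))
    (hgi : Integrable g ((volume.restrict (Ioc 0 T)).prod volume))
    (hgK0 : Integrable (fun p => (K 0 p.2 : ℂ) * g p) ((volume.restrict (Ioc 0 T)).prod volume))
    (hT : 0 ≤ T) :
    IntervalIntegrable (fun r => ∫ p, (K' (r - p.1) p.2 : ℂ) * g p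
        ∂((volume.restrict (Ioc 0 r)).prod volume)) volume 0 T ∧
    ∫ p, (K (T - p.1) p.2 : ℂ) * g p ∂((volume.restrict (Ioc 0 T)).prod volume) =
      (∫ p, (K 0 p.2 : ℂ) * g p ∂((volume.restrict (Ioc 0 T)).prod volume)) +
      ∫ r in (0 : ℝ)..T, ∫ p, (K' (r - p.1) p.2 : ℂ) * g p
        ∂((volume.restrict (Ioc 0 r)).prod volume) := by
  set ν : Measure (ℝ × Rn n) := (volume.restrict (Ioc 0 T)).prod volume with hν
  -- For each source time s the identity is K(T-s) = K(0) + ∫_s^T K'(r-s) dr. Exchanging the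
  -- integrals over the triangle s ≤ r ≤ T gives the claim, with growth 1+|ξ| of K' absorbed by g.
  set S : Set (ℝ × (ℝ × Rn n)) := {q | q.2.1 ≤ q.1} with hS
  have hSm : MeasurableSet S :=
    measurableSet_le (measurable_fst.comp measurable_snd) measurable_fst
  let H : ℝ × (ℝ × Rn n) → ℂ := S.indicator fun q => (K' (q.1 - q.2.1) q.2.2 : ℂ) * g q.2
  have hcont : Continuous fun q : ℝ × (ℝ × Rn n) => (K' (q.1 - q.2.1) q.2.2 : ℂ) :=
    Complex.continuous_ofReal.comp (hKc'.comp
      (by fun_prop : Continuous fun q : ℝ × (ℝ × Rn n) => (q.1 - q.2.1, q.2.2)))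
  have hHi : Integrable H ((volume.restrict (Ioc 0 T)).prod ν) := by
    have h1 : Integrable (fun q : ℝ × (ℝ × Rn n) => B * ‖((1 + ‖q.2.2‖ : ℝ) : ℂ) * g q.2‖)
        ((volume.restrict (Ioc 0 T)).prod ν) := (hg.norm.const_mul B).comp_snd _
    refine h1.mono' ?_ (ae_of_all _ fun q => ?_)
    · exact (hcont.aestronglyMeasurable.mul hgi.1.comp_snd).indicator hSm
    · refine (norm_indicator_le_norm_self _ _).trans ?_
      rw [norm_mul, norm_mul, Complex.norm_real, Complex.norm_real, Real.norm_eq_abs,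
        Real.norm_of_nonneg (by positivity), ← mul_assoc]
      gcongr
      exact hB _ _
  have hinner : ∀ r ∈ Ioc 0 T, ∫ p, H (r, p) ∂ν =
      ∫ p, (K' (r - p.1) p.2 : ℂ) * g p ∂((volume.restrict (Ioc 0 r)).prod volume) := by
    intro r hr
    have h1 : (fun p => H (r, p)) = (Iic r ×ˢ (univ : Set (Rn n))).indicator
        fun p => (K' (r - p.1) p.2 : ℂ) * g p := by
      ext p
      simp only [H, S, indicator_apply, mem_ofPred_eq, mem_prod, mem_Iic, mem_univ, and_true]
    rw [h1, integral_indicator (measurableSet_Iic.prod MeasurableSet.univ)]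
    have h2 : ν.restrict (Iic r ×ˢ (univ : Set (Rn n))) = (volume.restrict (Ioc 0 r)).prod volume := by
      rw [hν, ← Measure.prod_restrict, Measure.restrict_univ,
        Measure.restrict_restrict measurableSet_Iic]
      congr 2
      ext x
      simp only [mem_inter_iff, mem_Iic, mem_Ioc]
      constructor
      · rintro ⟨h, h', -⟩; exact ⟨h', h⟩
      · rintro ⟨h, h'⟩; exact ⟨h', h, h'.trans hr.2⟩
    rw [h2]
  constructor
  · rw [intervalIntegrable_iff_integrableOn_Ioc_of_le hT]
    refine hHi.integral_prod_left.congr ?_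
    rw [EventuallyEq, ae_restrict_iff' measurableSet_Ioc]
    exact ae_of_all _ hinner
  · rw [intervalIntegral.integral_of_le hT, ← setIntegral_congr_fun measurableSet_Ioc hinner,
      integral_integral_swap (f := fun r p => H (r, p)) hHi, ← integral_add hgK0]
    · have hae : ∀ᵐ p ∂ν, p.1 ∈ Ioc 0 T := by
        have h3 : ν.restrict (Ioc 0 T ×ˢ univ) = ν := by
          rw [hν, ← Measure.prod_restrict, Measure.restrict_univ,
            Measure.restrict_restrict measurableSet_Ioc, inter_self]
        rw [← h3]
        filter_upwards [ae_restrict_mem (measurableSet_Ioc.prod MeasurableSet.univ)] with p hp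
        exact hp.1
      refine integral_congr_ae ?_
      filter_upwards [hae] with p hp
      have h1 : (fun r => H (r, p)) = (Ici p.1).indicator fun r => (K' (r - p.1) p.2 : ℂ) * g p := by
        ext r
        simp only [H, S, indicator_apply, mem_ofPred_eq, mem_Ici]
      have h2 : Ici p.1 ∩ Ioc 0 T = Icc p.1 T := by
        ext x
        simp only [mem_inter_iff, mem_Ici, mem_Ioc, mem_Icc]
        constructor
        · rintro ⟨h, -, h'⟩; exact ⟨h, h'⟩
        · rintro ⟨h, h'⟩; exact ⟨h, hp.1.trans_le h, h'⟩
      rw [h1, integral_indicator measurableSet_Ici, Measure.restrict_restrict measurableSet_Ici, h2,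
        integral_Icc_eq_integral_Ioc, ← intervalIntegral.integral_of_le hp.2,
        intervalIntegral.integral_mul_const]
      have h3 : ∫ r in p.1..T, (K' (r - p.1) p.2 : ℂ) = (K (T - p.1) p.2 : ℂ) - (K 0 p.2 : ℂ) := by
        rw [intervalIntegral.integral_eq_sub_of_hasDerivAt
          (f := fun r => (K (r - p.1) p.2 : ℂ))]
        · simp
        · intro r _
          exact ((hK p.2 (r - p.1)).comp_sub_const r p.1).ofReal_comp
        · exact (Complex.continuous_ofReal.comp (hKc'.comp
            (by fun_prop : Continuous fun r : ℝ => (r - p.1, p.2)))).intervalIntegrable _ _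
      rw [h3]; ring
    · exact hHi.integral_prod_right

end Volterra

/-! ### Data of the wave generated on a time set. -/

section Coefficients

variable {n : ℕ}

/-- Fourier transform of the initial position of the free wave generated by the forcing on `J`. -/
noncomputable def sinCoef (f : ℝ → Rn n → ℂ) (J : Set ℝ) (ξ : Rn n) : ℂ :=
  -∫ s in J, (waveSin s ξ : ℂ) * f s ξ

/-- Fourier transform of the initial velocity of the free wave generated by the forcing on `J`. -/
noncomputable def cosCoef (f : ℝ → Rn n → ℂ) (J : Set ℝ) (ξ : Rn n) : ℂ :=
  ∫ s in J, (waveCos s ξ : ℂ) * f s ξ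

/-- Integrability in space-time against a power of the frequency, locally in time. -/
def TemperateForcing (f : ℝ → Rn n → ℂ) (N : ℕ) : Prop :=
  Measurable (Function.uncurry f) ∧ ∀ T : ℝ,
    Integrable (fun p : ℝ × Rn n => (((1 + ‖p.2‖) ^ N)⁻¹ : ℝ) • f p.1 p.2)
      ((volume.restrict (Ioc 0 T)).prod volume)

variable {f : ℝ → Rn n → ℂ} {N : ℕ} {J : Set ℝ} {T : ℝ}

theorem restrict_prod_le (hJ : J ⊆ Ioc 0 T) : (volume.restrict J).prod (volume : Measure (Rn n)) ≤
    (volume.restrict (Ioc 0 T)).prod volume := by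
  have h1 := Measure.prod_restrict (μ := (volume : Measure ℝ)) (ν := (volume : Measure (Rn n))) J univ
  have h2 := Measure.prod_restrict (μ := (volume : Measure ℝ)) (ν := (volume : Measure (Rn n))) (Ioc 0 T) univ
  rw [Measure.restrict_univ] at h1 h2
  rw [h1, h2]
  exact Measure.restrict_mono (prod_mono hJ subset_rfl) le_rfl

theorem ae_prod_restrict_mem (hJm : MeasurableSet J) :
    ∀ᵐ p ∂((volume.restrict J).prod (volume : Measure (Rn n))), p.1 ∈ J := by
  have h2 := Measure.prod_restrict (μ := (volume : Measure ℝ)) (ν := (volume : Measure (Rn n))) J univ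
  rw [Measure.restrict_univ] at h2
  rw [h2]
  filter_upwards [ae_restrict_mem (hJm.prod MeasurableSet.univ)] with p hp using hp.1

theorem TemperateForcing.integrable_weight (hf : TemperateForcing f N) (hJm : MeasurableSet J)
    (hJ : J ⊆ Ioc 0 T) {k : ℝ → Rn n → ℝ} (hk : Continuous fun p : ℝ × Rn n => k p.1 p.2) {C : ℝ}
    (hC : ∀ s ∈ J, ∀ ξ, |k s ξ| ≤ C) :
    Integrable (fun p : ℝ × Rn n => (((1 + ‖p.2‖) ^ N)⁻¹ : ℝ) • ((k p.1 p.2 : ℂ) * f p.1 p.2))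
      ((volume.restrict J).prod volume) := by
  have h1 := (hf.2 T).mono_measure (restrict_prod_le hJ)
  refine (h1.norm.const_mul C).mono' ?_ ?_
  · exact (by fun_prop (disch := intros; positivity) :
      Continuous fun p : ℝ × Rn n => ((1 + ‖p.2‖) ^ N)⁻¹).aestronglyMeasurable.smul
      ((Complex.continuous_ofReal.comp hk).aestronglyMeasurable.mul hf.1.aestronglyMeasurable)
  · filter_upwards [ae_prod_restrict_mem hJm] with p hp
    rw [norm_smul, norm_smul, norm_mul, Complex.norm_real, Real.norm_eq_abs (k _ _)]
    calc _ ≤ ‖((1 + ‖p.2‖) ^ N)⁻¹‖ * (C * ‖f p.1 p.2‖) := by gcongr; exact hC _ hp _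
      _ = _ := by ring

theorem TemperateForcing.temperateL1_integral (hf : TemperateForcing f N) (hJm : MeasurableSet J)
    (hJ : J ⊆ Ioc 0 T) {k : ℝ → Rn n → ℝ} (hk : Continuous fun p : ℝ × Rn n => k p.1 p.2) {C : ℝ}
    (hC : ∀ s ∈ J, ∀ ξ, |k s ξ| ≤ C) : TemperateL1 fun ξ => ∫ s in J, (k s ξ : ℂ) * f s ξ := by
  refine ⟨N, (hf.integrable_weight hJm hJ hk hC).integral_prod_right.congr (ae_of_all _ fun ξ => ?_)⟩
  simp only
  rw [integral_smul]

/-- For almost all frequencies the forcing is integrable on bounded time sets. -/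
theorem TemperateForcing.ae_integrableOn (hf : TemperateForcing f N)
    (hJ : J ⊆ Ioc 0 T) : ∀ᵐ ξ, IntegrableOn (fun s => f s ξ) J := by
  have h1 := ((hf.2 T).mono_measure (restrict_prod_le hJ)).prod_left_ae
  filter_upwards [h1] with ξ hξ
  have h0 : (1 + ‖ξ‖) ^ N ≠ 0 := by positivity
  refine (hξ.smul ((1 + ‖ξ‖) ^ N)).congr (ae_of_all _ fun s => ?_)
  simp only [Pi.smul_apply]
  rw [smul_smul, mul_inv_cancel₀ h0, one_smul]

theorem TemperateForcing.integrable_schwartz_mul (hf : TemperateForcing f N) (hJ : J ⊆ Ioc 0 T)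
    (Φ : 𝓢(Rn n, ℂ)) : Integrable (fun p : ℝ × Rn n => Φ p.2 * f p.1 p.2)
      ((volume.restrict J).prod volume) := by
  have h1 := (hf.2 T).mono_measure (restrict_prod_le hJ)
  obtain ⟨s, C, -, hC⟩ := SchwartzMap.exists_one_add_pow_mul_le (n := n) N
  refine (h1.norm.const_mul (C * s.sup (schwartzSeminormFamily ℂ (Rn n) ℂ) Φ)).mono' ?_
    (ae_of_all _ fun p => ?_)
  · exact (Φ.continuous.comp continuous_snd).aestronglyMeasurable.mul hf.1.aestronglyMeasurable
  · have hp : 0 < (1 + ‖p.2‖) ^ N := by positivity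
    rw [norm_mul, norm_smul, norm_inv, Real.norm_of_nonneg hp.le]
    calc _ = ((1 + ‖p.2‖) ^ N * ‖Φ p.2‖) * (((1 + ‖p.2‖) ^ N)⁻¹ * ‖f p.1 p.2‖) := by field_simp
      _ ≤ _ := mul_le_mul_of_nonneg_right (hC Φ p.2) (by positivity)

theorem TemperateForcing.temperateL1_sinCoef (hf : TemperateForcing f N) (hJm : MeasurableSet J)
    (hJ : J ⊆ Ioc 0 T) : TemperateL1 (sinCoef f J) := by
  have h := hf.temperateL1_integral hJm hJ continuous_waveSin (C := T) fun s hs ξ =>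
    (abs_waveSin_le s ξ).trans (by rw [abs_of_pos (hJ hs).1]; exact (hJ hs).2)
  exact h.mono (C := 1) h.aestronglyMeasurable.neg
    (ae_of_all _ fun ξ => by rw [sinCoef, norm_neg, one_mul])

theorem TemperateForcing.temperateL1_cosCoef (hf : TemperateForcing f N) (hJm : MeasurableSet J)
    (hJ : J ⊆ Ioc 0 T) : TemperateL1 (cosCoef f J) :=
  hf.temperateL1_integral hJm hJ continuous_waveCos (C := 1) fun s _ ξ => abs_waveCos_le s ξ

theorem integrableOn_continuous_mul {g : ℝ → ℂ} (hg : IntegrableOn g J) (hJm : MeasurableSet J)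
    (hJ : J ⊆ Ioc 0 T)
    {k : ℝ → ℝ} (hk : Continuous k) : IntegrableOn (fun s => (k s : ℂ) * g s) J := by
  obtain ⟨C, hC⟩ := (isCompact_Icc (a := 0) (b := T)).exists_bound_of_continuousOn hk.continuousOn
  have hkm : AEStronglyMeasurable (fun s => (k s : ℂ)) (volume.restrict J) :=
    (Complex.continuous_ofReal.comp hk).aestronglyMeasurable
  refine (hg.norm.const_mul C).mono' (hkm.mul hg.1) ?_
  filter_upwards [ae_restrict_mem hJm] with s hs
  rw [norm_mul, Complex.norm_real]
  exact mul_le_mul_of_nonneg_right (hC s (Ioc_subset_Icc_self (hJ hs))) (norm_nonneg _)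

theorem continuous_waveSin_left (ξ : Rn n) : Continuous fun t => waveSin t ξ :=
  continuous_iff_continuousAt.2 fun t => (hasDerivAt_waveSin t ξ).continuousAt

theorem continuous_waveCos_left (ξ : Rn n) : Continuous fun t => waveCos t ξ :=
  continuous_iff_continuousAt.2 fun t => (hasDerivAt_waveCos t ξ).continuousAt

/-- The subtraction formula separates t from s. This is why the forcing on a fixed time set produces
a free wave in t; the identity is confined to almost all ξ since only there the time integrals are
known to converge. -/
theorem TemperateForcing.freeHat_ae_eq (hf : TemperateForcing f N) (hJm : MeasurableSet J)
    (hJ : J ⊆ Ioc 0 T) (t : ℝ) : freeHat (sinCoef f J) (cosCoef f J) t =ᵐ[volume]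
      fun ξ => ∫ s in J, (waveSin (t - s) ξ : ℂ) * f s ξ := by
  filter_upwards [hf.ae_integrableOn hJ] with ξ hξ
  have h1 := integrableOn_continuous_mul hξ hJm hJ (continuous_waveSin_left ξ)
  have h2 := integrableOn_continuous_mul hξ hJm hJ (continuous_waveCos_left ξ)
  rw [freeHat, sinCoef, cosCoef, mul_neg, ← integral_const_mul, ← integral_const_mul, add_comm,
    ← sub_eq_add_neg, ← integral_sub (h2.const_mul _) (h1.const_mul _)]
  refine integral_congr_ae (ae_of_all _ fun s => ?_)
  beta_reduce
  rw [waveSin_sub]; push_cast; ring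

theorem TemperateForcing.freeHat'_ae_eq (hf : TemperateForcing f N) (hJm : MeasurableSet J)
    (hJ : J ⊆ Ioc 0 T) (t : ℝ) : freeHat' (sinCoef f J) (cosCoef f J) t =ᵐ[volume]
      fun ξ => ∫ s in J, (waveCos (t - s) ξ : ℂ) * f s ξ := by
  filter_upwards [hf.ae_integrableOn hJ] with ξ hξ
  have h1 := integrableOn_continuous_mul hξ hJm hJ (continuous_waveSin_left ξ)
  have h2 := integrableOn_continuous_mul hξ hJm hJ (continuous_waveCos_left ξ)
  rw [freeHat', sinCoef, cosCoef, mul_neg, ← integral_const_mul, ← integral_const_mul, add_comm,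
    ← sub_eq_add_neg, ← integral_sub (h2.const_mul _) (h1.const_mul _)]
  refine integral_congr_ae (ae_of_all _ fun s => ?_)
  beta_reduce
  rw [waveCos_sub]; push_cast; ring

end Coefficients

/-! ### Duhamel's formula for weak solutions. -/

section Duhamel

variable {n : ℕ} {f : ℝ → Rn n → ℂ} {N : ℕ} {J : Set ℝ} {T : ℝ}

theorem TemperateForcing.integrable_kernel_mul (hf : TemperateForcing f N) (hJm : MeasurableSet J)
    (hJ : J ⊆ Ioc 0 T) {k : ℝ → Rn n → ℝ} (hk : Continuous fun p : ℝ × Rn n => k p.1 p.2) {C : ℝ}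
    (hC : ∀ s ∈ J, ∀ ξ, |k s ξ| ≤ C) (Φ : 𝓢(Rn n, ℂ)) :
    Integrable (fun p : ℝ × Rn n => (k p.1 p.2 : ℂ) * (Φ p.2 * f p.1 p.2))
      ((volume.restrict J).prod volume) := by
  have h1 := hf.integrable_schwartz_mul hJ Φ
  refine (h1.norm.const_mul C).mono'
    ((Complex.continuous_ofReal.comp hk).aestronglyMeasurable.mul h1.1) ?_
  filter_upwards [ae_prod_restrict_mem hJm] with p hp
  rw [norm_mul, Complex.norm_real]
  exact mul_le_mul_of_nonneg_right (hC _ hp _) (norm_nonneg _)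

theorem TemperateForcing.integral_kernel_mul (hf : TemperateForcing f N) (hJm : MeasurableSet J)
    (hJ : J ⊆ Ioc 0 T) {k : ℝ → Rn n → ℝ} (hk : Continuous fun p : ℝ × Rn n => k p.1 p.2) {C : ℝ}
    (hC : ∀ s ∈ J, ∀ ξ, |k s ξ| ≤ C) (Φ : 𝓢(Rn n, ℂ)) :
    ∫ ξ, Φ ξ * ∫ s in J, (k s ξ : ℂ) * f s ξ =
      ∫ p, (k p.1 p.2 : ℂ) * (Φ p.2 * f p.1 p.2) ∂((volume.restrict J).prod volume) := by
  rw [integral_prod_symm _ (hf.integrable_kernel_mul hJm hJ hk hC Φ)]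
  congr 1; ext ξ
  rw [← integral_const_mul]
  congr 1; ext s
  ring

/-- The wave generated by the forcing on the time set `J`, on the Fourier side. -/
noncomputable def TemperateForcing.wave (hf : TemperateForcing f N) (hJm : MeasurableSet J)
    (hJ : J ⊆ Ioc 0 T) (t : ℝ) : 𝓢'(Rn n, ℂ) :=
  (temperateL1_freeHat (hf.temperateL1_sinCoef hJm hJ) (hf.temperateL1_cosCoef hJm hJ) t).toDist

/-- The time derivative of `TemperateForcing.wave`. -/
noncomputable def TemperateForcing.wave' (hf : TemperateForcing f N) (hJm : MeasurableSet J)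
    (hJ : J ⊆ Ioc 0 T) (t : ℝ) : 𝓢'(Rn n, ℂ) :=
  (temperateL1_freeHat' (hf.temperateL1_sinCoef hJm hJ) (hf.temperateL1_cosCoef hJm hJ) t).toDist

theorem TemperateForcing.wave_apply (hf : TemperateForcing f N) (hJm : MeasurableSet J)
    (hJ : J ⊆ Ioc 0 T) (t : ℝ) (Φ : 𝓢(Rn n, ℂ)) : hf.wave hJm hJ t Φ =
      ∫ p, (waveSin (t - p.1) p.2 : ℂ) * (Φ p.2 * f p.1 p.2)
        ∂((volume.restrict J).prod volume) := by
  rw [TemperateForcing.wave, TemperateL1.toDist_apply,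
    ← hf.integral_kernel_mul hJm hJ (k := fun s ξ => waveSin (t - s) ξ) (C := |t| + T)]
  · refine integral_congr_ae ?_
    filter_upwards [hf.freeHat_ae_eq hJm hJ t] with ξ hξ
    rw [hξ]
  · exact continuous_waveSin.comp (g := fun p : ℝ × Rn n => waveSin p.1 p.2)
      (f := fun p : ℝ × Rn n => (t - p.1, p.2)) (by fun_prop)
  · intro s hs ξ
    refine (abs_waveSin_le _ _).trans ((abs_sub _ _).trans ?_)
    rw [abs_of_pos (hJ hs).1]
    linarith [(hJ hs).2]

theorem TemperateForcing.wave'_apply (hf : TemperateForcing f N) (hJm : MeasurableSet J)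
    (hJ : J ⊆ Ioc 0 T) (t : ℝ) (Φ : 𝓢(Rn n, ℂ)) : hf.wave' hJm hJ t Φ =
      ∫ p, (waveCos (t - p.1) p.2 : ℂ) * (Φ p.2 * f p.1 p.2)
        ∂((volume.restrict J).prod volume) := by
  rw [TemperateForcing.wave', TemperateL1.toDist_apply,
    ← hf.integral_kernel_mul hJm hJ (k := fun s ξ => waveCos (t - s) ξ) (C := 1)]
  · refine integral_congr_ae ?_
    filter_upwards [hf.freeHat'_ae_eq hJm hJ t] with ξ hξ
    rw [hξ]
  · exact continuous_waveCos.comp (g := fun p : ℝ × Rn n => waveCos p.1 p.2)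
      (f := fun p : ℝ × Rn n => (t - p.1, p.2)) (by fun_prop)
  · exact fun s _ ξ => abs_waveCos_le _ _

theorem TemperateForcing.integrable_one_add_norm_mul (hf : TemperateForcing f N) (hJ : J ⊆ Ioc 0 T)
    (Φ : 𝓢(Rn n, ℂ)) :
    Integrable (fun p : ℝ × Rn n => ((1 + ‖p.2‖ : ℝ) : ℂ) * (Φ p.2 * f p.1 p.2))
      ((volume.restrict J).prod volume) := by
  have h1 := hf.integrable_schwartz_mul hJ Φ
  have h2 := (hf.integrable_schwartz_mul hJ
    (SchwartzMap.smulLeftCLM ℂ (fun ξ : Rn n => (laplaceSymbol ξ : ℂ)) Φ)).norm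
  refine ((h1.norm.const_mul 2).add h2).mono' ?_ (ae_of_all _ fun p => ?_)
  · exact (by fun_prop : Continuous fun p : ℝ × Rn n => ((1 + ‖p.2‖ : ℝ) : ℂ)).aestronglyMeasurable.mul
      h1.1
  · rw [Pi.add_apply, SchwartzMap.smulLeftCLM_apply_apply hasTemperateGrowth_laplaceSymbol,
      smul_eq_mul, mul_assoc, norm_mul (laplaceSymbol p.2 : ℂ), Complex.norm_real,
      norm_mul ((1 + ‖p.2‖ : ℝ) : ℂ), Complex.norm_real, Real.norm_of_nonneg (by positivity),
      laplaceSymbol, norm_neg, norm_pow, Real.norm_of_nonneg (by positivity : 0 ≤ 2 * Real.pi * ‖p.2‖)]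
    have h3 : ‖p.2‖ ≤ 1 + (2 * Real.pi * ‖p.2‖) ^ 2 := by
      have : 1 ≤ (2 * Real.pi) ^ 2 := by nlinarith [Real.pi_gt_three]
      rw [mul_pow]
      nlinarith [sq_nonneg (‖p.2‖ - 1), sq_nonneg ‖p.2‖]
    nlinarith [norm_nonneg (Φ p.2 * f p.1 p.2)]

/-- The sine kernel vanishes at time 0, so extending the time set (0, r] contributes no boundary
term. -/
theorem TemperateForcing.wave_eq_integral (hf : TemperateForcing f N) {T : ℝ} (hT : 0 ≤ T)
    (Φ : 𝓢(Rn n, ℂ)) :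
    IntervalIntegrable (fun r => hf.wave' measurableSet_Ioc (subset_refl (Ioc 0 r)) r Φ) volume 0 T ∧
    hf.wave measurableSet_Ioc (subset_refl (Ioc 0 T)) T Φ =
      ∫ r in (0 : ℝ)..T, hf.wave' measurableSet_Ioc (subset_refl (Ioc 0 r)) r Φ := by
  have h := integral_volterra_eq (T := T) (B := 1) (fun ξ t => hasDerivAt_waveSin t ξ)
    continuous_waveCos
    (fun t ξ => (abs_waveCos_le t ξ).trans (by linarith [norm_nonneg ξ]))
    (hf.integrable_one_add_norm_mul subset_rfl Φ) (hf.integrable_schwartz_mul subset_rfl Φ)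
    (by simp only [waveSin_zero, Complex.ofReal_zero, zero_mul]; exact integrable_zero _ _ _) hT
  simp only [waveSin_zero, Complex.ofReal_zero, zero_mul, integral_zero, zero_add] at h
  simp_rw [wave_apply, wave'_apply]
  exact h

/-- The cosine kernel equals 1 at time 0, and this boundary term is the forcing. -/
theorem TemperateForcing.wave'_eq_integral (hf : TemperateForcing f N) {T : ℝ} (hT : 0 ≤ T)
    (Φ : 𝓢(Rn n, ℂ)) :
    IntervalIntegrable (fun r => hf.wave measurableSet_Ioc (subset_refl (Ioc 0 r)) r
      (SchwartzMap.smulLeftCLM ℂ (fun ξ : Rn n => (laplaceSymbol ξ : ℂ)) Φ)) volume 0 T ∧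
    IntervalIntegrable (fun r => ∫ ξ, Φ ξ * f r ξ) volume 0 T ∧
    hf.wave' measurableSet_Ioc (subset_refl (Ioc 0 T)) T Φ =
      (∫ r in (0 : ℝ)..T, ∫ ξ, Φ ξ * f r ξ) +
      ∫ r in (0 : ℝ)..T, hf.wave measurableSet_Ioc (subset_refl (Ioc 0 r)) r
        (SchwartzMap.smulLeftCLM ℂ (fun ξ : Rn n => (laplaceSymbol ξ : ℂ)) Φ) := by
  have hc : Continuous fun p : ℝ × Rn n => laplaceSymbol p.2 * waveSin p.1 p.2 :=
    (continuous_laplaceSymbol.comp continuous_snd).mul continuous_waveSin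
  have hi := hf.integrable_schwartz_mul (subset_refl (Ioc 0 T)) Φ
  have h := integral_volterra_eq (T := T) (B := 2 * Real.pi)
    (fun ξ t => hasDerivAt_waveCos t ξ) hc
    (fun t ξ => (abs_laplaceSymbol_mul_waveSin_le t ξ).trans
      (by have := Real.pi_pos; gcongr; linarith))
    (hf.integrable_one_add_norm_mul subset_rfl Φ) hi
    (by simp only [waveCos_zero, Complex.ofReal_one, one_mul]; exact hi) hT
  have e : ∀ r, hf.wave measurableSet_Ioc (subset_refl (Ioc 0 r)) r
        (SchwartzMap.smulLeftCLM ℂ (fun ξ : Rn n => (laplaceSymbol ξ : ℂ)) Φ) =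
      ∫ p, ((laplaceSymbol p.2 * waveSin (r - p.1) p.2 : ℝ) : ℂ) * (Φ p.2 * f p.1 p.2)
        ∂((volume.restrict (Ioc 0 r)).prod volume) := fun r => by
    rw [wave_apply]
    congr 1; ext p
    rw [SchwartzMap.smulLeftCLM_apply_apply hasTemperateGrowth_laplaceSymbol, smul_eq_mul]
    push_cast; ring
  simp_rw [e, wave'_apply]
  refine ⟨h.1, ?_, ?_⟩
  · rw [intervalIntegrable_iff_integrableOn_Ioc_of_le hT]
    exact hi.integral_prod_left
  · rw [h.2]
    simp only [waveCos_zero, Complex.ofReal_one, one_mul]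
    rw [integral_prod _ hi, intervalIntegral.integral_of_le hT, intervalIntegral.integral_of_le hT]

theorem continuousOn_Ici_primitive {k : ℝ → ℂ}
    (h : ∀ T, 0 ≤ T → IntervalIntegrable k volume 0 T) :
    ContinuousOn (fun t => ∫ s in (0 : ℝ)..t, k s) (Ici 0) := by
  intro t ht
  have ht : 0 ≤ t := ht
  have h1 := intervalIntegral.continuousOn_primitive_interval'
    (h (t + 1) (by linarith)) (left_mem_uIcc)
  rw [uIcc_of_le (by linarith)] at h1
  refine (h1 t ⟨ht, by linarith⟩).mono_of_mem_nhdsWithin ?_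
  rw [← Ici_inter_Iic]
  exact inter_mem self_mem_nhdsWithin (mem_nhdsWithin_of_mem_nhds (Iic_mem_nhds (by linarith)))

theorem hasDerivWithinAt_Ici_primitive {k : ℝ → ℂ} (h : ContinuousOn k (Ici 0)) {t : ℝ}
    (ht : 0 ≤ t) : HasDerivWithinAt (fun t => ∫ s in (0 : ℝ)..t, k s) (k t) (Ici 0) t := by
  -- Freezing k at its value at 0 for negative times gives a function continuous on ℝ, so that the
  -- two-sided fundamental theorem applies even at t = 0.
  have hc : Continuous fun r => k (max r 0) :=
    h.comp_continuous (by fun_prop) fun r => mem_Ici.2 (le_max_right _ _)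
  have h1 := (intervalIntegral.integral_hasDerivAt_right (hc.intervalIntegrable 0 t)
    (hc.stronglyMeasurableAtFilter _ _) hc.continuousAt).hasDerivWithinAt (s := Ici 0)
  rw [max_eq_left ht] at h1
  refine h1.congr_of_mem (fun s hs => ?_) ht
  refine intervalIntegral.integral_congr fun r hr => ?_
  rw [uIcc_of_le hs] at hr
  simp only [max_eq_left hr.1]

theorem laplacian_fourier (Φ : 𝓢(Rn n, ℂ)) : Δ (𝓕 Φ) =
    𝓕 (SchwartzMap.smulLeftCLM ℂ (fun ξ : Rn n => (laplaceSymbol ξ : ℂ)) Φ) := by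
  have h := fourierInv_laplacian (𝓕 Φ)
  rw [FourierTransform.fourierInv_fourier_eq] at h
  rw [← h, FourierTransform.fourier_fourierInv_eq]

/-- Duhamel's formula. -/
theorem IsWaveSolutionOn.fourier_eq {w w' F : ℝ → 𝓢'(Rn n, ℂ)}
    (hw : IsWaveSolutionOn (Ici 0) w w' F) (h0 : w 0 = 0) (h0' : w' 0 = 0)
    (hf : TemperateForcing f N)
    (hF : ∀ᵐ s ∂(volume.restrict (Ioi 0)), IsRepresentedBy (𝓕 (F s)) (f s)) (hT : 0 ≤ T) :
    𝓕 (w T) = hf.wave measurableSet_Ioc (subset_refl (Ioc 0 T)) T := by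
  set p : Rn n → ℂ := fun ξ => (laplaceSymbol ξ : ℂ) with hp
  set D : ℝ → 𝓢'(Rn n, ℂ) := fun t => hf.wave measurableSet_Ioc (subset_refl (Ioc 0 t)) t with hD
  set D' : ℝ → 𝓢'(Rn n, ℂ) := fun t => hf.wave' measurableSet_Ioc (subset_refl (Ioc 0 t)) t with hD'
  have hDd : ∀ Φ, ∀ t, 0 ≤ t → HasDerivWithinAt (fun s => D s Φ) (D' t Φ) (Ici 0) t := by
    intro Φ t ht
    have hc : ContinuousOn (fun t => D' t Φ) (Ici 0) := by
      refine ContinuousOn.congr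
        ((continuousOn_Ici_primitive fun T hT => (hf.wave'_eq_integral hT Φ).2.1).add
        (continuousOn_Ici_primitive fun T hT => (hf.wave'_eq_integral hT Φ).1)) fun t ht => ?_
      exact (hf.wave'_eq_integral ht Φ).2.2
    exact (hasDerivWithinAt_Ici_primitive hc ht).congr_of_mem
      (fun s hs => (hf.wave_eq_integral hs Φ).2) ht
  -- The difference between the transformed solution and the Duhamel wave satisfies the homogeneous
  -- equation with zero data.
  have key := TemperedDistribution.eq_zero_of_hasDerivWithinAt (p := p)
    hasTemperateGrowth_laplaceSymbol (V := fun t => 𝓕 (w t) - D t) (V' := fun t => 𝓕 (w' t) - D' t)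
    ?_ ?_ ?_ hT
  · exact sub_eq_zero.1 key
  · intro Φ t ht
    exact ((hw (𝓕 Φ) t ht).1).sub (hDd Φ t ht)
  · intro Φ t ht
    obtain ⟨-, hFi, hw'⟩ := hw (𝓕 Φ) t ht
    obtain ⟨i1, i2, e⟩ := hf.wave'_eq_integral ht Φ
    have hwi : IntervalIntegrable (fun s => w s (𝓕 (SchwartzMap.smulLeftCLM ℂ p Φ))) volume 0 t := by
      refine ContinuousOn.intervalIntegrable fun s hs => ?_
      rw [uIcc_of_le ht] at hs
      exact ((hw (𝓕 (SchwartzMap.smulLeftCLM ℂ p Φ)) s hs.1).1.continuousWithinAt).mono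
        (uIcc_of_le ht ▸ Icc_subset_Ici_self)
    have e2 : ∫ r in (0 : ℝ)..t, ∫ ξ, Φ ξ * f r ξ = ∫ r in (0 : ℝ)..t, F r (𝓕 Φ) := by
      rw [intervalIntegral.integral_of_le ht, intervalIntegral.integral_of_le ht]
      refine integral_congr_ae ?_
      filter_upwards [ae_restrict_of_ae_restrict_of_subset Ioc_subset_Ioi_self hF] with s hs
      rw [← (hs Φ).2, TemperedDistribution.fourier_apply]
    have e3 : (𝓕 (w' t) - D' t) Φ = w' t (𝓕 Φ) - D' t Φ := by
      rw [← TemperedDistribution.fourier_apply]; rfl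
    have e4 : ∀ s, (𝓕 (w s) - D s) (SchwartzMap.smulLeftCLM ℂ p Φ) =
        w s (𝓕 (SchwartzMap.smulLeftCLM ℂ p Φ)) - D s (SchwartzMap.smulLeftCLM ℂ p Φ) := fun s => by
      rw [← TemperedDistribution.fourier_apply]; rfl
    simp_rw [e3, e4]
    rw [hw', h0', intervalIntegral.integral_sub hwi i1]
    simp_rw [TemperedDistribution.laplacian_apply_apply, laplacian_fourier]
    rw [intervalIntegral.integral_add hwi hFi]
    have e5 : D' t Φ = _ := e
    rw [e5, e2]
    simp only [hp]
    change 0 + _ - _ = _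
    ring
  · ext Φ
    have e5 := (hf.wave_eq_integral le_rfl Φ).2
    rw [intervalIntegral.integral_same] at e5
    change (𝓕 (w 0)) Φ - D 0 Φ = 0
    rw [h0, TemperedDistribution.fourier_apply]
    change 0 - D 0 Φ = 0
    simp only [hD]
    rw [e5, sub_zero]

end Duhamel

/-! ### Plancherel for sine and cosine transforms in time. -/

section Plancherel

theorem ae_eq_of_integral_schwartz_mul_eq_real {f g : ℝ → ℂ} (hf : LocallyIntegrable f)
    (hg : LocallyIntegrable g) (h : ∀ φ : 𝓢(ℝ, ℂ), ∫ x, φ x * f x = ∫ x, φ x * g x) :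
    f =ᵐ[volume] g := by
  refine ae_eq_of_integral_contDiff_smul_eq hf hg fun φ hφ hc => ?_
  have h1 : HasCompactSupport (Complex.ofRealCLM ∘ φ) := hc.comp_left rfl
  have h2 : ContDiff ℝ ((⊤ : ℕ∞) : WithTop ℕ∞) (Complex.ofRealCLM ∘ φ) :=
    Complex.ofRealCLM.contDiff.comp hφ
  exact h (h1.toSchwartzMap h2)

theorem lintegral_enorm_sq_eq_eLpNorm_sq {α : Type*} [MeasurableSpace α] {μ : Measure α}
    {E : Type*} [TopologicalSpace E] [ContinuousENorm E] (g : α → E) :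
    ∫⁻ x, ‖g x‖ₑ ^ 2 ∂μ = eLpNorm g 2 μ ^ 2 := by
  have h := eLpNorm_nnreal_pow_eq_lintegral (μ := μ) (f := g) (p := 2) two_ne_zero
  simp only [NNReal.coe_ofNat, ENNReal.rpow_ofNat, ENNReal.coe_ofNat] at h
  exact h.symm

theorem continuous_fourier_real {g : ℝ → ℂ} (h1 : Integrable g) : Continuous (𝓕 g) :=
  VectorFourier.fourierIntegral_continuous Real.continuous_fourierChar
    (by exact continuous_inner) h1

/-- Plancherel's identity for integrable functions. -/
theorem lintegral_enorm_sq_fourier {g : ℝ → ℂ} (h1 : Integrable g) (h2 : MemLp g 2) :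
    ∫⁻ ρ, ‖𝓕 g ρ‖ₑ ^ 2 = ∫⁻ s, ‖g s‖ₑ ^ 2 := by
  set G : Lp ℂ 2 (volume : Measure ℝ) := h2.toLp with hG
  -- The L² transform and the integral transform are identified as distributions, by moving the
  -- transform onto the test function.
  have hae : (𝓕 G : Lp ℂ 2 (volume : Measure ℝ)) =ᵐ[volume] 𝓕 g := by
    refine ae_eq_of_integral_schwartz_mul_eq_real ?_ ?_ fun φ => ?_
    · exact ((Lp.memLp _).locallyIntegrable (by norm_num))
    · exact (continuous_fourier_real h1).locallyIntegrable
    · have e1 := congrArg (fun u : 𝓢'(ℝ, ℂ) => u φ) (Lp.fourier_toTemperedDistribution_eq G)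
      simp only [TemperedDistribution.fourier_apply, Lp.toTemperedDistribution_apply, smul_eq_mul] at e1
      rw [← e1]
      have e2 : ∫ x, (𝓕 φ) x * G x = ∫ x, 𝓕 (φ : ℝ → ℂ) x * g x := by
        refine integral_congr_ae ?_
        filter_upwards [h2.coeFn_toLp] with x hx
        rw [hG, hx, SchwartzMap.fourier_coe]
      rw [e2]
      have e3 := VectorFourier.integral_fourierIntegral_smul_eq_flip (μ := volume) (ν := volume)
        (L := innerₗ ℝ) Real.continuous_fourierChar (by exact continuous_inner)
        φ.integrable h1
      simp only [smul_eq_mul, flip_innerₗ] at e3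
      exact e3
  have h3 : eLpNorm (𝓕 g) 2 volume = eLpNorm g 2 volume := by
    rw [← eLpNorm_congr_ae hae, ← eLpNorm_congr_ae h2.coeFn_toLp, ← ENNReal.toReal_eq_toReal_iff'
      (Lp.memLp _).2.ne (Lp.memLp _).2.ne]
    exact Lp.norm_fourier_eq G
  rw [lintegral_enorm_sq_eq_eLpNorm_sq, lintegral_enorm_sq_eq_eLpNorm_sq, h3]

theorem enorm_half_add_sq_le (a b : ℂ) : ‖2⁻¹ * (a + b)‖ₑ ^ 2 ≤ ‖a‖ₑ ^ 2 + ‖b‖ₑ ^ 2 := by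
  have h : ‖2⁻¹ * (a + b)‖ ≤ max ‖a‖ ‖b‖ := by
    rw [norm_mul, norm_inv, Complex.norm_ofNat]
    have := norm_add_le a b
    have := le_max_left ‖a‖ ‖b‖
    have := le_max_right ‖a‖ ‖b‖
    linarith
  rcases le_total ‖a‖ ‖b‖ with hab | hab
  · rw [max_eq_right hab] at h
    calc _ ≤ ‖b‖ₑ ^ 2 := by gcongr; exact enorm_le_iff_norm_le.2 h
      _ ≤ _ := le_add_self
  · rw [max_eq_left hab] at h
    calc _ ≤ ‖a‖ₑ ^ 2 := by gcongr; exact enorm_le_iff_norm_le.2 h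
      _ ≤ _ := le_self_add

/-- The two reflected copies of 𝓕 g each contribute one L² norm, hence the constant 2. The cosine
transform is the case c = 1, and the sine transform, up to a unimodular factor, the case c = -1. -/
theorem lintegral_half_fourier_le {g : ℝ → ℂ} (h1 : Integrable g) {G : ℝ → ℂ} {c : ℂ} (hc : ‖c‖ₑ = 1)
    (hG : ∀ ρ, G ρ = 2⁻¹ * (𝓕 g ρ + c * 𝓕 g (-ρ))) :
    ∫⁻ ρ, ‖G ρ‖ₑ ^ 2 ≤ 2 * ∫⁻ s, ‖g s‖ₑ ^ 2 := by
  by_cases htop : ∫⁻ s, ‖g s‖ₑ ^ 2 = ∞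
  · simp [htop]
  have h2 : MemLp g 2 := by
    refine ⟨h1.1, ?_⟩
    rw [lintegral_enorm_sq_eq_eLpNorm_sq] at htop
    exact lt_top_iff_ne_top.2 fun h => htop (by rw [h]; rfl)
  have hm : Measurable fun ρ => ‖𝓕 g ρ‖ₑ ^ 2 := (continuous_fourier_real h1).enorm.measurable.pow_const 2
  calc ∫⁻ ρ, ‖G ρ‖ₑ ^ 2 ≤ ∫⁻ ρ, (‖𝓕 g ρ‖ₑ ^ 2 + ‖𝓕 g (-ρ)‖ₑ ^ 2) := by
        refine lintegral_mono fun ρ => ?_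
        rw [hG]
        refine (enorm_half_add_sq_le _ _).trans ?_
        rw [enorm_mul, hc, one_mul]
    _ = (∫⁻ ρ, ‖𝓕 g ρ‖ₑ ^ 2) + ∫⁻ ρ, ‖𝓕 g (-ρ)‖ₑ ^ 2 := lintegral_add_left hm _
    _ = (∫⁻ ρ, ‖𝓕 g ρ‖ₑ ^ 2) + ∫⁻ ρ, ‖𝓕 g ρ‖ₑ ^ 2 := by
        rw [lintegral_neg_eq_self (fun ρ => ‖𝓕 g ρ‖ₑ ^ 2)]
    _ = _ := by rw [lintegral_enorm_sq_fourier h1 h2, two_mul]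

theorem integrable_exp_mul {g : ℝ → ℂ} (h1 : Integrable g) (ρ : ℝ) :
    Integrable fun s => Complex.exp (↑(-2 * Real.pi * s * ρ) * Complex.I) * g s := by
  refine h1.bdd_mul (c := 1) (by fun_prop) (ae_of_all _ fun s => ?_)
  rw [Complex.norm_exp_ofReal_mul_I]

theorem lintegral_enorm_sq_cos_le {g : ℝ → ℂ} (h1 : Integrable g) :
    ∫⁻ ρ, ‖∫ s, (Real.cos (2 * Real.pi * ρ * s) : ℂ) * g s‖ₑ ^ 2 ≤ 2 * ∫⁻ s, ‖g s‖ₑ ^ 2 := by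
  refine lintegral_half_fourier_le h1 (c := 1) (by simp) fun ρ => ?_
  rw [Real.fourier_real_eq_integral_exp_smul, Real.fourier_real_eq_integral_exp_smul, one_mul]
  simp only [smul_eq_mul]
  rw [← integral_add (integrable_exp_mul h1 ρ) (integrable_exp_mul h1 (-ρ)), ← integral_const_mul]
  congr 1; ext s
  rw [Complex.ofReal_cos, Complex.cos]
  have e1 : (↑(-2 * Real.pi * s * ρ) * Complex.I : ℂ) = -↑(2 * Real.pi * ρ * s) * Complex.I := by
    push_cast; ring
  have e2 : (↑(-2 * Real.pi * s * -ρ) * Complex.I : ℂ) = ↑(2 * Real.pi * ρ * s) * Complex.I := by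
    push_cast; ring
  rw [e1, e2]; ring

theorem lintegral_enorm_sq_sin_le {g : ℝ → ℂ} (h1 : Integrable g) :
    ∫⁻ ρ, ‖∫ s, (Real.sin (2 * Real.pi * ρ * s) : ℂ) * g s‖ₑ ^ 2 ≤ 2 * ∫⁻ s, ‖g s‖ₑ ^ 2 := by
  have hI : ∀ z : ℂ, ‖z‖ₑ = ‖-Complex.I * z‖ₑ := fun z => by
    rw [enorm_mul, enorm_neg, ← ofReal_norm Complex.I, Complex.norm_I, ENNReal.ofReal_one,
      one_mul]
  simp_rw [hI (∫ s, (Real.sin (2 * Real.pi * _ * s) : ℂ) * g s)]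
  refine lintegral_half_fourier_le h1 (c := -1) (by simp) fun ρ => ?_
  rw [Real.fourier_real_eq_integral_exp_smul, Real.fourier_real_eq_integral_exp_smul, neg_one_mul,
    ← sub_eq_add_neg]
  simp only [smul_eq_mul]
  rw [← integral_sub (integrable_exp_mul h1 ρ) (integrable_exp_mul h1 (-ρ)), ← integral_const_mul,
    ← integral_const_mul]
  congr 1; ext s
  rw [Complex.ofReal_sin, Complex.sin]
  have e1 : (↑(-2 * Real.pi * s * ρ) * Complex.I : ℂ) = -↑(2 * Real.pi * ρ * s) * Complex.I := by
    push_cast; ring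
  have e2 : (↑(-2 * Real.pi * s * -ρ) * Complex.I : ℂ) = ↑(2 * Real.pi * ρ * s) * Complex.I := by
    push_cast; ring
  rw [e1, e2]
  linear_combination (-(1/2) * (Complex.exp (-↑(2 * Real.pi * ρ * s) * Complex.I) -
    Complex.exp (↑(2 * Real.pi * ρ * s) * Complex.I)) * g s) * Complex.I_sq

end Plancherel

/-! ### Polar coordinates for nonnegative integrals. -/

section Polar

open Metric

variable {E : Type*} [NormedAddCommGroup E] [NormedSpace ℝ E] [MeasurableSpace E] [BorelSpace E]
  [FiniteDimensional ℝ E] [Nontrivial E] (μ : Measure E) [μ.IsAddHaarMeasure]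

/-- Integration in polar coordinates. -/
theorem lintegral_eq_lintegral_toSphere {g : E → ℝ≥0∞} (hg : Measurable g) :
    ∫⁻ x, g x ∂μ = ∫⁻ r in Ioi (0 : ℝ), ENNReal.ofReal (r ^ (Module.finrank ℝ E - 1)) *
      ∫⁻ ω, g (r • (ω : E)) ∂μ.toSphere := by
  have e1 : ∫⁻ x, g x ∂μ = ∫⁻ x : ({(0)}ᶜ : Set E), g x ∂(μ.comap (↑)) := by
    rw [lintegral_subtype_comap (measurableSet_singleton _).compl, restrict_compl_singleton]
  have e2 : ∫⁻ x : ({(0)}ᶜ : Set E), g x ∂(μ.comap (↑)) =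
      ∫⁻ p : sphere (0 : E) 1 × Ioi (0 : ℝ), g ((p.2 : ℝ) • (p.1 : E))
        ∂(μ.toSphere.prod (.volumeIoiPow (Module.finrank ℝ E - 1))) := by
    rw [← μ.measurePreserving_homeomorphUnitSphereProd.lintegral_comp_emb
      (Homeomorph.measurableEmbedding _)]
    refine lintegral_congr fun x => ?_
    congr 1
    have := (homeomorphUnitSphereProd E).symm_apply_apply x
    have hx : ‖(x : E)‖ ≠ 0 := norm_ne_zero_iff.2 x.2
    conv_lhs => rw [← this]
    simp [smul_smul, hx]
  have hm : Measurable fun p : sphere (0 : E) 1 × Ioi (0 : ℝ) => g ((p.2 : ℝ) • (p.1 : E)) :=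
    hg.comp (by fun_prop)
  have hm' : Measurable fun p : sphere (0 : E) 1 × ℝ => g (p.2 • (p.1 : E)) :=
    hg.comp (by fun_prop)
  rw [e1, e2, lintegral_prod_symm' _ hm, Measure.volumeIoiPow,
    lintegral_withDensity_eq_lintegral_mul₀]
  · simp only [Pi.mul_apply]
    rw [lintegral_subtype_comap measurableSet_Ioi
      (fun r : ℝ => ENNReal.ofReal (r ^ (Module.finrank ℝ E - 1)) * ∫⁻ ω, g (r • (ω : E)) ∂μ.toSphere)]
  · fun_prop
  · exact hm.lintegral_prod_left'.aemeasurable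

end Polar

/-! ### Weighted Schwartz functions on spheres. -/

section SphereBound

variable {n : ℕ}

/-- Peetre's inequality. -/
theorem one_add_norm_rpow_le {E : Type*} [NormedAddCommGroup E] (s : ℝ) (x y : E) :
    (1 + ‖x‖) ^ s ≤ (1 + ‖x - y‖) ^ |s| * (1 + ‖y‖) ^ s := by
  have hx : 0 < 1 + ‖x‖ := by positivity
  have hy : 0 < 1 + ‖y‖ := by positivity
  have hxy : 0 < 1 + ‖x - y‖ := by positivity
  rcases le_total 0 s with h | h
  · rw [abs_of_nonneg h, ← Real.mul_rpow hxy.le hy.le]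
    refine Real.rpow_le_rpow hx.le ?_ h
    have := norm_le_norm_add_norm_sub' x y
    nlinarith [norm_nonneg (x - y), norm_nonneg y]
  · rw [abs_of_nonpos h, Real.rpow_neg hxy.le, ← div_eq_inv_mul, le_div_iff₀ (by positivity),
      ← Real.mul_rpow hx.le hxy.le]
    refine Real.rpow_le_rpow_of_nonpos hy ?_ h
    have := norm_le_norm_add_norm_sub x y
    nlinarith [norm_nonneg (x - y), norm_nonneg x]

theorem SchwartzMap.exists_norm_le (ψ : 𝓢(Rn n, ℂ)) (M : ℕ) :
    ∃ C : ℝ, 0 ≤ C ∧ ∀ x, ‖ψ x‖ ≤ C * ((1 + ‖x‖) ^ M)⁻¹ := by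
  obtain ⟨C, hC, h⟩ := ψ.exists_norm_sub_le M
  refine ⟨C, hC, fun x => ?_⟩
  simpa using h 0 x

/-- The numbers ρ and 1+r are comparable: ρ ≤ 1+r ≤ ρ+2 ≤ 3ρ. One inequality serves s ≥ 0 and the
other s ≤ 0. -/
theorem rpow_le_three_rpow_mul {ρ r s : ℝ} (hρ : 1 ≤ ρ) (h1 : ρ ≤ r) (h2 : r ≤ ρ + 1) :
    ρ ^ s ≤ 3 ^ |s| * (1 + r) ^ s := by
  rcases le_total 0 s with h | h
  · have h3 : ρ ^ s ≤ (1 + r) ^ s := Real.rpow_le_rpow (by linarith) (by linarith) h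
    have h4 : (1 : ℝ) ≤ 3 ^ |s| := Real.one_le_rpow (by norm_num) (abs_nonneg s)
    have h5 : 0 ≤ (1 + r) ^ s := Real.rpow_nonneg (by linarith) _
    nlinarith
  · rw [abs_of_nonpos h, Real.rpow_neg (by norm_num), ← div_eq_inv_mul, le_div_iff₀ (by positivity),
      ← Real.mul_rpow (by linarith) (by norm_num)]
    exact Real.rpow_le_rpow_of_nonpos (by linarith) (by linarith) h

/-- Near the origin ρ^(n-1+s) ≤ 1 because the total exponent is nonnegative, and |η-ρω| differs from
|η| by at most 1, so the decay of ψ supplies the power of 1+|η|. -/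
theorem sphere_norm_bound_of_le_one {M : ℕ} {s C : ℝ} {ψ : Rn n → ℂ} (hC0 : 0 ≤ C)
    (hC : ∀ x, ‖ψ x‖ ≤ C * ((1 + ‖x‖) ^ M)⁻¹) (hM : |s| ≤ M) (hs : 0 ≤ (n : ℝ) - 1 + s) (hn : 1 ≤ n)
    {ρ : ℝ} (hρ : 0 < ρ) (hρ1 : ρ ≤ 1) {ω : Rn n} (hω : ‖ω‖ = 1) (η : Rn n) :
    ρ ^ (n - 1) * (ρ ^ s * ‖ψ (η - ρ • ω)‖) ≤ C * 2 ^ M * (1 + ‖η‖) ^ s := by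
  have h1 : ρ ^ (n - 1) * ρ ^ s ≤ 1 := by
    rw [← Real.rpow_natCast, ← Real.rpow_add hρ]
    refine Real.rpow_le_one hρ.le hρ1 ?_
    rw [Nat.cast_sub hn]; simpa using hs
  have h2 : 1 + ‖η‖ ≤ 2 * (1 + ‖η - ρ • ω‖) := by
    have := norm_le_norm_add_norm_sub' η (ρ • ω)
    rw [norm_smul, hω, Real.norm_of_nonneg hρ.le] at this
    linarith [norm_nonneg (η - ρ • ω)]
  have h3 : ((1 + ‖η - ρ • ω‖) ^ M)⁻¹ ≤ 2 ^ M * ((1 + ‖η‖) ^ M)⁻¹ := by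
    rw [← div_eq_mul_inv, le_div_iff₀ (by positivity), inv_mul_le_iff₀ (by positivity), ← mul_pow,
      mul_comm _ (2 : ℝ)]
    gcongr
  have h4 : ((1 + ‖η‖) ^ M)⁻¹ ≤ (1 + ‖η‖) ^ s := by
    rw [← Real.rpow_natCast, ← Real.rpow_neg (by positivity)]
    refine Real.rpow_le_rpow_of_exponent_le (by linarith [norm_nonneg η]) ?_
    linarith [neg_abs_le s]
  calc _ = (ρ ^ (n - 1) * ρ ^ s) * ‖ψ (η - ρ • ω)‖ := by ring
    _ ≤ 1 * (C * (2 ^ M * (1 + ‖η‖) ^ s)) := by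
        refine mul_le_mul h1 ((hC _).trans ?_) (norm_nonneg _) zero_le_one
        refine mul_le_mul_of_nonneg_left (h3.trans ?_) hC0
        exact mul_le_mul_of_nonneg_left h4 (by positivity)
    _ = _ := by ring

/-- Moving the radius from ρ to r in [ρ, ρ+1] changes distances to η by at most 1. Of the M powers
of decay, |s| pay for Peetre's inequality and n+1 remain, enough for integrability over ℝⁿ. -/
theorem sphere_norm_bound_of_one_le {M : ℕ} {s C : ℝ} {ψ : Rn n → ℂ} (hC0 : 0 ≤ C)
    (hC : ∀ x, ‖ψ x‖ ≤ C * ((1 + ‖x‖) ^ M)⁻¹) (hM : |s| + (n + 1) ≤ M)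
    {ρ r : ℝ} (hρ1 : 1 ≤ ρ) (h1 : ρ ≤ r) (h2 : r ≤ ρ + 1) {ω : Rn n} (hω : ‖ω‖ = 1) (η : Rn n) :
    ρ ^ (n - 1) * (ρ ^ s * ‖ψ (η - ρ • ω)‖) ≤ (C * 2 ^ M * 3 ^ |s| * (1 + ‖η‖) ^ s) *
      (r ^ (n - 1) * (1 + ‖r • ω - η‖) ^ (-((n : ℝ) + 1))) := by
  have e1 : ‖r • ω‖ = r := by rw [norm_smul, hω, Real.norm_of_nonneg (by linarith), mul_one]
  have a1 : 1 + ‖r • ω - η‖ ≤ 2 * (1 + ‖η - ρ • ω‖) := by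
    have e2 : r • ω - η = (r - ρ) • ω - (η - ρ • ω) := by rw [sub_smul]; abel
    have := norm_sub_le ((r - ρ) • ω) (η - ρ • ω)
    rw [← e2, norm_smul, hω, Real.norm_of_nonneg (by linarith)] at this
    linarith [norm_nonneg (η - ρ • ω)]
  have a2 : ((1 + ‖η - ρ • ω‖) ^ M)⁻¹ ≤ 2 ^ M * ((1 + ‖r • ω - η‖) ^ M)⁻¹ := by
    rw [← div_eq_mul_inv, le_div_iff₀ (by positivity), inv_mul_le_iff₀ (by positivity), ← mul_pow,
      mul_comm _ (2 : ℝ)]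
    gcongr
  have a3 : ρ ^ s ≤ 3 ^ |s| * ((1 + ‖r • ω - η‖) ^ |s| * (1 + ‖η‖) ^ s) := by
    refine (rpow_le_three_rpow_mul hρ1 h1 h2).trans ?_
    refine mul_le_mul_of_nonneg_left ?_ (by positivity)
    have := one_add_norm_rpow_le s (r • ω) η
    rwa [e1] at this
  have a4 : (1 + ‖r • ω - η‖) ^ |s| * ((1 + ‖r • ω - η‖) ^ M)⁻¹ ≤
      (1 + ‖r • ω - η‖) ^ (-((n : ℝ) + 1)) := by
    rw [← Real.rpow_natCast, ← Real.rpow_neg (by positivity), ← Real.rpow_add (by positivity)]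
    refine Real.rpow_le_rpow_of_exponent_le (by linarith [norm_nonneg (r • ω - η)]) ?_
    linarith
  have a5 : ρ ^ (n - 1) ≤ r ^ (n - 1) := pow_le_pow_left₀ (by linarith) h1 _
  have hr0 : 0 ≤ r := by linarith
  calc _ ≤ r ^ (n - 1) * ((3 ^ |s| * ((1 + ‖r • ω - η‖) ^ |s| * (1 + ‖η‖) ^ s)) *
        (C * (2 ^ M * ((1 + ‖r • ω - η‖) ^ M)⁻¹))) := by
        refine mul_le_mul a5 (mul_le_mul a3 ((hC _).trans (mul_le_mul_of_nonneg_left a2 hC0))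
          (norm_nonneg _) (by positivity)) ?_ (by positivity)
        have : 0 ≤ ρ ^ s := Real.rpow_nonneg (by linarith) _
        positivity
    _ = (C * 2 ^ M * 3 ^ |s| * (1 + ‖η‖) ^ s) * (r ^ (n - 1) *
        ((1 + ‖r • ω - η‖) ^ |s| * ((1 + ‖r • ω - η‖) ^ M)⁻¹)) := by ring
    _ ≤ _ := by gcongr

/-- Uniformity in ρ is the point: ψ(η - ·) is concentrated in a ball of bounded size, which meets
any sphere in bounded area. -/
theorem exists_toSphere_bound (hn : 1 ≤ n) (ψ : 𝓢(Rn n, ℂ)) {s : ℝ} (hs : 0 ≤ (n : ℝ) - 1 + s) :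
    ∃ C : ℝ≥0∞, C ≠ ∞ ∧ ∀ (η : Rn n) (ρ : ℝ), 0 < ρ →
      ∫⁻ ω, ENNReal.ofReal (ρ ^ (n - 1) * (ρ ^ s * ‖ψ (η - ρ • (ω : Rn n))‖))
        ∂(volume : Measure (Rn n)).toSphere ≤ C * ENNReal.ofReal ((1 + ‖η‖) ^ s) := by
  obtain ⟨M, hM⟩ := exists_nat_ge (|s| + (n + 1))
  have hM' : |s| ≤ M := by have : (0 : ℝ) ≤ n := n.cast_nonneg; linarith
  obtain ⟨C, hC0, hC⟩ := ψ.exists_norm_le M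
  have : Nonempty (Fin n) := ⟨⟨0, by omega⟩⟩
  set σ := (volume : Measure (Rn n)).toSphere with hσ
  set K : ℝ≥0∞ := ∫⁻ x : Rn n, ENNReal.ofReal ((1 + ‖x‖) ^ (-((n : ℝ) + 1))) with hK
  have hKfin : K ≠ ∞ := (finite_integral_one_add_norm (by simp)).ne
  refine ⟨ENNReal.ofReal (C * 2 ^ M) * σ univ + ENNReal.ofReal (C * 2 ^ M * 3 ^ |s|) * K, ?_, ?_⟩
  · exact ENNReal.add_ne_top.2 ⟨ENNReal.mul_ne_top ENNReal.ofReal_ne_top (measure_ne_top _ _),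
      ENNReal.mul_ne_top ENNReal.ofReal_ne_top hKfin⟩
  intro η ρ hρ
  have hω : ∀ ω : Metric.sphere (0 : Rn n) 1, ‖(ω : Rn n)‖ = 1 := fun ω => by simp
  rw [add_mul]
  rcases le_total ρ 1 with h | h
  · refine le_trans ?_ le_self_add
    calc _ ≤ ∫⁻ _, ENNReal.ofReal (C * 2 ^ M * (1 + ‖η‖) ^ s) ∂σ :=
          lintegral_mono fun ω => ENNReal.ofReal_le_ofReal
            (sphere_norm_bound_of_le_one hC0 hC hM' hs hn hρ h (hω ω) η)
      _ = _ := by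
          rw [lintegral_const, ENNReal.ofReal_mul (by positivity)]; ring
  · refine le_trans ?_ le_add_self
    set g : Rn n → ℝ≥0∞ := fun x => ENNReal.ofReal ((1 + ‖x - η‖) ^ (-((n : ℝ) + 1))) with hg
    have hgm : Measurable g := by
      refine ENNReal.measurable_ofReal.comp (Continuous.measurable ?_)
      refine Continuous.rpow_const (by fun_prop) fun x => Or.inl ?_
      positivity
    have e1 : ∫⁻ x, g x = K := lintegral_sub_right_eq_self
      (fun x : Rn n => ENNReal.ofReal ((1 + ‖x‖) ^ (-((n : ℝ) + 1)))) η
    set L := ∫⁻ ω, ENNReal.ofReal (ρ ^ (n - 1) * (ρ ^ s * ‖ψ (η - ρ • (ω : Rn n))‖)) ∂σ with hL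
    set A := ENNReal.ofReal (C * 2 ^ M * 3 ^ |s| * (1 + ‖η‖) ^ s) with hA
    have key : ∀ r ∈ Ioc ρ (ρ + 1), L ≤ A * (ENNReal.ofReal (r ^ (n - 1)) *
        ∫⁻ ω, g (r • (ω : Rn n)) ∂σ) := by
      intro r hr
      have hr0 : 0 ≤ r := by linarith [hr.1]
      rw [← lintegral_const_mul' _ _ ENNReal.ofReal_ne_top, ← lintegral_const_mul' _ _
        ENNReal.ofReal_ne_top]
      refine lintegral_mono fun ω => ?_
      rw [hg, ← ENNReal.ofReal_mul (by positivity), ← ENNReal.ofReal_mul (by positivity)]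
      exact ENNReal.ofReal_le_ofReal
        (sphere_norm_bound_of_one_le hC0 hC hM h hr.1.le hr.2 (hω ω) η)
    -- Averaging over r in an interval of length 1 replaces the sphere by a shell, and polar
    -- coordinates bound the shell integral by the integral over all of ℝⁿ, which does not depend on
    -- η.
    calc L = ∫⁻ _ in Ioc ρ (ρ + 1), L := by simp
      _ ≤ ∫⁻ r in Ioc ρ (ρ + 1), A * (ENNReal.ofReal (r ^ (n - 1)) *
          ∫⁻ ω, g (r • (ω : Rn n)) ∂σ) := setLIntegral_mono' measurableSet_Ioc key
      _ ≤ ∫⁻ r in Ioi 0, A * (ENNReal.ofReal (r ^ (n - 1)) * ∫⁻ ω, g (r • (ω : Rn n)) ∂σ) :=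
          lintegral_mono_set fun r hr => hρ.trans hr.1
      _ = A * K := by
          rw [lintegral_const_mul' _ _ ENNReal.ofReal_ne_top, ← e1,
            lintegral_eq_lintegral_toSphere volume hgm, finrank_euclideanSpace_fin]
      _ = _ := by
          rw [hA, ENNReal.ofReal_mul (by positivity)]; ring

/-- Radial functions against a Schwartz function, with a power weight. -/
theorem exists_lintegral_radial_le (hn : 1 ≤ n) (ψ : 𝓢(Rn n, ℂ)) {s : ℝ} (hs : 0 ≤ (n : ℝ) - 1 + s) :
    ∃ C : ℝ≥0∞, C ≠ ∞ ∧ ∀ (η : Rn n) (h : ℝ → ℝ≥0∞), Measurable h →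
      ∫⁻ ξ, ENNReal.ofReal (‖ξ‖ ^ s * ‖ψ (η - ξ)‖) * h ‖ξ‖ ≤
        C * (ENNReal.ofReal ((1 + ‖η‖) ^ s) * ∫⁻ ρ, h ρ) := by
  obtain ⟨C, hC, hb⟩ := exists_toSphere_bound hn ψ hs
  have : Nonempty (Fin n) := ⟨⟨0, by omega⟩⟩
  refine ⟨C, hC, fun η h hh => ?_⟩
  rw [lintegral_eq_lintegral_toSphere, finrank_euclideanSpace_fin]
  · calc _ ≤ ∫⁻ r in Ioi (0 : ℝ), (C * ENNReal.ofReal ((1 + ‖η‖) ^ s)) * h r := by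
          refine setLIntegral_mono' measurableSet_Ioi fun r hr => ?_
          have hr : 0 < r := hr
          have e1 : ∀ ω : Metric.sphere (0 : Rn n) 1, ‖r • (ω : Rn n)‖ = r := fun ω => by
            rw [norm_smul, Real.norm_of_nonneg hr.le]; simp
          simp_rw [e1]
          rw [lintegral_mul_const, ← mul_assoc, ← lintegral_const_mul' _ _ ENNReal.ofReal_ne_top]
          · refine mul_le_mul_left (le_trans (le_of_eq ?_) (hb η r hr)) _
            refine lintegral_congr fun ω => ?_
            rw [← ENNReal.ofReal_mul (by positivity)]
          · refine ENNReal.measurable_ofReal.comp (Continuous.measurable ?_)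
            exact continuous_const.mul (ψ.continuous.comp (by fun_prop)).norm
      _ ≤ ∫⁻ r, (C * ENNReal.ofReal ((1 + ‖η‖) ^ s)) * h r := setLIntegral_le_lintegral _ _
      _ = _ := by rw [lintegral_const_mul _ hh, mul_assoc]
  · refine Measurable.mul (ENNReal.measurable_ofReal.comp (Measurable.mul ?_ ?_)) (hh.comp measurable_norm)
    · exact measurable_norm.pow_const s
    · exact (ψ.continuous.comp (by fun_prop)).norm.measurable

end SphereBound

/-! ### Restriction to the cone of the space-time Fourier transform. -/

section OscillatoryIntegral

theorem lintegral_mul_sq_le {α : Type*} [MeasurableSpace α] {μ : Measure α} {a b : α → ℝ≥0∞}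
    (ha : AEMeasurable a μ) (hb : AEMeasurable b μ) :
    (∫⁻ x, a x * b x ∂μ) ^ 2 ≤ (∫⁻ x, a x ^ 2 ∂μ) * ∫⁻ x, b x ^ 2 ∂μ := by
  have h := ENNReal.lintegral_mul_le_Lp_mul_Lq μ Real.HolderConjugate.two_two ha hb
  simp only [Pi.mul_apply, ENNReal.rpow_ofNat] at h
  calc _ ≤ ((∫⁻ x, a x ^ 2 ∂μ) ^ (1 / 2 : ℝ) * (∫⁻ x, b x ^ 2 ∂μ) ^ (1 / 2 : ℝ)) ^ 2 := by gcongr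
    _ = _ := by
        rw [mul_pow, ← ENNReal.rpow_ofNat, ← ENNReal.rpow_ofNat, ← ENNReal.rpow_mul,
          ← ENNReal.rpow_mul]
        norm_num

/-- Cauchy–Schwarz with the splitting a = a^(1/2) a^(1/2), so that the kernel a is never squared. -/
theorem lintegral_mul_sq_le_weighted {α : Type*} [MeasurableSpace α] {μ : Measure α}
    {a b : α → ℝ≥0∞} (ha : AEMeasurable a μ) (hb : AEMeasurable b μ) :
    (∫⁻ x, a x * b x ∂μ) ^ 2 ≤ (∫⁻ x, a x ∂μ) * ∫⁻ x, a x * b x ^ 2 ∂μ := by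
  have e : ∀ x, (a x ^ (1 / 2 : ℝ)) ^ 2 = a x := fun x => by
    rw [← ENNReal.rpow_ofNat, ← ENNReal.rpow_mul]; norm_num
  have h := lintegral_mul_sq_le (ha.pow_const (1 / 2 : ℝ)) ((ha.pow_const (1 / 2 : ℝ)).mul hb)
  simp only [Pi.mul_apply, mul_pow, e] at h
  simp_rw [← mul_assoc, ← sq, e] at h
  exact h

variable {n : ℕ} {f : ℝ → Rn n → ℂ} {N : ℕ} {J : Set ℝ} {T : ℝ} {K : ℝ → ℝ → ℝ}

/-- The integral of the forcing over `J` against an oscillating kernel `K ρ s`. -/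
noncomputable def oscInt (K : ℝ → ℝ → ℝ) (f : ℝ → Rn n → ℂ) (J : Set ℝ) (ρ : ℝ) (ξ : Rn n) : ℂ :=
  ∫ s in J, (K ρ s : ℂ) * f s ξ

theorem measurable_oscInt (hf : Measurable (Function.uncurry f))
    (hK : Continuous (Function.uncurry K)) :
    Measurable fun p : ℝ × Rn n => oscInt K f J p.1 p.2 := by
  have h : Measurable fun q : (ℝ × Rn n) × ℝ => (K q.1.1 q.2 : ℂ) * f q.2 q.1.2 := by
    refine Measurable.mul ?_ ?_
    · exact Complex.measurable_ofReal.comp (hK.measurable.comp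
        (by fun_prop : Measurable fun q : (ℝ × Rn n) × ℝ => (q.1.1, q.2)))
    · exact hf.comp (by fun_prop : Measurable fun q : (ℝ × Rn n) × ℝ => (q.2, q.1.2))
  exact (h.stronglyMeasurable.integral_prod_right (ν := volume.restrict J)).measurable

/-- Convolution reproducing formulas pass to oscillatory integrals in time. -/
theorem TemperateForcing.oscInt_eq_integral (hf : TemperateForcing f N) (hJm : MeasurableSet J)
    (hJ : J ⊆ Ioc 0 T) (hK : Continuous (Function.uncurry K)) (hK1 : ∀ ρ s, |K ρ s| ≤ 1)
    {ψ : 𝓢(Rn n, ℂ)} (hψ : ∀ᵐ s ∂(volume.restrict J), ∀ ξ, f s ξ = ∫ η, ψ (η - ξ) * f s η)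
    (ρ : ℝ) (ξ : Rn n) : oscInt K f J ρ ξ = ∫ η, ψ (η - ξ) * oscInt K f J ρ η := by
  have hi := hf.integrable_kernel_mul hJm hJ (k := fun s _ => K ρ s) (C := 1)
    (hK.comp (by fun_prop : Continuous fun p : ℝ × Rn n => (ρ, p.1))) (fun s _ _ => hK1 ρ s)
    (ψ.compSubConstCLM ℂ ξ)
  simp only [SchwartzMap.compSubConstCLM_apply] at hi
  calc oscInt K f J ρ ξ = ∫ s in J, ∫ η, (K ρ s : ℂ) * (ψ (η - ξ) * f s η) := by
        refine integral_congr_ae ?_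
        filter_upwards [hψ] with s hs
        rw [integral_const_mul, ← hs ξ]
    _ = ∫ η, ∫ s in J, (K ρ s : ℂ) * (ψ (η - ξ) * f s η) :=
        integral_integral_swap (f := fun s η => (K ρ s : ℂ) * (ψ (η - ξ) * f s η)) hi
    _ = _ := by
        congr 1; ext η
        rw [oscInt, ← integral_const_mul]
        congr 1; ext s; ring

/-- The restriction to the cone `ρ = ‖ξ‖` of the oscillatory integrals of a forcing term with a
convolution reproducing formula. -/
theorem exists_lintegral_oscInt_le (hn : 1 ≤ n) (ψ : 𝓢(Rn n, ℂ)) {s : ℝ}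
    (hs : 0 ≤ (n : ℝ) - 1 + s) : ∃ C : ℝ≥0∞, C ≠ ∞ ∧ ∀ (K : ℝ → ℝ → ℝ) (f : ℝ → Rn n → ℂ) (N : ℕ)
      (J : Set ℝ) (T : ℝ), Continuous (Function.uncurry K) → (∀ ρ s, |K ρ s| ≤ 1) →
      (∀ g : ℝ → ℂ, Integrable g → ∫⁻ ρ, ‖∫ s, (K ρ s : ℂ) * g s‖ₑ ^ 2 ≤ 2 * ∫⁻ s, ‖g s‖ₑ ^ 2) →
      TemperateForcing f N → MeasurableSet J → J ⊆ Ioc 0 T →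
      (∀ᵐ s ∂(volume.restrict J), ∀ ξ, f s ξ = ∫ η, ψ (η - ξ) * f s η) →
      ∫⁻ ξ, ENNReal.ofReal (‖ξ‖ ^ s) * ‖oscInt K f J ‖ξ‖ ξ‖ₑ ^ 2 ≤
        C * ∫⁻ τ in J, ∫⁻ η, ENNReal.ofReal ((1 + ‖η‖) ^ s) * ‖f τ η‖ₑ ^ 2 := by
  obtain ⟨C, hC, hb⟩ := exists_lintegral_radial_le hn ψ hs
  set A : ℝ≥0∞ := ∫⁻ η, ‖ψ η‖ₑ with hA
  have hAfin : A ≠ ∞ := ψ.integrable.2.ne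
  refine ⟨A * C * 2, by finiteness, ?_⟩
  intro K f N J T hK hK1 hK2 hf hJm hJ hψ
  have hΨm := measurable_oscInt (J := J) hf.1 hK
  have hψc : Continuous fun p : Rn n × Rn n => ψ (p.2 - p.1) := ψ.continuous.comp (by fun_prop)
  -- The point (|ξ|, ξ) of the cone is replaced by an average over (|ξ|, η). The time frequency
  -- stays |ξ| while η becomes free, so the later integration over ξ can use |ξ| as a variable
  -- independent of η.
  have hpt : ∀ ξ, ENNReal.ofReal (‖ξ‖ ^ s) * ‖oscInt K f J ‖ξ‖ ξ‖ₑ ^ 2 ≤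
      A * ∫⁻ η, ENNReal.ofReal (‖ξ‖ ^ s * ‖ψ (η - ξ)‖) * ‖oscInt K f J ‖ξ‖ η‖ₑ ^ 2 := by
    intro ξ
    have hm1 : Measurable fun η => ‖ψ (η - ξ)‖ₑ :=
      (hψc.comp (by fun_prop : Continuous fun η => (ξ, η))).enorm.measurable
    have hm2 : Measurable fun η => ‖oscInt K f J ‖ξ‖ η‖ₑ :=
      (hΨm.comp (by fun_prop : Measurable fun η : Rn n => (‖ξ‖, η))).enorm
    have e1 : ‖oscInt K f J ‖ξ‖ ξ‖ₑ ^ 2 ≤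
        A * ∫⁻ η, ‖ψ (η - ξ)‖ₑ * ‖oscInt K f J ‖ξ‖ η‖ₑ ^ 2 := by
      calc _ ≤ (∫⁻ η, ‖ψ (η - ξ)‖ₑ * ‖oscInt K f J ‖ξ‖ η‖ₑ) ^ 2 := by
            gcongr
            rw [hf.oscInt_eq_integral hJm hJ hK hK1 hψ ‖ξ‖ ξ]
            refine (enorm_integral_le_lintegral_enorm _).trans (le_of_eq ?_)
            simp_rw [enorm_mul]
        _ ≤ _ := lintegral_mul_sq_le_weighted hm1.aemeasurable hm2.aemeasurable
        _ = _ := by rw [hA, lintegral_sub_right_eq_self (fun η => ‖ψ η‖ₑ) ξ]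
    calc _ ≤ ENNReal.ofReal (‖ξ‖ ^ s) * (A * ∫⁻ η, ‖ψ (η - ξ)‖ₑ * ‖oscInt K f J ‖ξ‖ η‖ₑ ^ 2) := by
          gcongr
      _ = A * (ENNReal.ofReal (‖ξ‖ ^ s) * ∫⁻ η, ‖ψ (η - ξ)‖ₑ * ‖oscInt K f J ‖ξ‖ η‖ₑ ^ 2) := by ring
      _ = _ := by
          rw [← lintegral_const_mul' _ _ ENNReal.ofReal_ne_top]
          congr 2; ext η
          rw [ENNReal.ofReal_mul (by positivity), ofReal_norm, mul_assoc]
  have hcone : Measurable fun p : Rn n × Rn n => ‖oscInt K f J ‖p.1‖ p.2‖ₑ ^ 2 :=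
    (hΨm.comp (by fun_prop : Measurable fun p : Rn n × Rn n => (‖p.1‖, p.2))).enorm.pow_const 2
  have hker : Measurable fun p : Rn n × Rn n => ENNReal.ofReal (‖p.1‖ ^ s * ‖ψ (p.2 - p.1)‖) :=
    ENNReal.measurable_ofReal.comp ((measurable_fst.norm.pow_const s).mul hψc.norm.measurable)
  -- At fixed η this is Plancherel in time for f extended by zero outside J.
  have hplan : ∀ᵐ η, ∫⁻ ρ, ‖oscInt K f J ρ η‖ₑ ^ 2 ≤ 2 * ∫⁻ τ in J, ‖f τ η‖ₑ ^ 2 := by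
    filter_upwards [hf.ae_integrableOn hJ] with η hη
    have h1 := hK2 (J.indicator fun τ => f τ η) ((integrable_indicator_iff hJm).2 hη)
    have e1 : ∫⁻ τ, ‖J.indicator (fun τ => f τ η) τ‖ₑ ^ 2 = ∫⁻ τ in J, ‖f τ η‖ₑ ^ 2 := by
      rw [← lintegral_indicator hJm]
      congr 1; ext τ
      by_cases hτ : τ ∈ J <;> simp [hτ]
    rw [e1] at h1
    convert h1 using 5 with ρ
    rw [oscInt, ← integral_indicator hJm]
    congr 1; ext τ
    by_cases hτ : τ ∈ J <;> simp [hτ]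
  have hfm : Measurable fun p : ℝ × Rn n => ‖f p.1 p.2‖ₑ ^ 2 := hf.1.enorm.pow_const 2
  have hw : Measurable fun η : Rn n => ENNReal.ofReal ((1 + ‖η‖) ^ s) :=
    ENNReal.measurable_ofReal.comp ((measurable_const.add measurable_norm).pow_const s)
  calc _ ≤ ∫⁻ ξ, A * ∫⁻ η, ENNReal.ofReal (‖ξ‖ ^ s * ‖ψ (η - ξ)‖) * ‖oscInt K f J ‖ξ‖ η‖ₑ ^ 2 :=
        lintegral_mono hpt
    _ = A * ∫⁻ η, ∫⁻ ξ, ENNReal.ofReal (‖ξ‖ ^ s * ‖ψ (η - ξ)‖) * ‖oscInt K f J ‖ξ‖ η‖ₑ ^ 2 := by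
        rw [lintegral_const_mul' _ _ hAfin, lintegral_lintegral_swap]
        exact (hker.mul hcone).aemeasurable
    _ ≤ A * ∫⁻ η, C * (ENNReal.ofReal ((1 + ‖η‖) ^ s) * (2 * ∫⁻ τ in J, ‖f τ η‖ₑ ^ 2)) := by
        refine mul_le_mul' le_rfl ?_
        refine lintegral_mono_ae ?_
        filter_upwards [hplan] with η hη
        refine (hb η (fun ρ => ‖oscInt K f J ρ η‖ₑ ^ 2) ?_).trans (by gcongr)
        exact (hΨm.comp (by fun_prop : Measurable fun ρ : ℝ => (ρ, η))).enorm.pow_const 2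
    _ = A * C * 2 * ∫⁻ η, ∫⁻ τ in J, ENNReal.ofReal ((1 + ‖η‖) ^ s) * ‖f τ η‖ₑ ^ 2 := by
        rw [lintegral_const_mul' _ _ hC]
        simp_rw [lintegral_const_mul' _ _ ENNReal.ofReal_ne_top]
        have e2 : ∀ η : Rn n, ENNReal.ofReal ((1 + ‖η‖) ^ s) * (2 * ∫⁻ τ in J, ‖f τ η‖ₑ ^ 2) =
            2 * (ENNReal.ofReal ((1 + ‖η‖) ^ s) * ∫⁻ τ in J, ‖f τ η‖ₑ ^ 2) := fun η => by ring
        simp_rw [e2]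
        rw [lintegral_const_mul' _ _ (by norm_num)]
        ring
    _ = _ := by
        rw [lintegral_lintegral_swap]
        exact ((hw.comp measurable_fst).mul (hfm.comp measurable_swap)).aemeasurable

end OscillatoryIntegral

/-! ### Sobolev energy of the forcing. -/

section Energy

variable {n : ℕ} {f : ℝ → Rn n → ℂ} {N : ℕ} {J : Set ℝ} {T : ℝ}

/-- The symbol of `1 - Δ`. -/
noncomputable def besselSymbol (ξ : Rn n) : ℝ := 1 + (2 * Real.pi * ‖ξ‖) ^ 2

theorem besselSymbol_pos (ξ : Rn n) : 0 < besselSymbol ξ := by unfold besselSymbol; positivity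

theorem continuous_besselSymbol : Continuous (besselSymbol (n := n)) := by
  unfold besselSymbol; fun_prop

/-- The weights (1+|ξ|)² and 1+(2π|ξ|)² are comparable in both directions with constant 2(2π)²,
which covers both signs of b. -/
theorem one_add_norm_rpow_le_besselSymbol (b : ℝ) (ξ : Rn n) :
    (1 + ‖ξ‖) ^ (2 * b) ≤ (2 * (2 * Real.pi) ^ 2) ^ |b| * besselSymbol ξ ^ b := by
  have hx := norm_nonneg ξ
  have hJ := besselSymbol_pos ξ
  have h4 : 1 ≤ (2 * Real.pi) ^ 2 := by nlinarith [Real.pi_gt_three]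
  have h1 : (1 + ‖ξ‖) ^ 2 ≤ (2 * (2 * Real.pi) ^ 2) * besselSymbol ξ := by
    have h2 : (1 + ‖ξ‖) ^ 2 ≤ 2 * besselSymbol ξ := by
      rw [besselSymbol, mul_pow]
      nlinarith [sq_nonneg (‖ξ‖ - 1), sq_nonneg ‖ξ‖]
    nlinarith
  have h3 : besselSymbol ξ ≤ (2 * (2 * Real.pi) ^ 2) * (1 + ‖ξ‖) ^ 2 := by
    rw [besselSymbol, mul_pow]
    nlinarith [sq_nonneg ‖ξ‖, mul_nonneg (by positivity : 0 ≤ (2 * Real.pi) ^ 2) hx]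
  have hc : (0 : ℝ) < 2 * (2 * Real.pi) ^ 2 := by positivity
  rw [Real.rpow_mul (by positivity), Real.rpow_ofNat]
  rcases le_total 0 b with h | h
  · rw [abs_of_nonneg h, ← Real.mul_rpow hc.le hJ.le]
    exact Real.rpow_le_rpow (by positivity) h1 h
  · rw [abs_of_nonpos h, Real.rpow_neg hc.le, ← div_eq_inv_mul, le_div_iff₀ (by positivity),
      ← Real.mul_rpow (by positivity) hc.le, mul_comm _ (2 * (2 * Real.pi) ^ 2)]
    exact Real.rpow_le_rpow_of_nonpos hJ h3 h

/-- The square of the Sobolev norm of order `γ - 1` at time `s`. -/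
noncomputable def energy (γ : ℝ) (f : ℝ → Rn n → ℂ) (s : ℝ) : ℝ≥0∞ :=
  ∫⁻ ξ, ‖besselSymbol ξ ^ ((γ - 1) / 2) • f s ξ‖ₑ ^ 2

theorem enorm_besselSymbol_smul_sq (b : ℝ) (ξ : Rn n) (z : ℂ) :
    ‖besselSymbol ξ ^ (b / 2) • z‖ₑ ^ 2 = ENNReal.ofReal (besselSymbol ξ ^ b) * ‖z‖ₑ ^ 2 := by
  have hJ := besselSymbol_pos ξ
  rw [enorm_smul, mul_pow, Real.enorm_of_nonneg (by positivity), ← ENNReal.ofReal_pow (by positivity),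
    ← Real.rpow_natCast, ← Real.rpow_mul hJ.le]
  congr 3; push_cast; ring

theorem measurable_weighted (γ : ℝ) (hf : Measurable (Function.uncurry f)) :
    Measurable fun p : ℝ × Rn n => besselSymbol p.2 ^ ((γ - 1) / 2) • f p.1 p.2 :=
  ((continuous_besselSymbol.measurable.comp measurable_snd).pow_const _).smul hf

theorem measurable_energy (γ : ℝ) (hf : Measurable (Function.uncurry f)) : Measurable (energy γ f) :=
  ((measurable_weighted γ hf).enorm.pow_const 2).lintegral_prod_right'

theorem sobolevNorm_sq_eq_energy {γ : ℝ} {u : 𝓢'(Rn n, ℂ)} {s : ℝ}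
    (h : IsRepresentedBy (𝓕 u) (f s)) : sobolevNorm (γ - 1) u ^ 2 = energy γ f s := by
  rw [sobolevNorm, weightedFourierNorm_eq h, ← lintegral_enorm_sq_eq_eLpNorm_sq]
  rfl

/-- Cauchy–Schwarz on (0, T] × ℝⁿ: up to the Sobolev weight f is square integrable, and the
remaining factor is square integrable in ξ and constant in time. The order N depends on n and γ
only. -/
theorem exists_temperateForcing (n : ℕ) (γ : ℝ) : ∃ N : ℕ, ∀ f : ℝ → Rn n → ℂ,
    Measurable (Function.uncurry f) → ∫⁻ s in Ioi (0 : ℝ), energy γ f s ≠ ∞ →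
    TemperateForcing f N := by
  -- This choice makes 2N + 2(γ-1) ≥ n+1, so the square of the remaining weight is integrable.
  obtain ⟨N, hN⟩ := exists_nat_ge ((n : ℝ) + 1 + |γ - 1|)
  refine ⟨N, fun f hf hfin => ⟨hf, fun T => ?_⟩⟩
  set ν := (volume.restrict (Ioc 0 T)).prod (volume : Measure (Rn n)) with hν
  have h1 : MemLp (fun p : ℝ × Rn n => besselSymbol p.2 ^ ((γ - 1) / 2) • f p.1 p.2) 2 ν := by
    refine ⟨(measurable_weighted γ hf).aestronglyMeasurable, ?_⟩
    have e : eLpNorm (fun p : ℝ × Rn n => besselSymbol p.2 ^ ((γ - 1) / 2) • f p.1 p.2) 2 ν ^ 2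
        = ∫⁻ s in Ioc 0 T, energy γ f s := by
      rw [← lintegral_enorm_sq_eq_eLpNorm_sq, hν, lintegral_prod _
        ((measurable_weighted γ hf).enorm.pow_const 2).aemeasurable]
      rfl
    have h2 : ∫⁻ s in Ioc 0 T, energy γ f s < ∞ :=
      (lintegral_mono_set Ioc_subset_Ioi_self).trans_lt hfin.lt_top
    rw [← e] at h2
    exact lt_top_iff_ne_top.2 fun h => by rw [h] at h2; simp at h2
  set b : Rn n → ℝ := fun ξ => ((1 + ‖ξ‖) ^ N)⁻¹ * besselSymbol ξ ^ (-((γ - 1) / 2)) with hb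
  have hbc : Continuous b := by
    refine Continuous.mul (by fun_prop (disch := intros; positivity)) ?_
    exact continuous_besselSymbol.rpow_const fun ξ => Or.inl (besselSymbol_pos ξ).ne'
  have hb2 : MemLp b 2 volume := by
    refine (memLp_two_iff_integrable_sq hbc.aestronglyMeasurable).2 ?_
    have h3 := (integrable_one_add_norm (E := Rn n) (μ := volume) (r := (n : ℝ) + 1) (by simp)).const_mul
      ((2 * (2 * Real.pi) ^ 2) ^ |γ - 1|)
    refine h3.mono' (hbc.pow 2).aestronglyMeasurable (ae_of_all _ fun ξ => ?_)
    have hx : 0 < 1 + ‖ξ‖ := by positivity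
    have hJ := besselSymbol_pos ξ
    have h4 := one_add_norm_rpow_le_besselSymbol (γ - 1) ξ
    have e1 : b ξ ^ 2 = (1 + ‖ξ‖) ^ (-(2 * N : ℝ)) * (besselSymbol ξ ^ (γ - 1))⁻¹ := by
      rw [hb]
      simp only
      rw [mul_pow, ← Real.rpow_neg hJ.le, ← Real.rpow_natCast (besselSymbol ξ ^ _),
        ← Real.rpow_mul hJ.le, ← Real.rpow_natCast (1 + ‖ξ‖) N, ← Real.rpow_neg hx.le,
        ← Real.rpow_natCast (_ ^ (-(N : ℝ))), ← Real.rpow_mul hx.le]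
      congr 2 <;> push_cast <;> ring
    rw [Real.norm_of_nonneg (sq_nonneg _), e1]
    have h5 : (besselSymbol ξ ^ (γ - 1))⁻¹ ≤
        (2 * (2 * Real.pi) ^ 2) ^ |γ - 1| * (1 + ‖ξ‖) ^ (-(2 * (γ - 1))) := by
      rw [Real.rpow_neg hx.le, ← div_eq_mul_inv, le_div_iff₀ (by positivity),
        inv_mul_le_iff₀ (by positivity), mul_comm (besselSymbol ξ ^ _)]
      exact h4
    calc _ ≤ (1 + ‖ξ‖) ^ (-(2 * N : ℝ)) *
          ((2 * (2 * Real.pi) ^ 2) ^ |γ - 1| * (1 + ‖ξ‖) ^ (-(2 * (γ - 1)))) := by gcongr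
      _ = (2 * (2 * Real.pi) ^ 2) ^ |γ - 1| * (1 + ‖ξ‖) ^ (-(2 * N : ℝ) + -(2 * (γ - 1))) := by
          rw [Real.rpow_add hx]; ring
      _ ≤ _ := by
          gcongr
          · linarith [norm_nonneg ξ]
          · have : (0 : ℝ) ≤ n := n.cast_nonneg
            linarith [neg_abs_le (γ - 1)]
  have h6 : MemLp (fun p : ℝ × Rn n => b p.2) 2 ν := hb2.comp_snd _
  refine (h1.smul h6 (r := 1) |> memLp_one_iff_integrable.1).congr (ae_of_all _ fun p => ?_)
  have hJ := besselSymbol_pos p.2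
  simp only [Pi.smul_apply', hb]
  rw [smul_smul, mul_assoc, ← Real.rpow_add hJ, neg_add_cancel, Real.rpow_zero, mul_one]

end Energy

/-! ### Strichartz estimate for the forcing on a fixed time set. -/

section FreeEstimate

variable {n : ℕ} {f : ℝ → Rn n → ℂ} {N : ℕ} {J : Set ℝ} {T : ℝ}

theorem freeHat_zero (a b : Rn n → ℂ) : freeHat a b 0 = a := by
  ext ξ; simp [freeHat, waveCos_zero, waveSin_zero]

theorem freeHat'_zero (a b : Rn n → ℂ) : freeHat' a b 0 = b := by
  ext ξ; simp [freeHat', waveCos_zero, waveSin_zero]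

theorem homSobolevNorm_sq {s : ℝ} {u : 𝓢'(Rn n, ℂ)} {g : Rn n → ℂ}
    (h : IsRepresentedBy (𝓕 u) g) :
    homSobolevNorm s u ^ 2 = ∫⁻ ξ, ‖(2 * Real.pi * ‖ξ‖) ^ s • g ξ‖ₑ ^ 2 := by
  rw [homSobolevNorm, weightedFourierNorm_eq h, ← lintegral_enorm_sq_eq_eLpNorm_sq]

theorem enorm_rpow_smul_sq (s : ℝ) (ξ : Rn n) (z : ℂ) :
    ‖(2 * Real.pi * ‖ξ‖) ^ s • z‖ₑ ^ 2 =
      ENNReal.ofReal ((2 * Real.pi) ^ (2 * s)) * (ENNReal.ofReal (‖ξ‖ ^ (2 * s)) * ‖z‖ₑ ^ 2) := by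
  have hpi := Real.pi_pos
  rw [enorm_smul, mul_pow, ← mul_assoc, ← ENNReal.ofReal_mul (by positivity),
    ← Real.mul_rpow (by positivity) (norm_nonneg _), Real.enorm_of_nonneg (by positivity),
    ← ENNReal.ofReal_pow (by positivity), ← Real.rpow_natCast, ← Real.rpow_mul (by positivity)]
  congr 3; push_cast; ring

/-- The denominator 2π|ξ| of the sine multiplier lowers the order from γ to γ-1, so position and
velocity reduce to the same weighted oscillatory integral. -/
theorem sinCoef_weighted (γ : ℝ) {ξ : Rn n} (hξ : ξ ≠ 0) :
    ‖(2 * Real.pi * ‖ξ‖) ^ γ • sinCoef f J ξ‖ₑ = ‖(2 * Real.pi * ‖ξ‖) ^ (γ - 1) •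
      oscInt (fun ρ s => Real.sin (2 * Real.pi * ρ * s)) f J ‖ξ‖ ξ‖ₑ := by
  have hx : 0 < 2 * Real.pi * ‖ξ‖ := by have := Real.pi_pos; have := norm_pos_iff.2 hξ; positivity
  have e : oscInt (fun ρ s => Real.sin (2 * Real.pi * ρ * s)) f J ‖ξ‖ ξ =
      (2 * Real.pi * ‖ξ‖ : ℝ) • (-sinCoef f J ξ) := by
    rw [oscInt, sinCoef, neg_neg, ← integral_smul]
    congr 1; ext s
    rw [← mul_waveSin, Complex.real_smul]; push_cast; ring
  rw [e, smul_smul, smul_neg, enorm_neg, Real.rpow_sub_one hx.ne', div_mul_cancel₀ _ hx.ne']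

/-- The data of the free wave generated by the forcing on `J`, in homogeneous Sobolev spaces. -/
theorem exists_homSobolevNorm_wave_le (hn : 2 ≤ n) (ψ : 𝓢(Rn n, ℂ)) {γ : ℝ}
    (hγ : -((n : ℝ) - 3) / 2 ≤ γ) : ∃ C : ℝ≥0∞, C ≠ ∞ ∧ ∀ (f : ℝ → Rn n → ℂ) (N : ℕ) (J : Set ℝ)
      (T : ℝ) (hf : TemperateForcing f N) (hJm : MeasurableSet J) (hJ : J ⊆ Ioc 0 T),
      (∀ᵐ s ∂(volume.restrict J), ∀ ξ, f s ξ = ∫ η, ψ (η - ξ) * f s η) →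
      homSobolevNorm γ (𝓕⁻ (hf.wave hJm hJ 0)) ^ 2 ≤ C * ∫⁻ s in J, energy γ f s ∧
      homSobolevNorm (γ - 1) (𝓕⁻ (hf.wave' hJm hJ 0)) ^ 2 ≤ C * ∫⁻ s in J, energy γ f s := by
  -- The squared weight has s = 2(γ-1), for which n-1+s ≥ 0 is the hypothesis on γ.
  obtain ⟨C, hC, hb⟩ := exists_lintegral_oscInt_le (by omega : 1 ≤ n) ψ (s := 2 * (γ - 1))
    (by linarith)
  set D := ENNReal.ofReal ((2 * (2 * Real.pi) ^ 2) ^ |γ - 1|)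
  set P := ENNReal.ofReal ((2 * Real.pi) ^ (2 * (γ - 1)))
  refine ⟨P * (C * D), by finiteness, fun f N J T hf hJm hJ hψ => ?_⟩
  have hen : ∫⁻ τ in J, ∫⁻ η, ENNReal.ofReal ((1 + ‖η‖) ^ (2 * (γ - 1))) * ‖f τ η‖ₑ ^ 2 ≤
      D * ∫⁻ s in J, energy γ f s := by
    rw [← lintegral_const_mul' _ _ ENNReal.ofReal_ne_top]
    refine lintegral_mono fun τ => ?_
    simp only
    rw [energy, ← lintegral_const_mul' _ _ ENNReal.ofReal_ne_top]
    refine lintegral_mono fun η => ?_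
    simp only
    rw [enorm_besselSymbol_smul_sq, ← mul_assoc, ← ENNReal.ofReal_mul (by positivity)]
    gcongr
    exact one_add_norm_rpow_le_besselSymbol (γ - 1) η
  have hmain : ∀ K : ℝ → ℝ → ℝ, Continuous (Function.uncurry K) → (∀ ρ s, |K ρ s| ≤ 1) →
      (∀ g : ℝ → ℂ, Integrable g → ∫⁻ ρ, ‖∫ s, (K ρ s : ℂ) * g s‖ₑ ^ 2 ≤ 2 * ∫⁻ s, ‖g s‖ₑ ^ 2) →
      ∫⁻ ξ, ‖(2 * Real.pi * ‖ξ‖) ^ (γ - 1) • oscInt K f J ‖ξ‖ ξ‖ₑ ^ 2 ≤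
        P * (C * D) * ∫⁻ s in J, energy γ f s := by
    intro K hK hK1 hK2
    simp_rw [enorm_rpow_smul_sq]
    rw [lintegral_const_mul' _ _ ENNReal.ofReal_ne_top]
    calc _ ≤ P * (C * (D * ∫⁻ s in J, energy γ f s)) := by
          refine mul_le_mul' le_rfl ((hb K f N J T hK hK1 hK2 hf hJm hJ hψ).trans ?_)
          exact mul_le_mul' le_rfl hen
      _ = _ := by ring
  have r1 : IsRepresentedBy (𝓕 (𝓕⁻ (hf.wave hJm hJ 0))) (sinCoef f J) := by
    rw [FourierTransform.fourier_fourierInv_eq]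
    have := (temperateL1_freeHat (hf.temperateL1_sinCoef hJm hJ)
      (hf.temperateL1_cosCoef hJm hJ) 0).isRepresentedBy_toDist
    exact this.congr (by rw [freeHat_zero])
  have r2 : IsRepresentedBy (𝓕 (𝓕⁻ (hf.wave' hJm hJ 0))) (cosCoef f J) := by
    rw [FourierTransform.fourier_fourierInv_eq]
    have := (temperateL1_freeHat' (hf.temperateL1_sinCoef hJm hJ)
      (hf.temperateL1_cosCoef hJm hJ) 0).isRepresentedBy_toDist
    exact this.congr (by rw [freeHat'_zero])
  rw [homSobolevNorm_sq r1, homSobolevNorm_sq r2]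
  constructor
  · refine le_trans (le_of_eq ?_) (hmain (fun ρ s => Real.sin (2 * Real.pi * ρ * s)) (by fun_prop)
      (fun _ _ => Real.abs_sin_le_one _) fun g hg => lintegral_enorm_sq_sin_le hg)
    have : Nonempty (Fin n) := ⟨⟨0, by omega⟩⟩
    refine lintegral_congr_ae ?_
    filter_upwards [compl_mem_ae_iff.2 (measure_singleton (0 : Rn n))] with ξ hξ
    rw [sinCoef_weighted γ hξ]
  · exact hmain (fun ρ s => Real.cos (2 * Real.pi * ρ * s)) (by fun_prop)
      (fun _ _ => Real.abs_cos_le_one _) fun g hg => lintegral_enorm_sq_cos_le hg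

/-- The Strichartz estimate for the free wave generated by the forcing on `J`. -/
theorem exists_timeNorm_wave_le (hn : 2 ≤ n) (ψ : 𝓢(Rn n, ℂ)) {X : NormedFunctionSpace n} {γ : ℝ}
    (hγ : -((n : ℝ) - 3) / 2 ≤ γ) {q : ℝ≥0∞} (hX : FreeStrichartz X γ q) :
    ∃ C : ℝ≥0∞, C ≠ ∞ ∧ ∀ (f : ℝ → Rn n → ℂ) (N : ℕ) (J : Set ℝ)
      (T : ℝ) (hf : TemperateForcing f N) (hJm : MeasurableSet J) (hJ : J ⊆ Ioc 0 T),
      (∀ᵐ s ∂(volume.restrict J), ∀ ξ, f s ξ = ∫ η, ψ (η - ξ) * f s η) →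
      ∫⁻ s in J, energy γ f s ≠ ∞ →
      timeNorm X.nrm q univ (fun t => 𝓕⁻ (hf.wave hJm hJ t)) ≤
        C * (∫⁻ s in J, energy γ f s) ^ (1 / 2 : ℝ) := by
  obtain ⟨C₀, hC₀⟩ := hX
  obtain ⟨C, hC, hb⟩ := exists_homSobolevNorm_wave_le hn ψ hγ
  refine ⟨C₀ * (2 * C ^ (1 / 2 : ℝ)), ?_, fun f N J T hf hJm hJ hψ hfin => ?_⟩
  · exact ENNReal.mul_ne_top ENNReal.coe_ne_top (ENNReal.mul_ne_top (by norm_num)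
      (ENNReal.rpow_ne_top_of_nonneg (by norm_num) hC))
  obtain ⟨h1, h2⟩ := hb f N J T hf hJm hJ hψ
  have hroot : ∀ {a b : ℝ≥0∞}, a ^ 2 ≤ b → a ≤ b ^ (1 / 2 : ℝ) := fun {a b} h => by
    have h' := ENNReal.rpow_le_rpow h (by norm_num : (0 : ℝ) ≤ 1 / 2)
    rwa [← ENNReal.rpow_ofNat, ← ENNReal.rpow_mul, (by norm_num : (2 : ℝ) * (1 / 2) = 1),
      ENNReal.rpow_one] at h'
  have h1' := hroot h1
  have h2' := hroot h2
  rw [ENNReal.mul_rpow_of_nonneg _ _ (by norm_num)] at h1' h2'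
  have hfin' : C ^ (1 / 2 : ℝ) * (∫⁻ s in J, energy γ f s) ^ (1 / 2 : ℝ) < ∞ :=
    ENNReal.mul_lt_top (ENNReal.rpow_lt_top_of_nonneg (by norm_num) hC)
      (ENNReal.rpow_lt_top_of_nonneg (by norm_num) hfin)
  have h3 := hC₀ _ _ (isWaveSolutionOn_free (hf.temperateL1_sinCoef hJm hJ)
    (hf.temperateL1_cosCoef hJm hJ)) (h1'.trans_lt hfin') (h2'.trans_lt hfin')
  refine h3.trans ?_
  calc _ ≤ C₀ * (C ^ (1 / 2 : ℝ) * (∫⁻ s in J, energy γ f s) ^ (1 / 2 : ℝ) +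
        C ^ (1 / 2 : ℝ) * (∫⁻ s in J, energy γ f s) ^ (1 / 2 : ℝ)) :=
        mul_le_mul' le_rfl (add_le_add h1' h2')
    _ = _ := by ring

end FreeEstimate

/-! ### Suprema and sums in L^q with values in [0, ∞]. -/

section LpLattice

variable {α : Type*} [MeasurableSpace α] {μ : Measure α} {q c : ℝ≥0∞}

theorem eLpNorm_le_iff_lintegral_rpow_le {f : α → ℝ≥0∞} (hq0 : q ≠ 0) (hq : q ≠ ∞) :
    eLpNorm f q μ ≤ c ↔ ∫⁻ x, f x ^ q.toReal ∂μ ≤ c ^ q.toReal := by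
  have hr : 0 < q.toReal := ENNReal.toReal_pos hq0 hq
  rw [eLpNorm_eq_lintegral_rpow_enorm_toReal hq0 hq, one_div, ENNReal.rpow_inv_le_iff hr]
  simp only [enorm_eq_self]

theorem eLpNorm_top_le_iff {f : α → ℝ≥0∞} : eLpNorm f ∞ μ ≤ c ↔ ∀ᵐ x ∂μ, f x ≤ c := by
  rw [eLpNorm_exponent_top]
  constructor
  · intro h
    filter_upwards [ae_le_eLpNormEssSup (f := f) (μ := μ)] with x hx
    simpa using hx.trans h
  · intro h
    refine essSup_le_of_ae_le _ ?_
    filter_upwards [h] with x hx using by simpa using hx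

theorem eLpNorm_iSup_nat_le {h : ℕ → α → ℝ≥0∞} (hm : ∀ j, Measurable (h j)) (hmono : Monotone h)
    (hq0 : q ≠ 0) (hc : ∀ j, eLpNorm (h j) q μ ≤ c) : eLpNorm (fun x => ⨆ j, h j x) q μ ≤ c := by
  rcases eq_or_ne q ∞ with rfl | hq
  · simp only [eLpNorm_top_le_iff] at hc ⊢
    filter_upwards [ae_all_iff.2 hc] with x hx using iSup_le hx
  · simp only [eLpNorm_le_iff_lintegral_rpow_le hq0 hq] at hc ⊢
    have hr : 0 < q.toReal := ENNReal.toReal_pos hq0 hq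
    have e : ∀ x, (⨆ j, h j x) ^ q.toReal = ⨆ j, h j x ^ q.toReal := fun x =>
      (ENNReal.orderIsoRpow q.toReal hr).map_iSup _
    simp_rw [e]
    rw [lintegral_iSup (fun j => (hm j).pow_const _)
      fun i j hij x => ENNReal.rpow_le_rpow (hmono hij x) hr.le]
    exact iSup_le hc

/-- The q-th power of the supremum is at most the sum of the q-th powers. For q = ∞ the exponent is
0 and the factor is 1. -/
theorem eLpNorm_iSup_fin_le {K : ℕ} {h : Fin K → α → ℝ≥0∞} (hm : ∀ j, Measurable (h j))
    (hq0 : q ≠ 0) (hc : ∀ j, eLpNorm (h j) q μ ≤ c) :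
    eLpNorm (fun x => ⨆ j, h j x) q μ ≤ (K : ℝ≥0∞) ^ (q⁻¹).toReal * c := by
  rcases eq_or_ne q ∞ with rfl | hq
  · simp only [eLpNorm_top_le_iff, ENNReal.inv_top, ENNReal.toReal_zero, ENNReal.rpow_zero,
      one_mul] at hc ⊢
    filter_upwards [ae_all_iff.2 hc] with x hx using iSup_le hx
  · simp only [eLpNorm_le_iff_lintegral_rpow_le hq0 hq] at hc ⊢
    have hr : 0 < q.toReal := ENNReal.toReal_pos hq0 hq
    have e : ∀ x, (⨆ j, h j x) ^ q.toReal = ⨆ j, h j x ^ q.toReal := fun x =>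
      (ENNReal.orderIsoRpow q.toReal hr).map_iSup _
    calc ∫⁻ x, (⨆ j, h j x) ^ q.toReal ∂μ ≤ ∫⁻ x, ∑ j, h j x ^ q.toReal ∂μ := by
          refine lintegral_mono fun x => ?_
          simp only [e]
          exact iSup_le fun j => Finset.single_le_sum (f := fun j => h j x ^ q.toReal)
            (fun _ _ => zero_le) (Finset.mem_univ j)
      _ = ∑ j, ∫⁻ x, h j x ^ q.toReal ∂μ :=
          lintegral_finsetSum _ fun j _ => (hm j).pow_const _
      _ ≤ ∑ _ : Fin K, c ^ q.toReal := Finset.sum_le_sum fun j _ => hc j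
      _ = _ := by
          rw [Finset.sum_const, Finset.card_univ, Fintype.card_fin, nsmul_eq_mul,
            ENNReal.mul_rpow_of_nonneg _ _ hr.le, ← ENNReal.rpow_mul, ENNReal.toReal_inv,
            inv_mul_cancel₀ hr.ne', ENNReal.rpow_one]

theorem eLpNorm_tsum_nat_le {g : ℕ → α → ℝ≥0∞} (hm : ∀ j, Measurable (g j)) (hq : 1 ≤ q) :
    eLpNorm (fun x => ∑' j, g j x) q μ ≤ ∑' j, eLpNorm (g j) q μ := by
  simp_rw [ENNReal.tsum_eq_iSup_nat]
  refine eLpNorm_iSup_nat_le (h := fun i x => ∑ j ∈ Finset.range i, g j x) ?_ ?_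
    (zero_lt_one.trans_le hq).ne' fun i => ?_
  · exact fun i => Finset.measurable_sum _ fun j _ => hm j
  · exact fun i j hij x => Finset.sum_le_sum_of_subset (Finset.range_mono hij)
  · refine le_trans ?_ (le_iSup _ i)
    have := eLpNorm_sum_le (μ := μ) (p := q) (s := Finset.range i) (f := g)
      (fun j _ => (hm j).aestronglyMeasurable) hq
    have e : (fun x => ∑ j ∈ Finset.range i, g j x) = ∑ j ∈ Finset.range i, g j := by
      ext x; rw [Finset.sum_apply]
    rw [e]
    exact this

theorem eLpNorm_restrict_iUnion_le {f : α → ℝ≥0∞} {s : ℕ → Set α} (hs : Monotone s) (hq0 : q ≠ 0)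
    (hc : ∀ j, eLpNorm f q (μ.restrict (s j)) ≤ c) : eLpNorm f q (μ.restrict (⋃ j, s j)) ≤ c := by
  rcases eq_or_ne q ∞ with rfl | hq
  · simp only [eLpNorm_top_le_iff] at hc ⊢
    exact ae_restrict_iUnion_iff _ _ |>.2 hc
  · simp only [eLpNorm_le_iff_lintegral_rpow_le hq0 hq] at hc ⊢
    rw [setLIntegral_iUnion_of_directed _ hs.directed_le]
    exact iSup_le hc

end LpLattice

/-! ### Level sets of a primitive. -/

section Primitive

theorem monotone_primitive {m : ℝ → ℝ} (hm : Integrable m) (h0 : ∀ s, 0 ≤ m s) :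
    Monotone fun s => ∫ x in (0 : ℝ)..s, m x := fun s t hst => by
  have h := intervalIntegral.integral_add_adjacent_intervals
    (hm.intervalIntegrable (a := 0) (b := s)) (hm.intervalIntegrable (a := s) (b := t))
  have h1 : 0 ≤ ∫ x in s..t, m x := intervalIntegral.integral_nonneg hst fun x _ => h0 x
  simp only
  linarith

/-- The distribution of a density with respect to its primitive. -/
theorem setIntegral_le_of_primitive_mem_Icc {m : ℝ → ℝ} (hm : Integrable m) (h0 : ∀ s, 0 ≤ m s)
    {S : Set ℝ} {a b c d : ℝ} (hb : S ⊆ Icc c d) (hab : a ≤ b)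
    (hSM : ∀ s ∈ S, (∫ x in (0 : ℝ)..s, m x) ∈ Icc a b) : ∫ x in S, m x ≤ b - a := by
  rcases S.eq_empty_or_nonempty with rfl | hne
  · simpa using hab
  have hbb : BddBelow S := bddBelow_Icc.mono hb
  have hba : BddAbove S := bddAbove_Icc.mono hb
  have hcont : Continuous fun s => ∫ x in (0 : ℝ)..s, m x :=
    intervalIntegral.continuous_primitive (fun _ _ => hm.intervalIntegrable) 0
  -- The infimum and supremum of S lie in its closure, where the primitive still takes values in [a,
  -- b] by continuity. The integral over S is bounded by the increment between these two points.
  have hcl : closure S ⊆ (fun s => ∫ x in (0 : ℝ)..s, m x) ⁻¹' Icc a b :=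
    closure_minimal hSM (isClosed_Icc.preimage hcont)
  have h1 := hcl (csInf_mem_closure hne hbb)
  have h2 := hcl (csSup_mem_closure hne hba)
  have hle : sInf S ≤ sSup S := csInf_le_csSup hne hbb hba
  calc ∫ x in S, m x ≤ ∫ x in Icc (sInf S) (sSup S), m x :=
        setIntegral_mono_set hm.integrableOn (ae_of_all _ h0)
          (LE.le.eventuallyLE fun x hx => ⟨csInf_le hbb hx, le_csSup hba hx⟩)
    _ = (∫ x in (0 : ℝ)..sSup S, m x) - ∫ x in (0 : ℝ)..sInf S, m x := by
        rw [integral_Icc_eq_integral_Ioc, ← intervalIntegral.integral_of_le hle,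
          intervalIntegral.integral_interval_sub_left hm.intervalIntegrable hm.intervalIntegrable]
    _ ≤ b - a := by have := h1.1; have := h2.2; simp only at *; linarith

end Primitive

/-! ### Lower semicontinuity of the norm of X. -/

section NormedFunctionSpace

variable {n : ℕ} (X : NormedFunctionSpace n)

theorem NormedFunctionSpace.nrm_zero : X.nrm 0 = 0 := by
  have h := X.nrm_smul 0 0
  have e : (0 : ℂ) • (0 : 𝓢'(Rn n, ℂ)) = 0 := by ext φ; exact zero_mul _
  rwa [e, enorm_zero, zero_mul] at h

/-- By duality the norm is a supremum of |u φ| over a fixed set of test functions, so it is lower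
semicontinuous for weak convergence. -/
theorem NormedFunctionSpace.nrm_le_of_tendsto {ι : Type*} {l : Filter ι} [l.NeBot]
    {u : ι → 𝓢'(Rn n, ℂ)} {u₀ : 𝓢'(Rn n, ℂ)} (h : ∀ φ, Tendsto (fun i => u i φ) l (𝓝 (u₀ φ)))
    {c : ℝ≥0∞} (hc : ∀ i, X.nrm (u i) ≤ c) : X.nrm u₀ ≤ c := by
  rw [X.nrm_eq_iSup]
  refine iSup₂_le fun φ hφ => ?_
  refine le_of_tendsto (h φ).enorm (Eventually.of_forall fun i => le_trans ?_ (hc i))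
  rw [X.nrm_eq_iSup]
  exact le_iSup₂_of_le φ hφ le_rfl

/-- The supremum is over an uncountable family, but each member is continuous in t, so the supremum
is lower semicontinuous. -/
theorem NormedFunctionSpace.measurable_nrm {u : ℝ → 𝓢'(Rn n, ℂ)}
    (h : ∀ φ, Continuous fun t => u t φ) : Measurable fun t => X.nrm (u t) := by
  have e : (fun t => X.nrm (u t)) = fun t => _ := funext fun t => X.nrm_eq_iSup (u t)
  rw [e]
  exact (lowerSemicontinuous_iSup fun φ => lowerSemicontinuous_iSup fun _ =>
    (h φ).enorm.lowerSemicontinuous).measurable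

end NormedFunctionSpace

/-! ### The Christ–Kiselev argument. -/

section ChristKiselev

variable {n : ℕ} {T : ℝ} {m : ℝ → ℝ} {B : ℝ}

/-- The primitive of a density. -/
noncomputable def primitive (m : ℝ → ℝ) (s : ℝ) : ℝ := ∫ x in (0 : ℝ)..s, m x

/-- The part of `(0, T]` where the primitive of `m` takes values in `(k B / 2 ^ i, (k + 1) B / 2 ^ i]`. -/
def dyadicPiece (m : ℝ → ℝ) (B T : ℝ) (i k : ℕ) : Set ℝ :=
  {s | s ∈ Ioc 0 T ∧ (k : ℝ) * (B / 2 ^ i) < primitive m s ∧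
    primitive m s ≤ ((k + 1 : ℕ) : ℝ) * (B / 2 ^ i)}

/-- The part of `(0, T]` where the primitive of `m` is at most `k B / 2 ^ i`. -/
def dyadicInit (m : ℝ → ℝ) (B T : ℝ) (i k : ℕ) : Set ℝ :=
  {s | s ∈ Ioc 0 T ∧ primitive m s ≤ (k : ℝ) * (B / 2 ^ i)}

theorem measurable_primitive (hm : Integrable m) : Measurable (primitive m) :=
  (intervalIntegral.continuous_primitive (fun _ _ => hm.intervalIntegrable) 0).measurable

theorem measurableSet_dyadicInit (hm : Integrable m) (i k : ℕ) :
    MeasurableSet (dyadicInit m B T i k) :=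
  measurableSet_Ioc.inter (measurableSet_le (measurable_primitive hm) measurable_const)

theorem measurableSet_dyadicPiece (hm : Integrable m) (i k : ℕ) :
    MeasurableSet (dyadicPiece m B T i k) :=
  measurableSet_Ioc.inter ((measurableSet_lt measurable_const (measurable_primitive hm)).inter
    (measurableSet_le (measurable_primitive hm) measurable_const))

theorem dyadicInit_union_dyadicPiece (hB : 0 < B) (i k : ℕ) :
    dyadicInit m B T i k ∪ dyadicPiece m B T i k = dyadicInit m B T i (k + 1) := by
  have hd : 0 < B / 2 ^ i := by positivity
  ext s
  simp only [dyadicInit, dyadicPiece, mem_union, mem_ofPred_eq]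
  constructor
  · rintro (⟨h1, h2⟩ | ⟨h1, h2, h3⟩)
    · refine ⟨h1, h2.trans ?_⟩
      gcongr
      exact k.le_succ
    · exact ⟨h1, h3⟩
  · rintro ⟨h1, h2⟩
    rcases le_or_gt (primitive m s) (k * (B / 2 ^ i)) with h | h
    · exact Or.inl ⟨h1, h⟩
    · exact Or.inr ⟨h1, h, h2⟩

theorem disjoint_dyadicInit_dyadicPiece (i k : ℕ) :
    Disjoint (dyadicInit m B T i k) (dyadicPiece m B T i k) :=
  disjoint_left.2 fun _ h1 h2 => absurd h1.2 (not_le.2 h2.2.1)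

theorem dyadicInit_two_mul (i k : ℕ) :
    dyadicInit m B T (i + 1) (2 * k) = dyadicInit m B T i k := by
  ext s
  simp only [dyadicInit, mem_ofPred_eq]
  have : ((2 * k : ℕ) : ℝ) * (B / 2 ^ (i + 1)) = k * (B / 2 ^ i) := by
    push_cast; rw [pow_succ]; field_simp
  rw [this]

/-- A family of distribution valued functions which depends additively on a time set, and whose
values are controlled by the integral of a density over the time set. -/
structure ForcedFamily (X : NormedFunctionSpace n) (q : ℝ≥0∞) (T : ℝ) (m : ℝ → ℝ) (C : ℝ≥0∞)
    (v : Set ℝ → ℝ → 𝓢'(Rn n, ℂ)) : Prop where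
  union : ∀ {A A' : Set ℝ}, MeasurableSet A → MeasurableSet A' → A ⊆ Ioc 0 T → A' ⊆ Ioc 0 T →
    Disjoint A A' → ∀ t, v (A ∪ A') t = v A t + v A' t
  -- This qualitative control serves only to discard sets of zero energy and to obtain weak
  -- convergence; the dependence of D on t and φ never enters the final constant.
  bound : ∀ t φ, ∃ D : ℝ, ∀ A, MeasurableSet A → A ⊆ Ioc 0 T → ‖v A t φ‖ ≤ D * √(∫ s in A, m s)
  measurable : ∀ A, MeasurableSet A → A ⊆ Ioc 0 T → Measurable fun t => X.nrm (v A t)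
  strichartz : ∀ A, MeasurableSet A → A ⊆ Ioc 0 T →
    timeNorm X.nrm q univ (v A) ≤ C * ENNReal.ofReal (√(∫ s in A, m s))

variable {X : NormedFunctionSpace n} {q : ℝ≥0∞} {C : ℝ≥0∞} {v : Set ℝ → ℝ → 𝓢'(Rn n, ℂ)}

/-- It makes plateaus of the primitive harmless: times with equal values of the primitive differ by
a set of zero energy. -/
theorem ForcedFamily.eq_zero (hv : ForcedFamily X q T m C v) {A : Set ℝ} (hA : MeasurableSet A)
    (hAT : A ⊆ Ioc 0 T) (h : ∫ s in A, m s ≤ 0) (t : ℝ) : v A t = 0 := by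
  ext φ
  obtain ⟨D, hD⟩ := hv.bound t φ
  have := hD A hA hAT
  rw [Real.sqrt_eq_zero_of_nonpos h, mul_zero] at this
  exact norm_le_zero_iff.1 this

/-- The supremum of the norms over the dyadic pieces of one generation. -/
noncomputable def dyadicSup (X : NormedFunctionSpace n) (v : Set ℝ → ℝ → 𝓢'(Rn n, ℂ)) (m : ℝ → ℝ)
    (B T : ℝ) (i : ℕ) (t : ℝ) : ℝ≥0∞ :=
  ⨆ k : Fin (2 ^ i), X.nrm (v (dyadicPiece m B T i k) t)

theorem ForcedFamily.nrm_succ_le (hv : ForcedFamily X q T m C v) (hm : Integrable m) (hB : 0 < B)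
    {i k : ℕ} (hk : k < 2 ^ i) (t : ℝ) : X.nrm (v (dyadicInit m B T i (k + 1)) t) ≤
      X.nrm (v (dyadicInit m B T i k) t) + dyadicSup X v m B T i t := by
  rw [← dyadicInit_union_dyadicPiece hB, hv.union (measurableSet_dyadicInit hm i k)
    (measurableSet_dyadicPiece hm i k) (fun s hs => hs.1) (fun s hs => hs.1)
    (disjoint_dyadicInit_dyadicPiece i k)]
  refine (X.nrm_add_le _ _).trans (add_le_add le_rfl ?_)
  exact le_iSup (fun k : Fin (2 ^ i) => X.nrm (v (dyadicPiece m B T i k) t)) ⟨k, hk⟩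

theorem setIntegral_primitive_le (hm : Integrable m) (h0 : ∀ s, 0 ≤ m s) {S : Set ℝ} {a b : ℝ}
    (hST : S ⊆ Ioc 0 T) (hab : a ≤ b) (h : ∀ s ∈ S, a ≤ primitive m s ∧ primitive m s ≤ b) :
    ∫ s in S, m s ≤ b - a :=
  setIntegral_le_of_primitive_mem_Icc hm h0 (hST.trans Ioc_subset_Icc_self) hab h

theorem primitive_nonneg (h0 : ∀ s, 0 ≤ m s) {t : ℝ} (ht : 0 ≤ t) : 0 ≤ primitive m t :=
  intervalIntegral.integral_nonneg ht fun x _ => h0 x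

theorem primitive_le (hm : Integrable m) (h0 : ∀ s, 0 ≤ m s) (hmB : ∫ s, m s ≤ B) {t : ℝ}
    (ht : 0 ≤ t) : primitive m t ≤ B := by
  rw [primitive, intervalIntegral.integral_of_le ht]
  exact (setIntegral_le_integral hm (ae_of_all _ h0)).trans hmB

/-- The floors are the truncated binary expansions of the energy fraction at time t. From one
generation to the next, k becomes 2k, which leaves the set unchanged, or 2k+1, which adds one piece
of the finer generation. -/
theorem ForcedFamily.nrm_dyadicInit_le (hv : ForcedFamily X q T m C v) (hm : Integrable m)
    (h0 : ∀ s, 0 ≤ m s) (hB : 0 < B) (hmB : ∫ s, m s ≤ B) {t : ℝ} (ht : 0 ≤ t) (i : ℕ) :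
    X.nrm (v (dyadicInit m B T i ⌊primitive m t / (B / 2 ^ i)⌋₊) t) ≤
      ∑ j ∈ Finset.range (i + 1), dyadicSup X v m B T j t := by
  have hM0 := primitive_nonneg h0 ht
  have hMB := primitive_le hm h0 hmB ht
  have hzero : X.nrm (v (dyadicInit m B T 0 0) t) = 0 := by
    rw [hv.eq_zero (measurableSet_dyadicInit hm 0 0) (fun s hs => hs.1) _ t, X.nrm_zero]
    refine (setIntegral_primitive_le hm h0 (fun s hs => hs.1) le_rfl (a := 0) (b := 0)
      fun s hs => ⟨primitive_nonneg h0 hs.1.1.le, ?_⟩).trans (by simp)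
    simpa using hs.2
  induction i with
  | zero =>
    have hk : ⌊primitive m t / (B / 2 ^ 0)⌋₊ ≤ 1 := by
      refine Nat.floor_le_one_of_le_one ?_
      rw [pow_zero, div_one]
      exact (div_le_one hB).2 hMB
    rcases Nat.le_one_iff_eq_zero_or_eq_one.1 hk with h | h
    · rw [h, hzero]; exact zero_le
    · rw [h]
      refine (hv.nrm_succ_le hm hB (k := 0) (by norm_num) t).trans ?_
      rw [hzero]; simp
  | succ i ih =>
    have hd : 0 < B / 2 ^ i := by positivity
    have hd' : 0 < B / 2 ^ (i + 1) := by positivity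
    set k := ⌊primitive m t / (B / 2 ^ i)⌋₊ with hk
    set k' := ⌊primitive m t / (B / 2 ^ (i + 1))⌋₊ with hk'
    have e : primitive m t / (B / 2 ^ (i + 1)) = 2 * (primitive m t / (B / 2 ^ i)) := by
      rw [pow_succ]; field_simp
    have l1 : (k : ℝ) ≤ primitive m t / (B / 2 ^ i) := Nat.floor_le (by positivity)
    have l2 : primitive m t / (B / 2 ^ i) < k + 1 := Nat.lt_floor_add_one _
    have l3 : (k' : ℝ) ≤ 2 * (primitive m t / (B / 2 ^ i)) := e ▸ Nat.floor_le (by positivity)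
    have l4 : 2 * (primitive m t / (B / 2 ^ i)) < k' + 1 := e ▸ Nat.lt_floor_add_one _
    have l5 : 2 * k < k' + 1 := by
      have : ((2 * k : ℕ) : ℝ) < ((k' + 1 : ℕ) : ℝ) := by push_cast; linarith
      exact_mod_cast this
    have l6 : k' < 2 * k + 2 := by
      have : ((k' : ℕ) : ℝ) < ((2 * k + 2 : ℕ) : ℝ) := by push_cast; linarith
      exact_mod_cast this
    -- Equality occurs when the primitive has reached B. In the odd case the added piece has index
    -- k'-1, which is still smaller than 2^(i+1).
    have l7 : k' ≤ 2 ^ (i + 1) := by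
      have h1 : primitive m t / (B / 2 ^ (i + 1)) ≤ 2 ^ (i + 1) := by
        rw [div_le_iff₀ hd', mul_div_cancel₀ _ (by positivity)]
        exact hMB
      have : (k' : ℝ) ≤ ((2 ^ (i + 1) : ℕ) : ℝ) := by
        push_cast
        exact (Nat.floor_le (by positivity)).trans h1
      exact_mod_cast this
    rw [Finset.sum_range_succ]
    rcases (by omega : k' = 2 * k ∨ k' = 2 * k + 1) with h | h
    · rw [h, dyadicInit_two_mul]
      exact ih.trans le_self_add
    · rw [h]
      refine (hv.nrm_succ_le hm hB (by omega) t).trans (add_le_add ?_ le_rfl)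
      rw [dyadicInit_two_mul]
      exact ih

/-- Truncating the binary expansion after generation i leaves out energy at most B/2^i. -/
theorem ForcedFamily.norm_sub_dyadicInit_le (hv : ForcedFamily X q T m C v) (hm : Integrable m)
    (h0 : ∀ s, 0 ≤ m s) (hB : 0 < B) {t : ℝ} (ht : t ∈ Ioc 0 T) {φ : 𝓢(Rn n, ℂ)} {D : ℝ}
    (hD : ∀ A, MeasurableSet A → A ⊆ Ioc 0 T → ‖v A t φ‖ ≤ D * √(∫ s in A, m s)) (hD0 : 0 ≤ D) (i : ℕ) :
    ‖v (Ioc 0 t) t φ - v (dyadicInit m B T i ⌊primitive m t / (B / 2 ^ i)⌋₊) t φ‖ ≤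
      D * √(B / 2 ^ i) := by
  have hd : 0 < B / 2 ^ i := by positivity
  have hmono : Monotone (primitive m) := monotone_primitive hm h0
  have hM0 := primitive_nonneg h0 ht.1.le
  set k := ⌊primitive m t / (B / 2 ^ i)⌋₊ with hk
  set A := dyadicInit m B T i k with hA
  have hAm : MeasurableSet A := measurableSet_dyadicInit hm i k
  have hAT : A ⊆ Ioc 0 T := fun s hs => hs.1
  have hI : Ioc 0 t ⊆ Ioc 0 T := Ioc_subset_Ioc_right ht.2
  have l1 : k * (B / 2 ^ i) ≤ primitive m t :=
    (le_div_iff₀ hd).1 (Nat.floor_le (by positivity))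
  have l2 : primitive m t < (k + 1) * (B / 2 ^ i) := (div_lt_iff₀ hd).1 (Nat.lt_floor_add_one _)
  -- At times after t that still belong to A the primitive lies between its value at t and kB/2^i,
  -- which is at most that value; it is therefore constant there and no energy is involved.
  have z : v (A \ Ioc 0 t) t = 0 := by
    refine hv.eq_zero (hAm.diff measurableSet_Ioc) (sdiff_subset.trans hAT) ?_ t
    refine (setIntegral_primitive_le hm h0 (sdiff_subset.trans hAT) le_rfl (a := primitive m t)
      fun s hs => ⟨hmono ?_, hs.1.2.trans l1⟩).trans (by simp)
    by_contra hst
    exact hs.2 ⟨hs.1.1.1, (not_le.1 hst).le⟩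
  have e1 : v (Ioc 0 t) t = v A t + v (Ioc 0 t \ A) t := by
    have h1 := hv.union measurableSet_Ioc (hAm.diff measurableSet_Ioc) hI (sdiff_subset.trans hAT)
      disjoint_sdiff_right t
    have h2 := hv.union hAm (measurableSet_Ioc.diff hAm) hAT (sdiff_subset.trans hI)
      disjoint_sdiff_right t
    rw [union_sdiff_self] at h1 h2
    rw [z, add_zero, union_comm, h2] at h1
    exact h1.symm
  have e2 : v (Ioc 0 t) t φ - v A t φ = v (Ioc 0 t \ A) t φ := by
    rw [e1]
    exact add_sub_cancel_left _ _
  rw [e2]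
  refine (hD _ (measurableSet_Ioc.diff hAm) (sdiff_subset.trans hI)).trans ?_
  gcongr
  refine (setIntegral_primitive_le hm h0 (sdiff_subset.trans hI) l1 fun s hs => ⟨?_, hmono hs.1.2⟩).trans
    (by linarith)
  by_contra hst
  exact hs.2 ⟨hI hs.1, (not_le.1 hst).le⟩

theorem ForcedFamily.nrm_le_tsum (hv : ForcedFamily X q T m C v) (hm : Integrable m)
    (h0 : ∀ s, 0 ≤ m s) (hB : 0 < B) (hmB : ∫ s, m s ≤ B) {t : ℝ} (ht : t ∈ Ioc 0 T) :
    X.nrm (v (Ioc 0 t) t) ≤ ∑' i, dyadicSup X v m B T i t := by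
  refine X.nrm_le_of_tendsto
    (u := fun i : ℕ => v (dyadicInit m B T i ⌊primitive m t / (B / 2 ^ i)⌋₊) t) (l := atTop)
    (fun φ => ?_) fun i => (hv.nrm_dyadicInit_le hm h0 hB hmB ht.1.le i).trans
      (ENNReal.sum_le_tsum _)
  obtain ⟨D, hD⟩ := hv.bound t φ
  have hD' : ∀ A, MeasurableSet A → A ⊆ Ioc 0 T → ‖v A t φ‖ ≤ |D| * √(∫ s in A, m s) :=
    fun A h1 h2 => (hD A h1 h2).trans (by gcongr; exact le_abs_self D)
  rw [tendsto_iff_norm_sub_tendsto_zero]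
  have hlim : Tendsto (fun i : ℕ => |D| * √(B / 2 ^ i)) atTop (𝓝 0) := by
    have h1 : Tendsto (fun i : ℕ => B / 2 ^ i) atTop (𝓝 0) :=
      tendsto_const_nhds.div_atTop (tendsto_pow_atTop_atTop_of_one_lt (by norm_num))
    have h2 := ((Real.continuous_sqrt.tendsto 0).comp h1).const_mul |D|
    simpa using h2
  refine squeeze_zero (fun _ => norm_nonneg _) (fun i => ?_) hlim
  rw [norm_sub_rev]
  exact hv.norm_sub_dyadicInit_le hm h0 hB ht hD' (abs_nonneg D) i

/-- The sum over all dyadic generations in the Christ–Kiselev lemma. -/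
noncomputable def dyadicConst (q : ℝ≥0∞) : ℝ≥0∞ :=
  ∑' i : ℕ, ENNReal.ofReal (2 ^ ((q⁻¹).toReal - 1 / 2)) ^ i

/-- The ratio 2^(1/q-1/2) is below 1 precisely because q > 2. -/
theorem dyadicConst_ne_top (hq : 2 < q) : dyadicConst q ≠ ∞ := by
  rw [dyadicConst, ENNReal.tsum_geometric]
  have h1 : (q⁻¹).toReal < 1 / 2 := by
    have h2 : q⁻¹ < 2⁻¹ := ENNReal.inv_lt_inv.2 hq
    have h3 := (ENNReal.toReal_lt_toReal h2.ne_top (by norm_num)).2 h2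
    simpa using h3
  have h4 : ENNReal.ofReal (2 ^ ((q⁻¹).toReal - 1 / 2)) < 1 := by
    rw [ENNReal.ofReal_lt_one]
    exact Real.rpow_lt_one_of_one_lt_of_neg (by norm_num) (by linarith)
  exact ENNReal.inv_ne_top.2 (tsub_pos_of_lt h4).ne'

theorem dyadic_weight_eq {p : ℝ} (hB : 0 < B) (i : ℕ) :
    ((2 ^ i : ℕ) : ℝ≥0∞) ^ p * ENNReal.ofReal (√(B / 2 ^ i)) =
      ENNReal.ofReal (√B) * ENNReal.ofReal (2 ^ (p - 1 / 2)) ^ i := by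
  have e1 : ((2 ^ i : ℕ) : ℝ≥0∞) ^ p = ENNReal.ofReal (((2 : ℝ) ^ i) ^ p) := by
    rw [← ENNReal.ofReal_rpow_of_pos (by positivity), ENNReal.ofReal_pow (by norm_num)]
    simp
  rw [e1, ← ENNReal.ofReal_pow (by positivity), ← ENNReal.ofReal_mul (by positivity),
    ← ENNReal.ofReal_mul (by positivity)]
  congr 1
  rw [Real.sqrt_div hB.le, Real.sqrt_eq_rpow (2 ^ i), ← Real.rpow_natCast, ← Real.rpow_natCast,
    ← Real.rpow_mul (by norm_num), ← Real.rpow_mul (by norm_num), ← Real.rpow_mul (by norm_num),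
    mul_div_assoc', mul_comm _ (√B), mul_div_assoc, ← Real.rpow_sub (by norm_num)]
  congr 2; ring

/-- The Christ–Kiselev lemma. -/
theorem ForcedFamily.timeNorm_le (hv : ForcedFamily X q T m C v) (hm : Integrable m)
    (h0 : ∀ s, 0 ≤ m s) (hB : 0 < B) (hmB : ∫ s, m s ≤ B) (hq : 2 < q) :
    timeNorm X.nrm q (Ioc 0 T) (fun t => v (Ioc 0 t) t) ≤
      C * dyadicConst q * ENNReal.ofReal (√B) := by
  have hq1 : 1 ≤ q := (by norm_num : (1 : ℝ≥0∞) ≤ 2).trans hq.le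
  have hmeas : ∀ i (k : Fin (2 ^ i)), Measurable fun t => X.nrm (v (dyadicPiece m B T i k) t) :=
    fun i k => hv.measurable _ (measurableSet_dyadicPiece hm i k) fun s hs => hs.1
  -- There are 2^i pieces, costing 2^(i/q), and each has energy at most B/2^i, gaining 2^(-i/2).
  have hone : ∀ i, eLpNorm (dyadicSup X v m B T i) q volume ≤
      C * ENNReal.ofReal (√B) * ENNReal.ofReal (2 ^ ((q⁻¹).toReal - 1 / 2)) ^ i := by
    intro i
    have hd : 0 < B / 2 ^ i := by positivity
    calc eLpNorm (dyadicSup X v m B T i) q volume ≤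
          ((2 ^ i : ℕ) : ℝ≥0∞) ^ (q⁻¹).toReal * (C * ENNReal.ofReal (√(B / 2 ^ i))) := by
          refine eLpNorm_iSup_fin_le (hmeas i) (zero_lt_one.trans_le hq1).ne' fun k => ?_
          have h1 := hv.strichartz _ (measurableSet_dyadicPiece (B := B) hm i k) fun s hs => hs.1
          rw [timeNorm, Measure.restrict_univ] at h1
          refine h1.trans ?_
          gcongr
          refine (setIntegral_primitive_le hm h0 (fun s hs => hs.1) ?_
            fun s hs => ⟨hs.2.1.le, hs.2.2⟩).trans ?_
          · gcongr
            exact Nat.le_succ _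
          · push_cast; linarith
      _ = C * (((2 ^ i : ℕ) : ℝ≥0∞) ^ (q⁻¹).toReal * ENNReal.ofReal (√(B / 2 ^ i))) := by ring
      _ = _ := by rw [dyadic_weight_eq hB]; ring
  calc timeNorm X.nrm q (Ioc 0 T) (fun t => v (Ioc 0 t) t)
      ≤ eLpNorm (fun t => ∑' i, dyadicSup X v m B T i t) q (volume.restrict (Ioc 0 T)) := by
        refine eLpNorm_mono_enorm_ae ?_
        filter_upwards [ae_restrict_mem measurableSet_Ioc] with t ht
        simpa using hv.nrm_le_tsum hm h0 hB hmB ht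
    _ ≤ eLpNorm (fun t => ∑' i, dyadicSup X v m B T i t) q volume :=
        eLpNorm_mono_measure _ Measure.restrict_le_self
    _ ≤ ∑' i, eLpNorm (dyadicSup X v m B T i) q volume :=
        eLpNorm_tsum_nat_le (fun i => Measurable.iSup (hmeas i)) hq1
    _ ≤ ∑' i : ℕ, C * ENNReal.ofReal (√B) * ENNReal.ofReal (2 ^ ((q⁻¹).toReal - 1 / 2)) ^ i :=
        ENNReal.tsum_le_tsum hone
    _ = _ := by rw [ENNReal.tsum_mul_left, dyadicConst]; ring

end ChristKiselev

/-! ### The waves as a forced family, and the conclusion. -/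

section WaveFamily

variable {n : ℕ} {f : ℝ → Rn n → ℂ} {N : ℕ} {T : ℝ} {A A' : Set ℝ}

theorem TemperateForcing.wave_union (hf : TemperateForcing f N) (hA : MeasurableSet A)
    (hA' : MeasurableSet A') (hAT : A ⊆ Ioc 0 T) (hAT' : A' ⊆ Ioc 0 T) (hd : Disjoint A A')
    (hU : MeasurableSet (A ∪ A')) (hUT : A ∪ A' ⊆ Ioc 0 T) (t : ℝ) :
    hf.wave hU hUT t = hf.wave hA hAT t + hf.wave hA' hAT' t := by
  ext Φ
  have hk : Continuous fun p : ℝ × Rn n => waveSin (t - p.1) p.2 :=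
    continuous_waveSin.comp (g := fun p : ℝ × Rn n => waveSin p.1 p.2)
      (f := fun p : ℝ × Rn n => (t - p.1, p.2)) (by fun_prop)
  have hC : ∀ s ∈ Ioc 0 T, ∀ ξ : Rn n, |waveSin (t - s) ξ| ≤ |t| + T := fun s hs ξ => by
    refine (abs_waveSin_le _ _).trans ((abs_sub _ _).trans ?_)
    rw [abs_of_pos hs.1]
    linarith [hs.2]
  change _ = hf.wave hA hAT t Φ + hf.wave hA' hAT' t Φ
  rw [hf.wave_apply, hf.wave_apply, hf.wave_apply, Measure.restrict_union hd hA', Measure.add_prod,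
    integral_add_measure]
  · exact hf.integrable_kernel_mul (k := fun s ξ => waveSin (t - s) ξ) hA hAT hk
      (fun s hs ξ => hC s (hAT hs) ξ) Φ
  · exact hf.integrable_kernel_mul (k := fun s ξ => waveSin (t - s) ξ) hA' hAT' hk
      (fun s hs ξ => hC s (hAT' hs) ξ) Φ

theorem SchwartzMap.lintegral_besselSymbol_smul_ne_top (b : ℝ) (Φ : 𝓢(Rn n, ℂ)) :
    ∫⁻ ξ, ‖besselSymbol ξ ^ (b / 2) • Φ ξ‖ₑ ^ 2 ≠ ∞ := by
  obtain ⟨M, hM⟩ := exists_nat_ge ((n : ℝ) + 1 + |b|)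
  obtain ⟨C, hC0, hC⟩ := Φ.exists_norm_le M
  have hfin := finite_integral_one_add_norm (E := Rn n) (μ := volume) (r := (n : ℝ) + 1) (by simp)
  set c : ℝ := (2 * (2 * Real.pi) ^ 2) ^ |b| * C ^ 2 with hc
  refine ne_top_of_le_ne_top (b := ENNReal.ofReal c * _)
    (ENNReal.mul_ne_top ENNReal.ofReal_ne_top hfin.ne) ?_
  rw [← lintegral_const_mul' _ _ ENNReal.ofReal_ne_top]
  refine lintegral_mono fun ξ => ?_
  simp only
  have hx : 0 < 1 + ‖ξ‖ := by positivity
  have hJ := besselSymbol_pos ξ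
  rw [enorm_besselSymbol_smul_sq, ← ofReal_norm, ← ENNReal.ofReal_pow (norm_nonneg _),
    ← ENNReal.ofReal_mul (by positivity), ← ENNReal.ofReal_mul (by positivity)]
  refine ENNReal.ofReal_le_ofReal ?_
  have h4 := one_add_norm_rpow_le_besselSymbol (-b) ξ
  rw [abs_neg] at h4
  have h5 : besselSymbol ξ ^ b ≤ (2 * (2 * Real.pi) ^ 2) ^ |b| * (1 + ‖ξ‖) ^ (2 * b) := by
    rw [Real.rpow_neg hJ.le, ← div_eq_mul_inv, le_div_iff₀ (by positivity), mul_neg,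
      Real.rpow_neg hx.le, inv_mul_le_iff₀ (by positivity), mul_comm ((1 + ‖ξ‖) ^ _)] at h4
    exact h4
  have h6 : ‖Φ ξ‖ ^ 2 ≤ C ^ 2 * (1 + ‖ξ‖) ^ (-(2 * M : ℝ)) := by
    have e : (1 + ‖ξ‖) ^ (-(2 * M : ℝ)) = (((1 + ‖ξ‖) ^ M)⁻¹) ^ 2 := by
      rw [Real.rpow_neg hx.le, inv_pow, ← pow_mul, ← Real.rpow_natCast]
      congr 2; push_cast; ring
    rw [e, ← mul_pow]
    exact pow_le_pow_left₀ (norm_nonneg _) (hC ξ) 2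
  calc _ ≤ ((2 * (2 * Real.pi) ^ 2) ^ |b| * (1 + ‖ξ‖) ^ (2 * b)) *
        (C ^ 2 * (1 + ‖ξ‖) ^ (-(2 * M : ℝ))) := by gcongr
    _ = c * (1 + ‖ξ‖) ^ (2 * b + -(2 * M : ℝ)) := by rw [hc, Real.rpow_add hx]; ring
    _ ≤ _ := by
        gcongr
        · linarith [norm_nonneg ξ]
        · have : (0 : ℝ) ≤ n := n.cast_nonneg
          linarith [le_abs_self b, abs_nonneg b]

theorem lintegral_energy_eq (γ : ℝ) (hf : Measurable (Function.uncurry f)) :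
    ∫⁻ p, ‖besselSymbol p.2 ^ ((γ - 1) / 2) • f p.1 p.2‖ₑ ^ 2 ∂((volume.restrict A).prod volume) =
      ∫⁻ s in A, energy γ f s := by
  rw [lintegral_prod _ ((measurable_weighted γ hf).enorm.pow_const 2).aemeasurable]
  rfl

/-- Duality between H^{γ-1} and H^{1-γ}, with Cauchy–Schwarz over A × ℝⁿ; the kernel is at most
|t|+T and A has measure at most T. -/
theorem TemperateForcing.exists_norm_wave_le (hf : TemperateForcing f N) (γ T t : ℝ)
    (Φ : 𝓢(Rn n, ℂ)) : ∃ D : ℝ≥0∞, D ≠ ∞ ∧ ∀ A (hA : MeasurableSet A) (hAT : A ⊆ Ioc 0 T),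
      ‖hf.wave hA hAT t Φ‖ₑ ≤ D * (∫⁻ s in A, energy γ f s) ^ (1 / 2 : ℝ) := by
  set K := ∫⁻ ξ, ‖besselSymbol ξ ^ ((1 - γ) / 2) • Φ ξ‖ₑ ^ 2 with hK
  have hKfin : K ≠ ∞ := Φ.lintegral_besselSymbol_smul_ne_top (1 - γ)
  set c := ENNReal.ofReal (|t| + T)
  refine ⟨c * (ENNReal.ofReal T * K) ^ (1 / 2 : ℝ), ?_, fun A hA hAT => ?_⟩
  · exact ENNReal.mul_ne_top ENNReal.ofReal_ne_top (ENNReal.rpow_ne_top_of_nonneg (by norm_num)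
      (ENNReal.mul_ne_top ENNReal.ofReal_ne_top hKfin))
  have hwm : Measurable fun p : ℝ × Rn n => besselSymbol p.2 ^ ((1 - γ) / 2) • Φ p.2 :=
    ((continuous_besselSymbol.measurable.comp measurable_snd).pow_const _).smul
      (Φ.continuous.measurable.comp measurable_snd)
  have hvol : volume A ≤ ENNReal.ofReal T := (measure_mono hAT).trans (by simp)
  have h1 : ‖hf.wave hA hAT t Φ‖ₑ ≤ c * ∫⁻ p, ‖besselSymbol p.2 ^ ((1 - γ) / 2) • Φ p.2‖ₑ *
      ‖besselSymbol p.2 ^ ((γ - 1) / 2) • f p.1 p.2‖ₑ ∂((volume.restrict A).prod volume) := by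
    rw [hf.wave_apply, ← lintegral_const_mul' _ _ ENNReal.ofReal_ne_top]
    refine (enorm_integral_le_lintegral_enorm _).trans (lintegral_mono_ae ?_)
    filter_upwards [ae_prod_restrict_mem hA] with p hp
    have hJ := besselSymbol_pos p.2
    have e1 : ‖besselSymbol p.2 ^ ((1 - γ) / 2) • Φ p.2‖ₑ *
        ‖besselSymbol p.2 ^ ((γ - 1) / 2) • f p.1 p.2‖ₑ = ‖Φ p.2 * f p.1 p.2‖ₑ := by
      rw [← enorm_mul, smul_mul_smul_comm, ← Real.rpow_add hJ]
      have : (1 - γ) / 2 + (γ - 1) / 2 = 0 := by ring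
      rw [this, Real.rpow_zero, one_smul]
    rw [e1, enorm_mul]
    gcongr
    rw [← ofReal_norm, Complex.norm_real, Real.norm_eq_abs]
    refine ENNReal.ofReal_le_ofReal ((abs_waveSin_le _ _).trans ((abs_sub _ _).trans ?_))
    rw [abs_of_pos (hAT hp).1]
    linarith [(hAT hp).2]
  refine h1.trans ?_
  rw [mul_assoc]
  refine mul_le_mul' le_rfl ?_
  rw [← ENNReal.mul_rpow_of_nonneg _ _ (by norm_num), one_div, ENNReal.le_rpow_inv_iff (by norm_num),
    ENNReal.rpow_ofNat]
  refine (lintegral_mul_sq_le hwm.enorm.aemeasurable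
    (measurable_weighted γ hf.1).enorm.aemeasurable).trans ?_
  rw [lintegral_energy_eq γ hf.1]
  refine mul_le_mul' ?_ le_rfl
  rw [lintegral_prod _ (hwm.enorm.pow_const 2).aemeasurable]
  simp only [lintegral_const, Measure.restrict_apply MeasurableSet.univ, univ_inter]
  rw [mul_comm]
  exact mul_le_mul' hvol le_rfl

/-- The energy density on the positive half line. -/
noncomputable def energyDensity (γ : ℝ) (f : ℝ → Rn n → ℂ) : ℝ → ℝ :=
  (Ioi (0 : ℝ)).indicator fun s => (energy γ f s).toReal

theorem energyDensity_nonneg (γ : ℝ) (f : ℝ → Rn n → ℂ) (s : ℝ) : 0 ≤ energyDensity γ f s :=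
  indicator_nonneg (fun _ _ => ENNReal.toReal_nonneg) s

theorem integrable_energyDensity {γ : ℝ} (hf : Measurable (Function.uncurry f))
    (hfin : ∫⁻ s in Ioi (0 : ℝ), energy γ f s ≠ ∞) : Integrable (energyDensity γ f) :=
  (integrable_indicator_iff measurableSet_Ioi).2
    (integrable_toReal_of_lintegral_ne_top (measurable_energy γ hf).aemeasurable hfin)

theorem setIntegral_energyDensity {γ : ℝ} (hf : Measurable (Function.uncurry f))
    (hfin : ∫⁻ s in Ioi (0 : ℝ), energy γ f s ≠ ∞) (hA : MeasurableSet A) (hA0 : A ⊆ Ioi 0) :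
    ENNReal.ofReal (∫ s in A, energyDensity γ f s) = ∫⁻ s in A, energy γ f s := by
  have hle := lintegral_mono_set (f := energy γ f) (μ := volume) hA0
  have h1 : ∫ s in A, energyDensity γ f s = ∫ s in A, (energy γ f s).toReal :=
    setIntegral_congr_fun hA fun s hs => indicator_of_mem (hA0 hs) _
  rw [h1, integral_toReal (measurable_energy γ hf).aemeasurable
    (ae_lt_top (measurable_energy γ hf) (ne_top_of_le_ne_top hfin hle)), ENNReal.ofReal_toReal
      (ne_top_of_le_ne_top hfin hle)]

theorem ofReal_sqrt_eq_rpow (x : ℝ) :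
    ENNReal.ofReal (√x) = ENNReal.ofReal x ^ (1 / 2 : ℝ) := by
  rcases le_total 0 x with h | h
  · rw [Real.sqrt_eq_rpow, ENNReal.ofReal_rpow_of_nonneg h (by norm_num)]
  · rw [Real.sqrt_eq_zero_of_nonpos h, ENNReal.ofReal_of_nonpos h]; simp

open scoped Classical in
/-- The waves generated by the forcing on subsets of `(0, T]`. -/
noncomputable def TemperateForcing.waveFamily (hf : TemperateForcing f N) (T : ℝ) (A : Set ℝ)
    (t : ℝ) : 𝓢'(Rn n, ℂ) :=
  if h : MeasurableSet A ∧ A ⊆ Ioc 0 T then 𝓕⁻ (hf.wave h.1 h.2 t) else 0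

theorem TemperateForcing.waveFamily_eq (hf : TemperateForcing f N) (hA : MeasurableSet A)
    (hAT : A ⊆ Ioc 0 T) (t : ℝ) : hf.waveFamily T A t = 𝓕⁻ (hf.wave hA hAT t) :=
  dif_pos ⟨hA, hAT⟩

theorem TemperateForcing.forcedFamily (hf : TemperateForcing f N) {γ : ℝ}
    (hfin : ∫⁻ s in Ioi (0 : ℝ), energy γ f s ≠ ∞) {X : NormedFunctionSpace n} {q C : ℝ≥0∞}
    (hS : ∀ A (hA : MeasurableSet A) (hAT : A ⊆ Ioc 0 T),
      timeNorm X.nrm q univ (fun t => 𝓕⁻ (hf.wave hA hAT t)) ≤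
        C * (∫⁻ s in A, energy γ f s) ^ (1 / 2 : ℝ)) :
    ForcedFamily X q T (energyDensity γ f) C (hf.waveFamily T) where
  union {A A'} hA hA' hAT hAT' hd t := by
    rw [hf.waveFamily_eq (hA.union hA') (union_subset hAT hAT'), hf.waveFamily_eq hA hAT,
      hf.waveFamily_eq hA' hAT', hf.wave_union hA hA' hAT hAT' hd, FourierTransform.fourierInv_add]
  bound t φ := by
    obtain ⟨D, hD, h⟩ := hf.exists_norm_wave_le γ T t (𝓕⁻ φ)
    refine ⟨D.toReal, fun A hA hAT => ?_⟩
    have h1 := h A hA hAT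
    have hA0 : A ⊆ Ioi 0 := hAT.trans Ioc_subset_Ioi_self
    rw [← setIntegral_energyDensity hf.1 hfin hA hA0, ← ofReal_sqrt_eq_rpow,
      ← ENNReal.ofReal_toReal hD, ← ENNReal.ofReal_mul ENNReal.toReal_nonneg] at h1
    rw [hf.waveFamily_eq hA hAT, TemperedDistribution.fourierInv_apply]
    rw [← ofReal_norm] at h1
    exact (ENNReal.ofReal_le_ofReal_iff (by positivity)).1 h1
  measurable A hA hAT := by
    simp_rw [hf.waveFamily_eq hA hAT]
    exact X.measurable_nrm fun φ => continuous_iff_continuousAt.2 fun t =>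
      (hasDerivAt_toDist_freeHat (hf.temperateL1_sinCoef hA hAT) (hf.temperateL1_cosCoef hA hAT)
        (𝓕⁻ φ) t).continuousAt
  strichartz A hA hAT := by
    have h1 := hS A hA hAT
    rw [← setIntegral_energyDensity hf.1 hfin hA (hAT.trans Ioc_subset_Ioi_self),
      ← ofReal_sqrt_eq_rpow] at h1
    refine le_trans (le_of_eq ?_) h1
    congr 1; ext t : 1
    exact hf.waveFamily_eq hA hAT t

end WaveFamily

theorem proposition2p1 (n : ℕ) (hn : 2 ≤ n) (X : NormedFunctionSpace n) (γ : ℝ)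
    (hγ : -((n : ℝ) - 3) / 2 ≤ γ) (q : ℝ≥0∞) (hq : 2 < q) (hX : FreeStrichartz X γ q)
    (R : ℝ) (hR : 0 < R) :
    ∃ C : ℝ≥0, ∀ w w' F : ℝ → 𝓢'(Rn n, ℂ),
      IsWaveSolutionOn (Ici 0) w w' F → w 0 = 0 → w' 0 = 0 →
      (∀ᵐ t ∂(volume.restrict (Ioi (0 : ℝ))),
        Distribution.IsVanishingOn (F t) {x : Rn n | 2 * R < ‖x‖}) →
      timeNorm (sobolevNorm (γ - 1)) 2 (Ioi 0) F < ∞ →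
      timeNorm X.nrm q (Ioi 0) w ≤ C * timeNorm (sobolevNorm (γ - 1)) 2 (Ioi 0) F := by
  obtain ⟨ψ, hψ⟩ := exists_fourier_forcing n hR
  obtain ⟨N, hN⟩ := exists_temperateForcing n γ
  obtain ⟨C, hC, hS⟩ := exists_timeNorm_wave_le hn ψ hγ hX
  have hCtop : C * dyadicConst q ≠ ∞ := ENNReal.mul_ne_top hC (dyadicConst_ne_top hq)
  refine ⟨(C * dyadicConst q).toNNReal, fun w w' F hw h0 h0' hvan hFfin => ?_⟩
  rw [ENNReal.coe_toNNReal hCtop]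
  obtain ⟨f, hfm, hf⟩ := hψ F (fun φ t ht => (hw φ t ht).2.1) hvan
  have hEq : timeNorm (sobolevNorm (γ - 1)) 2 (Ioi 0) F ^ 2 = ∫⁻ s in Ioi (0 : ℝ), energy γ f s := by
    rw [timeNorm, ← lintegral_enorm_sq_eq_eLpNorm_sq]
    refine lintegral_congr_ae ?_
    filter_upwards [hf] with s hs
    rw [enorm_eq_self, sobolevNorm_sq_eq_energy hs.1]
  have hfin : ∫⁻ s in Ioi (0 : ℝ), energy γ f s ≠ ∞ := hEq ▸ (ENNReal.pow_lt_top hFfin).ne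
  have hF := hN f hfm hfin
  have hrep : ∀ᵐ s ∂(volume.restrict (Ioi 0)), IsRepresentedBy (𝓕 (F s)) (f s) :=
    hf.mono fun s hs => hs.1
  -- The solution is the diagonal of the family, with the time set (0, t] evaluated at t. This is
  -- the form required by the Christ–Kiselev argument.
  have hwave : ∀ T t, t ∈ Ioc 0 T → w t = hF.waveFamily T (Ioc 0 t) t := fun T t ht => by
    have h1 := hw.fourier_eq h0 h0' hF hrep ht.1.le
    rw [hF.waveFamily_eq measurableSet_Ioc (Ioc_subset_Ioc_right ht.2)]
    have h2 := congrArg (fun u : 𝓢'(Rn n, ℂ) => (𝓕⁻ u : 𝓢'(Rn n, ℂ))) h1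
    simp only [FourierTransform.fourierInv_fourier_eq] at h2
    exact h2
  set E := ∫ s, energyDensity γ f s with hE
  have hm := integrable_energyDensity hfm hfin
  have hE0 : 0 ≤ E := integral_nonneg (energyDensity_nonneg γ f)
  have hroot : ENNReal.ofReal (√E) = timeNorm (sobolevNorm (γ - 1)) 2 (Ioi 0) F := by
    have h1 := setIntegral_energyDensity hfm hfin measurableSet_Ioi subset_rfl
    have h2 : ∫ s in Ioi 0, energyDensity γ f s = E := by
      refine setIntegral_eq_integral_of_forall_compl_eq_zero fun s hs => ?_
      exact indicator_of_notMem hs _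
    rw [h2, ← hEq] at h1
    rw [ofReal_sqrt_eq_rpow, h1, ← ENNReal.rpow_ofNat, ← ENNReal.rpow_mul]
    norm_num
  -- The dyadic decomposition needs B > 0, while the total energy E may vanish; every B > E is
  -- admissible and B decreases to E at the end.
  have hB : ∀ B, E < B → timeNorm X.nrm q (Ioi 0) w ≤ C * dyadicConst q * ENNReal.ofReal (√B) := by
    intro B hB
    have hU : Ioi (0 : ℝ) = ⋃ j : ℕ, Ioc (0 : ℝ) j := by
      ext x
      simp only [mem_Ioi, mem_iUnion, mem_Ioc]
      exact ⟨fun hx => (exists_nat_ge x).imp fun m hm => ⟨hx, hm⟩, fun ⟨m, hm⟩ => hm.1⟩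
    rw [timeNorm, hU]
    -- The constant does not depend on the length of the time interval, so exhausting (0, ∞) by the
    -- intervals (0, j] loses nothing.
    refine eLpNorm_restrict_iUnion_le
      (fun i j hij => Ioc_subset_Ioc_right (Nat.cast_le.2 hij)) (zero_lt_two.trans hq).ne' fun j => ?_
    have hfam : ForcedFamily X q j (energyDensity γ f) C (hF.waveFamily j) :=
      hF.forcedFamily hfin fun A hA hAT => hS f N A j hF hA hAT
        (ae_restrict_of_ae_restrict_of_subset (hAT.trans Ioc_subset_Ioi_self)
          (hf.mono fun s hs ξ => (hs.2 ξ).2))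
        (ne_top_of_le_ne_top hfin (lintegral_mono_set (hAT.trans Ioc_subset_Ioi_self)))
    refine le_trans (le_of_eq ?_) (hfam.timeNorm_le hm (energyDensity_nonneg γ f)
      (hE0.trans_lt hB) hB.le hq)
    refine eLpNorm_congr_ae ?_
    filter_upwards [ae_restrict_mem measurableSet_Ioc] with t ht
    rw [hwave j t ht]
  rw [← hroot]
  have hlim : Filter.Tendsto (fun B => C * dyadicConst q * ENNReal.ofReal (√B)) (nhdsWithin E (Ioi E))
      (nhds (C * dyadicConst q * ENNReal.ofReal (√E))) := by
    refine ENNReal.Tendsto.const_mul ?_ (Or.inr hCtop)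
    exact ((ENNReal.continuous_ofReal.comp Real.continuous_sqrt).tendsto E).mono_left
      nhdsWithin_le_nhds
  exact ge_of_tendsto hlim (by filter_upwards [self_mem_nhdsWithin] with B hB' using hB B hB')
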